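/- Let $d\ge 1$, $K>0$, and let $U$ be a non-negative real polynomial of degree $4$ with positive leading coefficient. For $i,j\in\mathbb Z^d$ put $|i-j|=\sum_{\ell=1}^d|i_\ell-j_\ell|$. Let $\mathcal X=(\mathbb R^2)^{\mathbb Z^d}$, with the product topology, be the set of states $x=\{x_i\}=\{(q_i,p_i)\}_{i\in\mathbb Z^d}$, and consider the equations of motion $$\dot q_i=p_i,\qquad \dot p_i=-U'(q_i)-K\sum_{j:|j-i|=1}(q_i-q_j),\qquad i\in\mathbb Z^d. \tag{1}$$ For $\nu\in\mathbb Z^d$ and $k\in\mathbb N$ let $\Lambda_{\nu,k}$ be the cube of center $\nu$ and side $2k+1$, and $$W_{\nu,k}(x)=\sum_{i\in\Lambda_{\nu,k}}\Big\{\frac{p_i^2}{2}+U(q_i)+1\Big\}+\sum_{i,j\in\Lambda_{\nu,k},\,|i-j|=1}\frac K4(q_i-q_j)^2,\qquad Q(x)=\sup_{\nu\in\mathbb Z^d}\ \sup_{k>\log^{1/d}(e+|\nu|)}\frac{W_{\nu,k}(x)}{(2k+1)^d},$$ where the second sum in $W_{\nu,k}$ is over ordered pairs, and let $\mathcal X_0=\{x\in\mathcal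 X: Q(x)<\infty\}$. For each $x\in\mathcal X_0$ there is exactly one solution $t\mapsto\Phi_t(x)$, $t\in\mathbb R$, of (1) with $\Phi_0(x)=x$ along which $Q$ is bounded on bounded time intervals, and $\Phi_t(x)_j$ is differentiable with respect to $x_i=(q_i,p_i)$ for all $i,j\in\mathbb Z^d$ and $t\in\mathbb R$. For an observable $F$ write $\Phi_tF=F\circ\Phi_t$, and let $$\{F,G\}=\sum_{k\in\mathbb Z^d}\Big(\frac{\partial F}{\partial q_k}\frac{\partial G}{\partial p_k}-\frac{\partial F}{\partial p_k}\frac{\partial G}{\partial q_k}\Big)$$ be the Poisson bracket. Let $\omega$ be a Borel probability measure on $\mathcal X$ such that (i) there is a constant $C_\omega>0$ such that, for all sufficiently small $\lambda>0$, $\int e^{\lambda W_{\nu,k}}\,d\omega\le e^{C_\omega(2k+1)^d}$ for all $\nu\in\mathbb Z^d$ and $k\in\mathbb N$; (ii) $\int \Phi_tF\,d\omega=\int F\,d\omega$ for all $t\in\mathbb R$ and every $F$ that is a function of finitely many of the variables $x_i$, differentiable, and bounded together with its first derivatives. Then $\omega(\mathcal X_0)=1$ and, for all differentiable $f,g:\mathbb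 R^2\to\mathbb R$ that are bounded together with their first derivatives, all $\alpha>1/2$, all $b>0$ and all $i\in\mathbb Z^d$, writing $f_i(x)=f(x_i)$ and $g_j(x)=g(x_j)$, $$\lim_{t\to\infty}\ \sup_{j\,:\,|i-j|>t\log^\alpha t}e^{bt}\,\big|\{f_i,\Phi_tg_j\}(x)\big|=0\qquad\text{for }\omega\text{-almost every }x.$$ -/

import Mathlib

open MeasureTheory Filter Topology
open scoped ENNReal NNReal

noncomputable section

namespace AnharmonicLattice

/-- The lattice `ℤ^d`. -/
abbrev Site (d : ℕ) : Type := Fin d → ℤ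

/-- The states `x = (q_i, p_i)_{i ∈ ℤ^d}`; the topology is the product topology, and the (product)
σ-algebra is its Borel σ-algebra, the index set being countable. -/
abbrev Config (d : ℕ) : Type := Site d → ℝ × ℝ

/-- The distance `|i - j| = ∑ l, |i_l - j_l|` on `ℤ^d`. -/
def siteDist {d : ℕ} (i j : Site d) : ℤ := ∑ l, |i l - j l|

/-- The sites `j` with `|j - i| = 1` (see `mem_neighbors`). -/
def neighbors {d : ℕ} (i : Site d) : Finset (Site d) :=
  (Finset.Icc (fun l => i l - 1) (fun l => i l + 1)).filter (fun j => siteDist j i = 1)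

theorem mem_neighbors {d : ℕ} (i j : Site d) : j ∈ neighbors i ↔ siteDist j i = 1 := by
  unfold neighbors
  rw [Finset.mem_filter, Finset.mem_Icc, and_iff_right_iff_imp]
  intro h
  have key : ∀ l, |j l - i l| ≤ 1 := fun l => by
    rw [← h]
    exact Finset.single_le_sum (f := fun l => |j l - i l|) (fun _ _ => abs_nonneg _)
      (Finset.mem_univ l)
  constructor <;> intro l <;> have := abs_le.mp (key l) <;> simp only <;> omega

/-- The cube `Λ_{ν,k}` of center `ν` and side `2k+1`. -/
def cube {d : ℕ} (ν : Site d) (k : ℕ) : Finset (Site d) :=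
  Finset.Icc (fun l => ν l - (k : ℤ)) (fun l => ν l + (k : ℤ))

/-- The force `F_i(x) = - U'(q_i) - K ∑_{|j-i|=1} (q_i - q_j)`. -/
def force {d : ℕ} (U : Polynomial ℝ) (K : ℝ) (i : Site d) (x : Config d) : ℝ :=
  -(U.derivative.eval (x i).1) - K * ∑ j ∈ neighbors i, ((x i).1 - (x j).1)

/-- The local energy `W_{ν,k}(x)`; the second sum runs over ordered pairs of neighbors. -/
def localEnergy {d : ℕ} (U : Polynomial ℝ) (K : ℝ) (ν : Site d) (k : ℕ) (x : Config d) : ℝ :=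
  ∑ i ∈ cube ν k, ((x i).2 ^ 2 / 2 + U.eval (x i).1 + 1) +
    ∑ i ∈ cube ν k, ∑ j ∈ (cube ν k).filter (fun j => siteDist j i = 1),
      K / 4 * ((x i).1 - (x j).1) ^ 2

/-- `Q(x) = sup_ν sup_{k > log^{1/d}(e+|ν|)} W_{ν,k}(x) / (2k+1)^d`, with values in `[0,∞]`
(the energies `W_{ν,k}` are positive when `U ≥ 0` and `K > 0`). -/
def Q {d : ℕ} (U : Polynomial ℝ) (K : ℝ) (x : Config d) : ℝ≥0∞ :=
  ⨆ (ν : Site d) (k : ℕ)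
    (_ : Real.log (Real.exp 1 + (siteDist ν 0 : ℝ)) ^ (1 / (d : ℝ)) < (k : ℝ)),
      ENNReal.ofReal (localEnergy U K ν k x / (2 * (k : ℝ) + 1) ^ d)

/-- The set `X₀` of the states with `Q(x) < ∞`. -/
def X0 {d : ℕ} (U : Polynomial ℝ) (K : ℝ) : Set (Config d) := {x | Q U K x < ∞}

/-- A global solution of the equations of motion `q̇_i = p_i`, `ṗ_i = F_i(x)` that moves inside
`X₀`, with `Q` bounded on bounded time intervals. (Some growth condition in space is needed for
uniqueness of solutions of the infinite system.) -/
structure IsSolution {d : ℕ} (U : Polynomial ℝ) (K : ℝ) (γ : ℝ → Config d) : Prop where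
  deriv_q : ∀ (i : Site d) (t : ℝ), HasDerivAt (fun s => (γ s i).1) (γ t i).2 t
  deriv_p : ∀ (i : Site d) (t : ℝ), HasDerivAt (fun s => (γ s i).2) (force U K i (γ t)) t
  locally_bounded : ∀ T : ℝ, ∃ M : ℝ≥0, ∀ t : ℝ, |t| ≤ T → Q U K (γ t) ≤ M

open Classical in
/-- The time evolution `Φ_t(x)`: the position at time `t` of the solution that starts from `x`.
(States from which no solution starts, all outside `X₀`, are left fixed.) -/
def flow {d : ℕ} (U : Polynomial ℝ) (K : ℝ) (t : ℝ) (x : Config d) : Config d :=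
  if h : ∃ γ : ℝ → Config d, IsSolution U K γ ∧ γ 0 = x then h.choose t else x

/-- A differentiable function that is bounded together with its derivative. -/
def BoundedDifferentiable {E : Type*} [NormedAddCommGroup E] [NormedSpace ℝ E] (φ : E → ℝ) :
    Prop :=
  Differentiable ℝ φ ∧ ∃ C : ℝ, ∀ y, |φ y| ≤ C ∧ ‖fderiv ℝ φ y‖ ≤ C

/-- The local observables: bounded differentiable functions, with bounded derivatives, of
finitely many of the variables `x_i`. -/
def IsLocalObservable {d : ℕ} (F : Config d → ℝ) : Prop :=
  ∃ (Λ : Finset (Site d)) (φ : (Λ → ℝ × ℝ) → ℝ),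
    BoundedDifferentiable φ ∧ ∀ x, F x = φ (fun i => x i)

/-- The superstability estimate: there is `C > 0` such that, for all small `λ > 0`,
`ω(e^{λ W_{ν,k}}) ≤ e^{C (2k+1)^d}` for all `ν`, `k`. -/
def Superstable {d : ℕ} (U : Polynomial ℝ) (K : ℝ) (ω : Measure (Config d)) : Prop :=
  ∃ C : ℝ, 0 < C ∧ ∃ lam₀ : ℝ, 0 < lam₀ ∧ ∀ lam : ℝ, 0 < lam → lam < lam₀ →
    ∀ (ν : Site d) (k : ℕ),
      ∫⁻ x, ENNReal.ofReal (Real.exp (lam * localEnergy U K ν k x)) ∂ω ≤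
        ENNReal.ofReal (Real.exp (C * (2 * (k : ℝ) + 1) ^ d))

/-- `ω(Φ_t F) = ω(F)` for all local observables `F` and all times `t`. -/
def TimeInvariant {d : ℕ} (U : Polynomial ℝ) (K : ℝ) (ω : Measure (Config d)) : Prop :=
  ∀ F : Config d → ℝ, IsLocalObservable F → ∀ t : ℝ,
    ∫ x, F (flow U K t x) ∂ω = ∫ x, F x ∂ω

/-- `∂F/∂q_i` at `x`. -/
def partialQ {d : ℕ} (i : Site d) (F : Config d → ℝ) (x : Config d) : ℝ :=
  deriv (fun s : ℝ => F (Function.update x i (s, (x i).2))) (x i).1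

/-- `∂F/∂p_i` at `x`. -/
def partialP {d : ℕ} (i : Site d) (F : Config d → ℝ) (x : Config d) : ℝ :=
  deriv (fun s : ℝ => F (Function.update x i ((x i).1, s))) (x i).2

/-- The Poisson bracket `{F, G}(x)`; only finitely many terms of the sum are nonzero if `F` or `G`
depends on finitely many sites. -/
def poissonBracket {d : ℕ} (F G : Config d → ℝ) (x : Config d) : ℝ :=
  ∑' i : Site d, (partialQ i F x * partialP i G x - partialP i F x * partialQ i G x)

/-- The single-site observable `f_i(x) = f(x_i)`. -/
def siteObs {d : ℕ} (f : ℝ × ℝ → ℝ) (i : Site d) : Config d → ℝ := fun x => f (x i)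

/-- `Φ_t F (x) = F(Φ_t(x))`. -/
def evolve {d : ℕ} (U : Polynomial ℝ) (K : ℝ) (t : ℝ) (F : Config d → ℝ) : Config d → ℝ :=
  fun x => F (flow U K t x)

end AnharmonicLattice

end

noncomputable section

namespace AnharmonicLattice

/-!
The site energies `E_i`, which share each bond equally between its ends, satisfy
`|d/dt E_i| ≤ A ∑ E_j` over the sites `j` near `i`. Averaging them with exponentially decaying
weights turns this into a Gronwall estimate, which propagates the logarithmic energy bounds that
define `X₀`.

Differences of solutions satisfy a linear lattice inequality `‖u_k'‖ ≤ A_k ∑ ‖u_j‖ + b_k`. As the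
force is quadratic in `q` up to constants and `q ^ 4` is bounded by the energy, `A_k` grows like
`√(log |k|)`. The weights `exp ((σ + s / T) |k - c| + ρ s)`, whose rate in space increases with
time, gain `|k - c| / T` under differentiation in `s`. This beats every sublinear `A_k`, so these
weights are supersolutions. The comparison gives uniqueness, existence as a limit of finite
systems, and differentiability in the initial state.

In an invariant superstable state, Chebyshev's inequality and the Borel-Cantelli lemma over all
cubes and all integer times bound the energy of almost every trajectory at the site `ν` and the
time `s` by a multiple of `log (e + |ν| + |s|)`. Then the rate `ρ` for the perturbations of the
site `i` on `[-2 t, 2 t]` can be taken of order `√(log t)`, and the initial rate `σ = -1` has only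
grown to `-1/2` at the time `t`. The bracket is thus at most a multiple of
`exp (-|i - j| / 2 + O(t √(log t)))`, and `t log^α t` with `α > 1/2` wins against `t √(log t)`.
-/

open Set

/-! ### Geometry of the lattice -/

section Geometry

variable {d : ℕ}

/-- The distance `|i - j|` of `ℤ^d` as a real number, for use in exponents. -/
def sdist (i j : Site d) : ℝ := (siteDist i j : ℝ)

/-- The sites at distance at most `1` from `i`: the sites on which the force at `i` depends. -/
def closedNeighbors (i : Site d) : Finset (Site d) := insert i (neighbors i)

lemma siteDist_comm (i j : Site d) : siteDist i j = siteDist j i :=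
  Finset.sum_congr rfl fun _ _ => abs_sub_comm _ _

lemma siteDist_self (i : Site d) : siteDist i i = 0 := by simp [siteDist]

lemma sdist_nonneg (i j : Site d) : 0 ≤ sdist i j := by
  unfold sdist siteDist
  positivity

lemma sdist_comm (i j : Site d) : sdist i j = sdist j i := by
  unfold sdist; rw [siteDist_comm]

lemma sdist_triangle (i j k : Site d) : sdist i k ≤ sdist i j + sdist j k := by
  unfold sdist siteDist
  rw [← Int.cast_add, ← Finset.sum_add_distrib]
  exact_mod_cast Finset.sum_le_sum fun l _ => abs_sub_le (i l) (j l) (k l)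

lemma sdist_self (i : Site d) : sdist i i = 0 := by simp [sdist, siteDist_self]

lemma self_mem_closedNeighbors (i : Site d) : i ∈ closedNeighbors i := Finset.mem_insert_self _ _

lemma neighbors_subset_closedNeighbors (i : Site d) : neighbors i ⊆ closedNeighbors i :=
  Finset.subset_insert _ _

lemma mem_closedNeighbors_comm {i j : Site d} : i ∈ closedNeighbors j ↔ j ∈ closedNeighbors i := by
  simp only [closedNeighbors, Finset.mem_insert, mem_neighbors, siteDist_comm i j, eq_comm]

lemma siteDist_le_one_of_mem_closedNeighbors {i j : Site d} (h : j ∈ closedNeighbors i) :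
    siteDist j i ≤ 1 := by
  rcases Finset.mem_insert.mp h with rfl | h
  · simp [siteDist_self]
  · exact ((mem_neighbors _ _).mp h).le

lemma abs_sdist_sub_le_one {i j : Site d} (h : j ∈ closedNeighbors i) (c : Site d) :
    |sdist j c - sdist i c| ≤ 1 := by
  have hji : sdist j i ≤ 1 := by
    unfold sdist; exact_mod_cast siteDist_le_one_of_mem_closedNeighbors h
  have h₁ := sdist_triangle j i c
  have h₂ := sdist_triangle i j c
  rw [sdist_comm i j] at h₂
  exact abs_le.mpr ⟨by linarith, by linarith⟩

lemma abs_sub_le_siteDist (i j : Site d) (l : Fin d) : |i l - j l| ≤ siteDist i j :=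
  Finset.single_le_sum (f := fun l => |i l - j l|) (fun _ _ => abs_nonneg _) (Finset.mem_univ l)

lemma mem_cube {ν i : Site d} {k : ℕ} : i ∈ cube ν k ↔ ∀ l, |i l - ν l| ≤ k := by
  simp only [cube, Finset.mem_Icc, Pi.le_def, ← forall_and]
  refine forall_congr' fun l => ?_
  rw [abs_le]
  constructor <;> rintro ⟨h₁, h₂⟩ <;> constructor <;> linarith

lemma self_mem_cube (ν : Site d) (k : ℕ) : ν ∈ cube ν k := by simp [mem_cube]

lemma mem_cube_of_siteDist_le {ν i : Site d} {k : ℕ} (h : siteDist i ν ≤ k) : i ∈ cube ν k :=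
  mem_cube.mpr fun l => (abs_sub_le_siteDist i ν l).trans h

lemma lt_sdist_of_notMem_cube {ν i : Site d} {k : ℕ} (h : i ∉ cube ν k) : (k : ℝ) < sdist i ν := by
  have := mt mem_cube_of_siteDist_le h
  unfold sdist
  exact_mod_cast not_le.mp this

lemma cube_mono (ν : Site d) : Monotone (cube ν) := fun k l h i hi =>
  mem_cube.mpr fun m => (mem_cube.mp hi m).trans (by exact_mod_cast h)

lemma neighbors_subset_cube_succ {ν i : Site d} {k : ℕ} (hi : i ∈ cube ν k) :
    neighbors i ⊆ cube ν (k + 1) := by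
  refine fun j hj => mem_cube.mpr fun l => ?_
  have hji : |j l - i l| ≤ 1 := (mem_neighbors i j).mp hj ▸ abs_sub_le_siteDist j i l
  have hiν := mem_cube.mp hi l
  have := abs_sub_le (j l) (i l) (ν l)
  push_cast
  linarith

lemma card_cube (ν : Site d) (k : ℕ) : (cube ν k).card = (2 * k + 1) ^ d := by
  unfold cube
  rw [Pi.card_Icc]
  simp only [Int.card_Icc]
  rw [Finset.prod_congr rfl (g := fun _ => 2 * k + 1) (fun l _ => by omega)]
  simp

lemma card_closedNeighbors_le (i : Site d) : (closedNeighbors i).card ≤ 3 ^ d := by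
  have h : closedNeighbors i ⊆ cube i 1 := fun _ hj =>
    mem_cube_of_siteDist_le (by simpa using siteDist_le_one_of_mem_closedNeighbors hj)
  simpa [card_cube] using Finset.card_le_card h

lemma sum_closedNeighbors_le {i : Site d} {f : Site d → ℝ} {a : ℝ}
    (h : ∀ j ∈ closedNeighbors i, f j ≤ a) (ha : 0 ≤ a) :
    ∑ j ∈ closedNeighbors i, f j ≤ 3 ^ d * a := by
  calc ∑ j ∈ closedNeighbors i, f j ≤ (closedNeighbors i).card * a := by
        simpa using Finset.sum_le_sum h
    _ ≤ 3 ^ d * a := by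
      gcongr
      exact_mod_cast card_closedNeighbors_le i

end Geometry

/-! ### Comparison with supersolutions -/

section Comparison

lemma neg_of_bootstrap {ι : Type*} (B : Finset ι) {T : ℝ} (g : ι → ℝ → ℝ)
    (hc : ∀ i ∈ B, ContinuousOn (g i) (Icc 0 T))
    (hstep : ∀ s ∈ Icc 0 T, (∀ r ∈ Ico 0 s, ∀ i ∈ B, g i r ≤ 0) → ∀ i ∈ B, g i s < 0) :
    ∀ s ∈ Icc 0 T, ∀ i ∈ B, g i s < 0 := by
  by_contra! hbad
  obtain ⟨s₀, hs₀, i₀, hi₀, hg₀⟩ := hbad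
  set V : Set ℝ := ⋃ i ∈ B, (Icc 0 T ∩ g i ⁻¹' Ici 0) with hVdef
  have hV : IsCompact V := B.finite_toSet.isCompact_biUnion fun i hi =>
    isCompact_Icc.of_isClosed_subset
      ((hc i hi).preimage_isClosed_of_isClosed isClosed_Icc isClosed_Ici) inter_subset_left
  have hne : V.Nonempty := ⟨s₀, by simp only [hVdef, mem_iUnion]; exact ⟨i₀, hi₀, hs₀, hg₀⟩⟩
  obtain ⟨τ, hτ, hmin⟩ := hV.exists_isLeast hne
  simp only [hVdef, mem_iUnion] at hτ
  obtain ⟨i, hi, hτ, hgi⟩ := hτ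
  refine absurd (hstep τ hτ ?_ i hi) (not_lt.mpr hgi)
  intro r hr j hj
  by_contra! hpos
  refine absurd (hmin (a := r) ?_) (not_le.mpr hr.2)
  simp only [hVdef, mem_iUnion]
  exact ⟨j, hj, ⟨hr.1, hr.2.le.trans hτ.2⟩, hpos.le⟩

variable {d : ℕ} {E : Type*} [NormedAddCommGroup E] [NormedSpace ℝ E]

/-- A family `u`, with time derivatives `u'`, whose norms satisfy on `[-T, T]` the differential
inequalities of the linear lattice system with coefficients `A` and source `b`. -/
structure IsSubsolution (T : ℝ) (A : Site d → ℝ) (b : Site d → ℝ → ℝ) (u u' : Site d → ℝ → E) :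
    Prop where
  hasDerivAt : ∀ k s, |s| ≤ T → HasDerivAt (u k) (u' k s) s
  norm_deriv_le : ∀ k s, |s| ≤ T →
    ‖u' k s‖ ≤ A k * ∑ j ∈ closedNeighbors k, ‖u j s‖ + b k |s|

/-- A nonnegative supersolution `z` on `[0, T]`, with time derivatives `z'`, of the linear lattice
system with coefficients `A` and source `b`. -/
structure IsSupersolution (T : ℝ) (A : Site d → ℝ) (b z z' : Site d → ℝ → ℝ) : Prop where
  nonneg : ∀ k, ∀ s ∈ Icc 0 T, 0 ≤ z k s
  hasDerivAt : ∀ k, ∀ s ∈ Icc 0 T, HasDerivAt (z k) (z' k s) s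
  le_deriv : ∀ k, ∀ s ∈ Icc 0 T, A k * ∑ j ∈ closedNeighbors k, z j s + b k s ≤ z' k s

variable {T : ℝ} {A : Site d → ℝ} {b b₁ b₂ z z' z₁ z₁' z₂ z₂' : Site d → ℝ → ℝ}
  {u u' : Site d → ℝ → E}

lemma IsSubsolution.comp_neg (hu : IsSubsolution T A b u u') :
    IsSubsolution T A b (fun k s => u k (-s)) (fun k s => -u' k (-s)) where
  hasDerivAt k s hs := by
    simpa [Function.comp_def] using
      (hu.hasDerivAt k (-s) (by rwa [abs_neg])).scomp s (hasDerivAt_neg s)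
  norm_deriv_le k s hs := by simpa using hu.norm_deriv_le k (-s) (by rwa [abs_neg])

lemma IsSupersolution.add (h₁ : IsSupersolution T A b₁ z₁ z₁')
    (h₂ : IsSupersolution T A b₂ z₂ z₂') :
    IsSupersolution T A (fun k s => b₁ k s + b₂ k s) (fun k s => z₁ k s + z₂ k s)
      (fun k s => z₁' k s + z₂' k s) where
  nonneg k s hs := add_nonneg (h₁.nonneg k s hs) (h₂.nonneg k s hs)
  hasDerivAt k s hs := (h₁.hasDerivAt k s hs).add (h₂.hasDerivAt k s hs)
  le_deriv k s hs := by
    rw [Finset.sum_add_distrib]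
    linarith [h₁.le_deriv k s hs, h₂.le_deriv k s hs]

lemma IsSupersolution.const_mul (h : IsSupersolution T A b z z') {η : ℝ} (hη : 0 ≤ η) :
    IsSupersolution T A (fun k s => η * b k s) (fun k s => η * z k s) (fun k s => η * z' k s) where
  nonneg k s hs := mul_nonneg hη (h.nonneg k s hs)
  hasDerivAt k s hs := (h.hasDerivAt k s hs).const_mul η
  le_deriv k s hs := by
    rw [← Finset.mul_sum]
    linarith [mul_le_mul_of_nonneg_left (h.le_deriv k s hs) hη]

lemma IsSupersolution.mono (h : IsSupersolution T A b₂ z z')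
    (hb : ∀ k, ∀ s ∈ Icc 0 T, b₁ k s ≤ b₂ k s) : IsSupersolution T A b₁ z z' where
  nonneg := h.nonneg
  hasDerivAt := h.hasDerivAt
  le_deriv k s hs := by linarith [h.le_deriv k s hs, hb k s hs]

lemma IsSubsolution.norm_lt_of_finite (hu : IsSubsolution T A b u u')
    (hz : IsSupersolution T A b z z') (hA : ∀ k, 0 ≤ A k) (B : Finset (Site d))
    (h0 : ∀ k ∈ B, ‖u k 0‖ < z k 0) (hout : ∀ k ∉ B, ∀ s ∈ Icc 0 T, ‖u k s‖ ≤ z k s) :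
    ∀ s ∈ Icc 0 T, ∀ k ∈ B, ‖u k s‖ < z k s := by
  have habs : ∀ s ∈ Icc 0 T, |s| ≤ T := fun s hs => (abs_of_nonneg hs.1).trans_le hs.2
  have huc : ∀ k, ContinuousOn (u k) (Icc 0 T) := fun k s hs =>
    (hu.hasDerivAt k s (habs s hs)).continuousAt.continuousWithinAt
  have hzc : ∀ k, ContinuousOn (z k) (Icc 0 T) := fun k s hs =>
    (hz.hasDerivAt k s hs).continuousAt.continuousWithinAt
  have key := neg_of_bootstrap B (T := T) (fun k s => ‖u k s‖ - z k s)
    (fun k _ => (huc k).norm.sub (hzc k)) ?_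
  · exact fun s hs k hk => sub_neg.mp (key s hs k hk)
  intro s hs hprev k hk
  have hsub : Icc 0 s ⊆ Icc 0 T := Icc_subset_Icc_right hs.2
  have hall : ∀ r ∈ Ico 0 s, ∀ j, ‖u j r‖ ≤ z j r := by
    intro r hr j
    by_cases hj : j ∈ B
    · exact sub_nonpos.mp (hprev r hr j hj)
    · exact hout j hj r (hsub ⟨hr.1, hr.2.le⟩)
  set ε := z k 0 - ‖u k 0‖ with hε
  have hεpos : 0 < ε := sub_pos.mpr (h0 k hk)
  have hle : ‖u k s‖ ≤ z k s - ε := by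
    refine image_norm_le_of_norm_deriv_right_le_deriv_boundary' (f := u k) (f' := u' k)
      (a := 0) (b := s) (B := fun r => z k r - ε) (B' := z' k) ((huc k).mono hsub)
      (fun r hr => (hu.hasDerivAt k r (habs r (hsub ⟨hr.1, hr.2.le⟩))).hasDerivWithinAt)
      (by simp [hε]) (((hzc k).mono hsub).sub continuousOn_const)
      (fun r hr => ((hz.hasDerivAt k r (hsub ⟨hr.1, hr.2.le⟩)).sub_const ε).hasDerivWithinAt)
      (fun r hr => ?_) ⟨hs.1, le_rfl⟩
    have hr' := hsub ⟨hr.1, hr.2.le⟩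
    refine (hu.norm_deriv_le k r (habs r hr')).trans (le_trans ?_ (hz.le_deriv k r hr'))
    rw [abs_of_nonneg hr.1]
    gcongr
    · exact hA k
    · exact hall r hr _
  linarith

/-- The weight `exp((σ + s/T)|k - c| + ρs)`. Its exponential rate in space increases by `1` during
the time `T`, and this compensates coefficients that grow like `|k - c|/T`. -/
def slidingWeight (c : Site d) (T ρ σ : ℝ) (k : Site d) (s : ℝ) : ℝ :=
  Real.exp ((σ + s / T) * sdist k c + ρ * s)

lemma slidingWeight_pos (c : Site d) (T ρ σ : ℝ) (k : Site d) (s : ℝ) :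
    0 < slidingWeight c T ρ σ k s := Real.exp_pos _

lemma slidingWeight_zero (c : Site d) (T ρ σ : ℝ) (k : Site d) :
    slidingWeight c T ρ σ k 0 = Real.exp (σ * sdist k c) := by simp [slidingWeight]

lemma exp_le_slidingWeight (c : Site d) {ρ s : ℝ} (hρ : 0 ≤ ρ) (hs : s ∈ Icc 0 T) (σ : ℝ)
    (k : Site d) : Real.exp (σ * sdist k c) ≤ slidingWeight c T ρ σ k s := by
  have hsT : 0 ≤ s / T * sdist k c :=
    mul_nonneg (div_nonneg hs.1 (hs.1.trans hs.2)) (sdist_nonneg k c)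
  refine Real.exp_le_exp.mpr ?_
  linarith [mul_nonneg hρ hs.1]

lemma hasDerivAt_slidingWeight (c : Site d) (T ρ σ : ℝ) (k : Site d) (s : ℝ) :
    HasDerivAt (slidingWeight c T ρ σ k)
      ((sdist k c / T + ρ) * slidingWeight c T ρ σ k s) s := by
  have h : HasDerivAt (fun s : ℝ => (σ + s / T) * sdist k c + ρ * s) (sdist k c / T + ρ) s :=
    (((((hasDerivAt_id s).div_const T).const_add σ).mul_const (sdist k c)).add
      ((hasDerivAt_id s).const_mul ρ)).congr_deriv (by ring)
  exact h.exp.congr_deriv (mul_comm _ _)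

lemma slidingWeight_le_of_mem_closedNeighbors {c j k : Site d} {ρ σ s : ℝ} (hσ : |σ| ≤ 1)
    (hs : s ∈ Icc 0 T) (hj : j ∈ closedNeighbors k) :
    slidingWeight c T ρ σ j s ≤ Real.exp 2 * slidingWeight c T ρ σ k s := by
  have hrate : |σ + s / T| ≤ 2 := by
    have hsT : |s / T| ≤ 1 := by
      rw [abs_of_nonneg (div_nonneg hs.1 (hs.1.trans hs.2))]
      exact div_le_one_of_le₀ hs.2 (hs.1.trans hs.2)
    linarith [abs_add_le σ (s / T)]
  have hdiff : (σ + s / T) * (sdist j c - sdist k c) ≤ 2 := by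
    refine (le_abs_self _).trans ?_
    rw [abs_mul]
    nlinarith [abs_sdist_sub_le_one hj c, abs_nonneg (σ + s / T),
      abs_nonneg (sdist j c - sdist k c)]
  rw [slidingWeight, slidingWeight, ← Real.exp_add]
  exact Real.exp_le_exp.mpr (by linarith)

lemma isSupersolution_slidingWeight (c : Site d) {ρ σ κ : ℝ} (hσ : |σ| ≤ 1) (hA : ∀ k, 0 ≤ A k)
    (hAρ : ∀ k, A k * (3 ^ d * Real.exp 2) + κ ≤ ρ + sdist k c / T) :
    IsSupersolution T A (fun k s => κ * slidingWeight c T ρ σ k s) (slidingWeight c T ρ σ)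
      (fun k s => (sdist k c / T + ρ) * slidingWeight c T ρ σ k s) where
  nonneg k s _ := (slidingWeight_pos c T ρ σ k s).le
  hasDerivAt k s _ := hasDerivAt_slidingWeight c T ρ σ k s
  le_deriv k s hs := by
    have hpos := slidingWeight_pos c T ρ σ k s
    have hsum : ∑ j ∈ closedNeighbors k, slidingWeight c T ρ σ j s ≤
        3 ^ d * (Real.exp 2 * slidingWeight c T ρ σ k s) :=
      sum_closedNeighbors_le (fun j hj => slidingWeight_le_of_mem_closedNeighbors hσ hs hj)
        (by positivity)
    linarith [mul_le_mul_of_nonneg_left hsum (hA k), mul_le_mul_of_nonneg_right (hAρ k) hpos.le]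

lemma exists_nat_le_mul_exp (G : ℝ) {η : ℝ} (hη : 0 < η) :
    ∃ N : ℕ, ∀ m : ℝ, (N : ℝ) ≤ m → G ≤ η * Real.exp (m / 2) := by
  have h : Tendsto (fun m : ℝ => η * Real.exp (m / 2)) atTop atTop :=
    Tendsto.const_mul_atTop hη (Real.tendsto_exp_atTop.comp
      (tendsto_id.atTop_div_const (by norm_num)))
  obtain ⟨m₀, hm₀⟩ := eventually_atTop.mp (h.eventually_ge_atTop G)
  obtain ⟨N, hN⟩ := exists_nat_ge m₀
  exact ⟨N, fun m hm => hm₀ m (hN.trans hm)⟩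

/-- Adding a small multiple of `slidingWeight c T ρ 1` makes the supersolution strict at time `0`
and larger than `u` outside of a finite cube. -/
lemma IsSubsolution.norm_le_of_nonneg (c : Site d) {ρ G : ℝ} (hρ : 0 ≤ ρ) (hA : ∀ k, 0 ≤ A k)
    (hAρ : ∀ k, A k * (3 ^ d * Real.exp 2) ≤ ρ + sdist k c / T)
    (hu : IsSubsolution T A b u u') (hz : IsSupersolution T A b z z')
    (h0 : ∀ k, ‖u k 0‖ ≤ z k 0)
    (hG : ∀ k s, |s| ≤ T → ‖u k s‖ ≤ G * Real.exp (sdist k c / 2)) :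
    ∀ s ∈ Icc 0 T, ∀ k, ‖u k s‖ ≤ z k s := by
  intro s hs k
  set y := slidingWeight c T ρ 1
  have hy : ∀ j r, 0 < y j r := slidingWeight_pos c T ρ 1
  suffices H : ∀ η > 0, ‖u k s‖ ≤ z k s + η * y k s by
    refine le_of_forall_pos_le_add fun ε hε => ?_
    simpa only [div_mul_cancel₀ _ (hy k s).ne'] using H (ε / y k s) (div_pos hε (hy k s))
  intro η hη
  obtain ⟨N, hN⟩ := exists_nat_le_mul_exp G hη
  have hout : ∀ j ∉ cube c N, ∀ r ∈ Icc 0 T, ‖u j r‖ ≤ z j r + η * y j r := by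
    intro j hj r hr
    have hGη : G * Real.exp (sdist j c / 2) ≤ η * y j r :=
      calc G * Real.exp (sdist j c / 2)
          ≤ η * Real.exp (sdist j c / 2) * Real.exp (sdist j c / 2) := by
            gcongr; exact hN _ (lt_sdist_of_notMem_cube hj).le
        _ = η * Real.exp (1 * sdist j c) := by rw [mul_assoc, ← Real.exp_add]; congr 2; ring
        _ ≤ η * y j r := by gcongr; exact exp_le_slidingWeight c hρ hr 1 j
    linarith [hG j r ((abs_of_nonneg hr.1).trans_le hr.2), hz.nonneg j r hr]
  by_cases hk : k ∈ cube c N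
  · have hzy := (hz.add ((isSupersolution_slidingWeight (κ := 0) (σ := 1) c (by simp) hA
      (by simpa using hAρ)).const_mul hη.le)).mono (b₁ := b) (by simp)
    refine (hu.norm_lt_of_finite hzy hA (cube c N) (fun j _ => ?_) hout s hs k hk).le
    linarith [h0 j, mul_pos hη (hy j 0)]
  · exact hout k hk s hs

theorem IsSubsolution.norm_le (c : Site d) {ρ G : ℝ} (hρ : 0 ≤ ρ) (hA : ∀ k, 0 ≤ A k)
    (hAρ : ∀ k, A k * (3 ^ d * Real.exp 2) ≤ ρ + sdist k c / T)
    (hu : IsSubsolution T A b u u') (hz : IsSupersolution T A b z z')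
    (h0 : ∀ k, ‖u k 0‖ ≤ z k 0)
    (hG : ∀ k s, |s| ≤ T → ‖u k s‖ ≤ G * Real.exp (sdist k c / 2)) :
    ∀ s, |s| ≤ T → ∀ k, ‖u k s‖ ≤ z k |s| := by
  intro s hs k
  rcases abs_cases s with ⟨habs, hsign⟩ | ⟨habs, hsign⟩ <;> rw [habs] at hs ⊢
  · exact hu.norm_le_of_nonneg c hρ hA hAρ hz h0 hG s ⟨hsign, hs⟩ k
  · simpa using hu.comp_neg.norm_le_of_nonneg c hρ hA hAρ hz (by simpa using h0)
      (fun j r hr => hG j (-r) (by rwa [abs_neg])) (-s) ⟨by linarith, hs⟩ k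

theorem IsSubsolution.norm_le_slidingWeight (c : Site d) {ρ G H σ : ℝ} (hρ : 0 ≤ ρ) (hH : 0 ≤ H)
    (hσ : |σ| ≤ 1) (hA : ∀ k, 0 ≤ A k)
    (hAρ : ∀ k, A k * (3 ^ d * Real.exp 2) + 1 ≤ ρ + sdist k c / T)
    (hu : IsSubsolution T A (fun k _ => H * Real.exp (σ * sdist k c)) u u')
    (h0 : ∀ k, ‖u k 0‖ ≤ H * Real.exp (σ * sdist k c))
    (hG : ∀ k s, |s| ≤ T → ‖u k s‖ ≤ G * Real.exp (sdist k c / 2)) :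
    ∀ s, |s| ≤ T → ∀ k, ‖u k s‖ ≤ H * slidingWeight c T ρ σ k |s| := by
  have hz := ((isSupersolution_slidingWeight (κ := 1) c hσ hA hAρ).const_mul hH).mono
    (b₁ := fun k _ => H * Real.exp (σ * sdist k c)) fun k s hs => by
      rw [one_mul]
      gcongr
      exact exp_le_slidingWeight c hρ hs σ k
  exact hu.norm_le c hρ hA (fun k => by linarith [hAρ k]) hz
    (fun k => by simpa only [abs_zero, slidingWeight_zero] using h0 k) hG

end Comparison

/-! ### Quartic polynomials -/

section Quartic

open Polynomial

lemma isBigO_cocompact_of_degree_le {P V : ℝ[X]} (hdeg : P.degree ≤ V.degree) :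
    (fun s => P.eval s) =O[cocompact ℝ] fun s => V.eval s := by
  have hbot : (fun s => P.eval s) =O[atBot] fun s => V.eval s := by
    have h := (P.comp (-X)).isBigO_atTop_of_degree_le (V.comp (-X))
      (by simpa only [degree_comp_neg_X] using hdeg)
    simpa [Function.comp_def] using h.comp_tendsto tendsto_neg_atBot_atTop
  rw [cocompact_eq_atBot_atTop]
  exact hbot.sup (P.isBigO_atTop_of_degree_le V hdeg)

lemma exists_abs_eval_le_mul {P V : ℝ[X]} (hdeg : P.degree ≤ V.degree)
    (hV : ∀ s, 0 < V.eval s) : ∃ C, ∀ s, |P.eval s| ≤ C * V.eval s := by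
  obtain ⟨C₁, hC₁⟩ := (isBigO_cocompact_of_degree_le hdeg).bound
  obtain ⟨S, hS, hSC⟩ := mem_cocompact.mp hC₁
  obtain ⟨C₂, hC₂⟩ := hS.exists_bound_of_continuousOn (f := fun s => P.eval s / V.eval s)
    (P.continuous.div V.continuous fun s => (hV s).ne').continuousOn
  refine ⟨max C₁ C₂, fun s => ?_⟩
  by_cases hs : s ∈ S
  · have h := hC₂ s hs
    rw [Real.norm_eq_abs, abs_div, abs_of_pos (hV s), div_le_iff₀ (hV s)] at h
    exact h.trans (mul_le_mul_of_nonneg_right (le_max_right _ _) (hV s).le)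
  · have h : ‖P.eval s‖ ≤ C₁ * ‖V.eval s‖ := hSC hs
    rw [Real.norm_eq_abs, Real.norm_eq_abs, abs_of_pos (hV s)] at h
    exact h.trans (mul_le_mul_of_nonneg_right (le_max_left _ _) (hV s).le)

lemma abs_eval_sub_eval_le (P : ℝ[X]) {a b M : ℝ}
    (hM : ∀ s ∈ uIcc a b, |P.derivative.eval s| ≤ M) :
    |P.eval b - P.eval a| ≤ M * |b - a| :=
  (convex_uIcc a b).norm_image_sub_le_of_norm_hasDerivWithin_le
    (fun s _ => (P.hasDerivAt s).hasDerivWithinAt) hM left_mem_uIcc right_mem_uIcc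

lemma abs_eval_taylor_le (P : ℝ[X]) {a b M : ℝ}
    (hM : ∀ s ∈ uIcc a b, |P.derivative.derivative.eval s| ≤ M) :
    |P.eval b - P.eval a - P.derivative.eval a * (b - a)| ≤ M * (b - a) ^ 2 := by
  have hM₀ : 0 ≤ M := (abs_nonneg _).trans (hM a left_mem_uIcc)
  have h := abs_eval_sub_eval_le (P - C (P.derivative.eval a) * X) (a := a) (b := b)
    (M := M * |b - a|) fun s hs => by
      simp only [derivative_sub, derivative_C_mul, derivative_X, mul_one, eval_sub, eval_C]
      refine (abs_eval_sub_eval_le P.derivative fun r hr =>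
        hM r (uIcc_subset_uIcc_left hs hr)).trans ?_
      gcongr M * ?_
      exact abs_sub_left_of_mem_uIcc hs
  rw [mul_assoc, ← sq, sq_abs] at h
  refine le_trans (le_of_eq ?_) h
  simp only [eval_sub, eval_mul, eval_C, eval_X]
  ring_nf

lemma sq_le_of_mem_uIcc {a b s : ℝ} (hs : s ∈ uIcc a b) : s ^ 2 ≤ a ^ 2 + b ^ 2 := by
  rcases mem_uIcc.mp hs with ⟨h₁, h₂⟩ | ⟨h₁, h₂⟩ <;>
    nlinarith [mul_nonneg (sub_nonneg.mpr h₁) (sub_nonneg.mpr h₂), sq_nonneg (a + b - s)]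

/-- Growth bounds with constant `C` for a nonnegative quartic potential `U`. -/
structure QuarticBounds (U : ℝ[X]) (C : ℝ) : Prop where
  one_le : 1 ≤ C
  nonneg : ∀ s, 0 ≤ U.eval s
  pow_four_le : ∀ s, s ^ 4 ≤ C * (U.eval s + 1)
  deriv_le : ∀ s, |U.derivative.eval s| ≤ C * (1 + s ^ 4)
  deriv2_le : ∀ s, |U.derivative.derivative.eval s| ≤ C * (1 + s ^ 2)
  deriv3_le : ∀ s, |U.derivative.derivative.derivative.eval s| ≤ C * (1 + s ^ 2)

variable {U : ℝ[X]} {C : ℝ}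

theorem exists_quarticBounds (hdeg : U.natDegree = 4) (hnonneg : ∀ s, 0 ≤ U.eval s) :
    ∃ C, QuarticBounds U C := by
  have hone : ∀ n, (1 + X ^ (n + 1) : ℝ[X]).degree = (n + 1 : ℕ) := fun n => by
    rw [add_comm]; exact degree_X_pow_add_C (Nat.succ_pos n) 1
  have hdeg1 : (U + C 1).degree = 4 := by
    rw [degree_add_C (natDegree_pos_iff_degree_pos.mp (by omega)),
      degree_eq_natDegree (by rintro rfl; simp at hdeg), hdeg]
    rfl
  have hd := U.natDegree_derivative_le
  have hd2 := U.derivative.natDegree_derivative_le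
  have hd3 := U.derivative.derivative.natDegree_derivative_le
  obtain ⟨C₀, h₀⟩ := exists_abs_eval_le_mul (P := X ^ 4) (V := U + C 1)
    (by rw [hdeg1]; exact degree_X_pow_le 4)
    fun s => by simpa using add_pos_of_nonneg_of_pos (hnonneg s) one_pos
  obtain ⟨C₁, h₁⟩ := exists_abs_eval_le_mul (P := U.derivative) (V := 1 + X ^ 4)
    (by rw [hone]; exact degree_le_of_natDegree_le (by omega)) fun s => by
      simp only [eval_add, eval_one, eval_pow, eval_X]; positivity
  obtain ⟨C₂, h₂⟩ := exists_abs_eval_le_mul (P := U.derivative.derivative) (V := 1 + X ^ 2)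
    (by rw [hone]; exact degree_le_of_natDegree_le (by omega)) fun s => by
      simp only [eval_add, eval_one, eval_pow, eval_X]; positivity
  obtain ⟨C₃, h₃⟩ := exists_abs_eval_le_mul (P := U.derivative.derivative.derivative)
    (V := 1 + X ^ 2) (by rw [hone]; exact degree_le_of_natDegree_le (by omega))
    fun s => by
      simp only [eval_add, eval_one, eval_pow, eval_X]; positivity
  simp only [eval_add, eval_one, eval_pow, eval_X, eval_C] at h₀ h₁ h₂ h₃
  refine ⟨1 + |C₀| + |C₁| + |C₂| + |C₃|, ?_, hnonneg, fun s => ?_, fun s => (h₁ s).trans ?_,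
    fun s => (h₂ s).trans ?_, fun s => (h₃ s).trans ?_⟩
  · linarith [abs_nonneg C₀, abs_nonneg C₁, abs_nonneg C₂, abs_nonneg C₃]
  · refine ((le_abs_self _).trans (h₀ s)).trans ?_
    gcongr
    · linarith [hnonneg s]
    · linarith [le_abs_self C₀, abs_nonneg C₁, abs_nonneg C₂, abs_nonneg C₃]
  all_goals
    gcongr
    linarith [abs_nonneg C₀, le_abs_self C₁, abs_nonneg C₁, le_abs_self C₂, abs_nonneg C₂,
      le_abs_self C₃, abs_nonneg C₃]

lemma QuarticBounds.pos (hU : QuarticBounds U C) : 0 < C := one_pos.trans_le hU.one_le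

lemma QuarticBounds.abs_deriv_sub_le (hU : QuarticBounds U C) (a b : ℝ) :
    |U.derivative.eval b - U.derivative.eval a| ≤ C * (1 + a ^ 2 + b ^ 2) * |b - a| :=
  abs_eval_sub_eval_le _ fun s hs => (hU.deriv2_le s).trans
    (mul_le_mul_of_nonneg_left (by linarith [sq_le_of_mem_uIcc hs]) hU.pos.le)

lemma QuarticBounds.abs_deriv_taylor_le (hU : QuarticBounds U C) (a b : ℝ) :
    |U.derivative.eval b - U.derivative.eval a - U.derivative.derivative.eval a * (b - a)| ≤
      C * (1 + a ^ 2 + b ^ 2) * (b - a) ^ 2 :=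
  abs_eval_taylor_le _ fun s hs => (hU.deriv3_le s).trans
    (mul_le_mul_of_nonneg_left (by linarith [sq_le_of_mem_uIcc hs]) hU.pos.le)

end Quartic

/-! ### Exponential sums over the lattice -/

section Sums

variable {d : ℕ}

lemma summable_exp_neg_abs_int {a : ℝ} (ha : 0 < a) :
    Summable fun n : ℤ => Real.exp (-a * |(n : ℝ)|) := by
  have h : Summable fun n : ℕ => Real.exp (-a * |((n : ℤ) : ℝ)|) := by
    have := Real.summable_exp_nat_mul_iff.mpr (neg_neg_of_pos ha)
    refine this.congr fun n => ?_
    simp [mul_comm]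
  exact Summable.of_nat_of_neg h (by simpa using h)

lemma summable_prod_pi {ι β : Type*} [Fintype ι] {f : β → ℝ} (hf : Summable f)
    (h0 : ∀ n, 0 ≤ f n) : Summable fun l : ι → β => ∏ m, f (l m) := by
  classical
  refine summable_of_sum_le (c := (∑' n, f n) ^ Fintype.card ι)
    (fun l => Finset.prod_nonneg fun m _ => h0 _) fun u => ?_
  set t : ι → Finset β := fun m => u.image fun l => l m
  calc ∑ l ∈ u, ∏ m, f (l m) ≤ ∑ l ∈ Fintype.piFinset t, ∏ m, f (l m) := by
        refine Finset.sum_le_sum_of_subset_of_nonneg (fun l hl => ?_)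
          fun l _ _ => Finset.prod_nonneg fun m _ => h0 _
        exact Fintype.mem_piFinset.mpr fun m => Finset.mem_image_of_mem _ hl
    _ = ∏ m, ∑ n ∈ t m, f n := (Finset.prod_univ_sum t fun _ n => f n).symm
    _ ≤ ∏ _m : ι, ∑' n, f n :=
        Finset.prod_le_prod (fun m _ => Finset.sum_nonneg fun n _ => h0 n)
          fun m _ => hf.sum_le_tsum _ fun n _ => h0 n
    _ = (∑' n, f n) ^ Fintype.card ι := by simp

lemma sdist_self_add (i l : Site d) : sdist i (i + l) = sdist l 0 := by
  simp [sdist, siteDist]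

lemma summable_exp_neg_sdist (c : Site d) {a : ℝ} (ha : 0 < a) :
    Summable fun j : Site d => Real.exp (-a * sdist c j) := by
  rw [← (Equiv.addLeft c).summable_iff]
  refine (summable_prod_pi (ι := Fin d) (summable_exp_neg_abs_int ha)
    fun _ => (Real.exp_pos _).le).congr fun l => ?_
  simp only [Function.comp_apply, Equiv.coe_addLeft]
  rw [sdist_self_add, ← Real.exp_sum]
  simp [sdist, siteDist, Finset.mul_sum]

lemma pow_le_exp_half (d : ℕ) {m : ℝ} (hm : 0 ≤ m) :
    (2 * m + 1) ^ d ≤ 4 ^ d * d.factorial * Real.exp (1 / 4) * Real.exp (m / 2) := by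
  have h := Real.pow_div_factorial_le_exp ((2 * m + 1) / 4) (by positivity) d
  rw [div_le_iff₀ (by positivity), div_pow, div_le_iff₀ (by positivity)] at h
  refine h.trans (le_of_eq ?_)
  rw [show (2 * m + 1) / 4 = 1 / 4 + m / 2 by ring, Real.exp_add]
  ring

/-- The weights that compare the energy of a cube with the energies of larger cubes. -/
def spreadWeight (d : ℕ) (l : Site d) : ℝ := Real.exp (-sdist l 0) * (2 * sdist l 0 + 1) ^ d

lemma spreadWeight_nonneg (l : Site d) : 0 ≤ spreadWeight d l := by
  have := sdist_nonneg l 0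
  unfold spreadWeight
  positivity

lemma summable_spreadWeight : Summable (spreadWeight d) := by
  refine Summable.of_nonneg_of_le spreadWeight_nonneg (fun l => ?_)
    ((summable_exp_neg_sdist (0 : Site d) (a := 1 / 2) (by norm_num)).mul_left
      (4 ^ d * d.factorial * Real.exp (1 / 4)))
  calc spreadWeight d l
      ≤ Real.exp (-sdist l 0) *
        (4 ^ d * d.factorial * Real.exp (1 / 4) * Real.exp (sdist l 0 / 2)) :=
      mul_le_mul_of_nonneg_left (pow_le_exp_half d (sdist_nonneg l 0)) (Real.exp_pos _).le
    _ = 4 ^ d * d.factorial * Real.exp (1 / 4) *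
        (Real.exp (-sdist l 0) * Real.exp (sdist l 0 / 2)) := by ring
    _ = _ := by
      rw [← Real.exp_add, sdist_comm 0 l]
      congr 2
      ring

/-- The sum of the weights `spreadWeight`. -/
def spreadConst (d : ℕ) : ℝ := ∑' l : Site d, spreadWeight d l

lemma one_le_spreadConst : 1 ≤ spreadConst d := by
  have h := summable_spreadWeight.le_tsum (0 : Site d) fun l _ => spreadWeight_nonneg l
  have h₀ : spreadWeight d 0 = 1 := by simp [spreadWeight, sdist_self]
  rwa [h₀] at h

/-- The average of `E` around the site `i` with exponentially decaying weights. -/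
def expSpread (E : Site d → ℝ) (i : Site d) : ℝ := ∑' j, Real.exp (-sdist i j) * E j

variable {E : Site d → ℝ}

lemma summable_exp_neg_sdist_mul (hE : ∀ i, 0 ≤ E i) {G : ℝ} {c : Site d}
    (hG : ∀ i, E i ≤ G * Real.exp (sdist i c / 2)) (i : Site d) :
    Summable fun j => Real.exp (-sdist i j) * E j := by
  have hG₀ : 0 ≤ G := by simpa [sdist_self] using (hE c).trans (hG c)
  refine Summable.of_nonneg_of_le (fun j => mul_nonneg (Real.exp_pos _).le (hE j)) (fun j => ?_)
    ((summable_exp_neg_sdist i (a := 1 / 2) (by norm_num)).mul_left (G * Real.exp (sdist i c / 2)))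
  calc Real.exp (-sdist i j) * E j
      ≤ Real.exp (-sdist i j) * (G * Real.exp (sdist j c / 2)) := by gcongr; exact hG j
    _ = G * Real.exp (-sdist i j + sdist j c / 2) := by rw [Real.exp_add]; ring
    _ ≤ G * Real.exp (sdist i c / 2 + -(1 / 2) * sdist i j) := by
      gcongr G * Real.exp ?_
      have := sdist_triangle j i c
      rw [sdist_comm j i] at this
      linarith
    _ = _ := by rw [Real.exp_add]; ring

lemma expSpread_nonneg (hE : ∀ i, 0 ≤ E i) (i : Site d) : 0 ≤ expSpread E i :=
  tsum_nonneg fun j => mul_nonneg (Real.exp_pos _).le (hE j)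

lemma le_expSpread (hE : ∀ i, 0 ≤ E i) {i : Site d}
    (hsum : Summable fun j => Real.exp (-sdist i j) * E j) : E i ≤ expSpread E i := by
  have h := hsum.le_tsum i fun j _ => mul_nonneg (Real.exp_pos _).le (hE j)
  rwa [sdist_self, neg_zero, Real.exp_zero, one_mul] at h

lemma expSpread_le_of_mem_closedNeighbors (hE : ∀ i, 0 ≤ E i)
    (hsum : ∀ i, Summable fun j => Real.exp (-sdist i j) * E j) {k l : Site d}
    (hl : l ∈ closedNeighbors k) : expSpread E l ≤ Real.exp 1 * expSpread E k := by
  rw [expSpread, expSpread, ← tsum_mul_left]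
  refine (hsum l).tsum_le_tsum (fun j => ?_) ((hsum k).mul_left _)
  rw [← mul_assoc, ← Real.exp_add]
  refine mul_le_mul_of_nonneg_right (Real.exp_le_exp.mpr ?_) (hE j)
  linarith [(abs_le.mp (abs_sdist_sub_le_one hl j)).1]

lemma isSupersolution_exp_mul_expSpread (hE : ∀ i, 0 ≤ E i)
    (hsum : ∀ i, Summable fun j => Real.exp (-sdist i j) * E j) {a ρ : ℝ} (ha : 0 ≤ a)
    (hρ : a * (3 ^ d * Real.exp 1) ≤ ρ) (T : ℝ) :
    IsSupersolution T (fun _ => a) (fun _ _ => 0) (fun k s => Real.exp (ρ * s) * expSpread E k)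
      (fun k s => Real.exp (ρ * s) * ρ * expSpread E k) where
  nonneg k s _ := mul_nonneg (Real.exp_pos _).le (expSpread_nonneg hE k)
  hasDerivAt k s _ := by
    simpa using (((hasDerivAt_id s).const_mul ρ).exp.mul_const (expSpread E k))
  le_deriv k s _ := by
    have hk := expSpread_nonneg hE k
    have hsp := sum_closedNeighbors_le
      (fun l hl => expSpread_le_of_mem_closedNeighbors hE hsum hl) (by positivity)
    rw [add_zero, ← Finset.mul_sum]
    calc a * (Real.exp (ρ * s) * ∑ l ∈ closedNeighbors k, expSpread E l)
        ≤ a * (Real.exp (ρ * s) * (3 ^ d * (Real.exp 1 * expSpread E k))) := by gcongr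
      _ = Real.exp (ρ * s) * (a * (3 ^ d * Real.exp 1)) * expSpread E k := by ring
      _ ≤ Real.exp (ρ * s) * ρ * expSpread E k := by gcongr

lemma sum_cube_add_le (hE : ∀ i, 0 ≤ E i) {l : Site d} {m : ℕ} (hl : siteDist l 0 ≤ m)
    (ν : Site d) (k : ℕ) : ∑ i ∈ cube ν k, E (i + l) ≤ ∑ i ∈ cube ν (k + m), E i := by
  rw [← Finset.sum_image (s := cube ν k) (g := fun i => i + l) (f := E)
    fun a _ b _ h => add_right_cancel h]
  refine Finset.sum_le_sum_of_subset_of_nonneg (fun j hj => ?_) fun i _ _ => hE i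
  obtain ⟨i, hi, rfl⟩ := Finset.mem_image.mp hj
  refine mem_cube.mpr fun n => ?_
  have hln : |l n| ≤ m := by simpa using (abs_sub_le_siteDist l 0 n).trans hl
  calc |(i + l) n - ν n| = |i n - ν n + l n| := by rw [Pi.add_apply]; ring_nf
    _ ≤ |i n - ν n| + |l n| := abs_add_le _ _
    _ ≤ ((k + m : ℕ) : ℤ) := by push_cast; exact add_le_add (mem_cube.mp hi n) hln

theorem sum_cube_expSpread_le (hE : ∀ i, 0 ≤ E i) {ν : Site d} {k : ℕ} {M : ℝ}
    (hM : ∀ l, k ≤ l → ∑ i ∈ cube ν l, E i ≤ M * (2 * (l : ℝ) + 1) ^ d)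
    (hsum : ∀ i, Summable fun j => Real.exp (-sdist i j) * E j) :
    ∑ i ∈ cube ν k, expSpread E i ≤ spreadConst d * (M * (2 * (k : ℝ) + 1) ^ d) := by
  have hM₀ : 0 ≤ M := nonneg_of_mul_nonneg_left
    ((Finset.sum_nonneg fun i _ => hE i).trans (hM k le_rfl)) (by positivity)
  have hshift : ∀ i, expSpread E i = ∑' l, Real.exp (-sdist l 0) * E (i + l) := fun i => by
    rw [expSpread, ← (Equiv.addLeft i).tsum_eq]
    simp [sdist_self_add]
  have hsum' : ∀ i, Summable fun l => Real.exp (-sdist l 0) * E (i + l) := fun i =>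
    ((Equiv.addLeft i).summable_iff.mpr (hsum i)).congr fun l => by simp [sdist_self_add]
  simp_rw [hshift]
  rw [← Summable.tsum_finsetSum fun i _ => hsum' i, spreadConst, ← tsum_mul_right]
  refine Summable.tsum_le_tsum (fun l => ?_) (summable_sum fun i _ => hsum' i)
    (summable_spreadWeight.mul_right _)
  obtain ⟨m, hm⟩ : ∃ m : ℕ, siteDist l 0 = m :=
    Int.eq_ofNat_of_zero_le (Finset.sum_nonneg fun _ _ => abs_nonneg _)
  have hmr : sdist l 0 = m := by unfold sdist; exact_mod_cast hm
  rw [← Finset.mul_sum, spreadWeight, mul_assoc]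
  gcongr
  calc ∑ i ∈ cube ν k, E (i + l) ≤ M * (2 * ((k + m : ℕ) : ℝ) + 1) ^ d :=
        (sum_cube_add_le hE hm.le ν k).trans (hM (k + m) (Nat.le_add_right _ _))
    _ ≤ M * ((2 * (m : ℝ) + 1) * (2 * (k : ℝ) + 1)) ^ d := by
        gcongr
        push_cast
        nlinarith [mul_nonneg (Nat.cast_nonneg (α := ℝ) k) (Nat.cast_nonneg (α := ℝ) m)]
    _ = (2 * sdist l 0 + 1) ^ d * (M * (2 * (k : ℝ) + 1) ^ d) := by rw [hmr, mul_pow]; ring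

end Sums

/-! ### Site energies -/

section Energy

variable {d : ℕ} (U : Polynomial ℝ) (K : ℝ)

/-- The energy of the site `i`, with half of the energy of each bond at `i`. -/
def siteEnergy (i : Site d) (x : Config d) : ℝ :=
  (x i).2 ^ 2 / 2 + U.eval (x i).1 + 1 + ∑ j ∈ neighbors i, K / 4 * ((x i).1 - (x j).1) ^ 2

/-- The sum of the site energies over a cube. Unlike `localEnergy`, it contains half of the energy
of the bonds that cross the boundary of the cube. -/
def cubeEnergy (ν : Site d) (k : ℕ) (x : Config d) : ℝ := ∑ i ∈ cube ν k, siteEnergy U K i x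

/-- The velocity `(p_i, F_i(x))` of the site `i`. -/
def velocity (i : Site d) (x : Config d) : ℝ × ℝ := ((x i).2, force U K i x)

/-- A solution for the times `|t| ≤ T` of the system in which only the sites in `S` move. -/
def IsPartialSolution (S : Set (Site d)) (T : ℝ) (γ : ℝ → Config d) : Prop :=
  ∀ i t, |t| ≤ T → HasDerivAt (fun s => γ s i) (S.indicator (fun j => velocity U K j (γ t)) i) t

/-- The energy that flows into the site `i` per unit of time, if only the sites in `S` move: the
contributions of `U` cancel, so that energy is exchanged only along the bonds. -/
def energyInflux (S : Set (Site d)) (i : Site d) (x : Config d) : ℝ :=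
  ∑ j ∈ neighbors i, -(K / 2) * ((x i).1 - (x j).1) *
    (S.indicator (fun k => (x k).2) i + S.indicator (fun k => (x k).2) j)

/-- The constant `A` for which `|d/dt E_i| ≤ A ∑ E_j`, summed over the sites `j` near `i`. -/
def influxConst (d : ℕ) (K : ℝ) : ℝ := 3 ^ d * (4 + 2 * K)

/-- The exponential growth rate of the energy. -/
def energyRate (d : ℕ) (K : ℝ) : ℝ := influxConst d K * (3 ^ d * Real.exp 2)

variable {U K}

lemma influxConst_nonneg (hK : 0 ≤ K) : 0 ≤ influxConst d K := by unfold influxConst; positivity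

lemma energyRate_nonneg (hK : 0 ≤ K) : 0 ≤ energyRate d K :=
  mul_nonneg (influxConst_nonneg hK) (by positivity)

lemma sum_bond_nonneg (hK : 0 ≤ K) (i : Site d) (x : Config d) :
    0 ≤ ∑ j ∈ neighbors i, K / 4 * ((x i).1 - (x j).1) ^ 2 :=
  Finset.sum_nonneg fun _ _ => by positivity

lemma one_le_siteEnergy (hK : 0 ≤ K) (hU : ∀ q, 0 ≤ U.eval q) (i : Site d) (x : Config d) :
    1 ≤ siteEnergy U K i x := by
  unfold siteEnergy
  linarith [sum_bond_nonneg hK i x, hU (x i).1, sq_nonneg (x i).2]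

lemma siteEnergy_nonneg (hK : 0 ≤ K) (hU : ∀ q, 0 ≤ U.eval q) (i : Site d) (x : Config d) :
    0 ≤ siteEnergy U K i x :=
  zero_le_one.trans (one_le_siteEnergy hK hU i x)

lemma sq_momentum_le (hK : 0 ≤ K) (hU : ∀ q, 0 ≤ U.eval q) (i : Site d) (x : Config d) :
    (x i).2 ^ 2 ≤ 2 * siteEnergy U K i x := by
  unfold siteEnergy
  linarith [sum_bond_nonneg hK i x, hU (x i).1]

lemma eval_add_one_le (hK : 0 ≤ K) (i : Site d) (x : Config d) :
    U.eval (x i).1 + 1 ≤ siteEnergy U K i x := by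
  unfold siteEnergy
  linarith [sum_bond_nonneg hK i x, sq_nonneg (x i).2]

lemma bond_le (hK : 0 ≤ K) (hU : ∀ q, 0 ≤ U.eval q) {i j : Site d} (hj : j ∈ neighbors i)
    (x : Config d) : K * ((x i).1 - (x j).1) ^ 2 ≤ 4 * siteEnergy U K i x := by
  have h := Finset.single_le_sum (f := fun j => K / 4 * ((x i).1 - (x j).1) ^ 2)
    (fun _ _ => by positivity) hj
  unfold siteEnergy
  linarith [hU (x i).1, sq_nonneg (x i).2]

lemma localEnergy_le_cubeEnergy (hK : 0 ≤ K) (ν : Site d) (k : ℕ) (x : Config d) :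
    localEnergy U K ν k x ≤ cubeEnergy U K ν k x := by
  unfold localEnergy cubeEnergy siteEnergy
  refine le_of_le_of_eq ?_ Finset.sum_add_distrib.symm
  refine add_le_add le_rfl (Finset.sum_le_sum fun i _ => ?_)
  refine Finset.sum_le_sum_of_subset_of_nonneg (fun j hj => ?_) fun _ _ _ => by positivity
  exact (mem_neighbors i j).mpr (Finset.mem_filter.mp hj).2

lemma cubeEnergy_le_localEnergy (hK : 0 ≤ K) (hU : ∀ q, 0 ≤ U.eval q) (ν : Site d) (k : ℕ)
    (x : Config d) : cubeEnergy U K ν k x ≤ localEnergy U K ν (k + 1) x := by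
  have hsub := cube_mono ν (Nat.le_succ k)
  unfold localEnergy cubeEnergy siteEnergy
  rw [Finset.sum_add_distrib]
  refine add_le_add ?_ ?_
  · refine Finset.sum_le_sum_of_subset_of_nonneg hsub fun i _ _ => ?_
    have := hU (x i).1
    positivity
  · refine (Finset.sum_le_sum fun i hi => ?_).trans (Finset.sum_le_sum_of_subset_of_nonneg hsub
      fun i _ _ => Finset.sum_nonneg fun _ _ => by positivity)
    refine Finset.sum_le_sum_of_subset_of_nonneg (fun j hj => ?_) fun _ _ _ => by positivity
    exact Finset.mem_filter.mpr ⟨neighbors_subset_cube_succ hi hj, (mem_neighbors i j).mp hj⟩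

lemma siteEnergy_le_cubeEnergy (hK : 0 ≤ K) (hU : ∀ q, 0 ≤ U.eval q) {ν i : Site d} {k : ℕ}
    (hi : i ∈ cube ν k) (x : Config d) : siteEnergy U K i x ≤ cubeEnergy U K ν k x :=
  Finset.single_le_sum (f := fun i => siteEnergy U K i x)
    (fun i _ => siteEnergy_nonneg hK hU i x) hi

lemma cubeEnergy_nonneg (hK : 0 ≤ K) (hU : ∀ q, 0 ≤ U.eval q) (ν : Site d) (k : ℕ)
    (x : Config d) : 0 ≤ cubeEnergy U K ν k x :=
  Finset.sum_nonneg fun i _ => siteEnergy_nonneg hK hU i x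

lemma hasDerivAt_siteEnergy {γ : ℝ → Config d} {v : Site d → ℝ × ℝ} {t : ℝ}
    (h : ∀ i, HasDerivAt (fun s => γ s i) (v i) t) (i : Site d) :
    HasDerivAt (fun s => siteEnergy U K i (γ s))
      ((γ t i).2 * (v i).2 + U.derivative.eval (γ t i).1 * (v i).1 +
        ∑ j ∈ neighbors i, K / 2 * ((γ t i).1 - (γ t j).1) * ((v i).1 - (v j).1)) t := by
  have hq : ∀ j, HasDerivAt (fun s => (γ s j).1) (v j).1 t := fun j =>
    (ContinuousLinearMap.fst ℝ ℝ ℝ).hasFDerivAt.comp_hasDerivAt t (h j)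
  have hp : HasDerivAt (fun s => (γ s i).2) (v i).2 t :=
    (ContinuousLinearMap.snd ℝ ℝ ℝ).hasFDerivAt.comp_hasDerivAt t (h i)
  have hkin : HasDerivAt (fun s => (γ s i).2 ^ 2 / 2) ((γ t i).2 * (v i).2) t :=
    ((hp.pow 2).div_const 2).congr_deriv (by ring)
  have hpot : HasDerivAt (fun s => U.eval (γ s i).1) (U.derivative.eval (γ t i).1 * (v i).1) t :=
    (U.hasDerivAt (γ t i).1).comp (h := fun s => (γ s i).1) t (hq i)
  have hbond : ∀ j ∈ neighbors i, HasDerivAt (fun s => K / 4 * ((γ s i).1 - (γ s j).1) ^ 2)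
      (K / 2 * ((γ t i).1 - (γ t j).1) * ((v i).1 - (v j).1)) t := fun j _ =>
    ((((hq i).sub (hq j)).pow 2).const_mul (K / 4)).congr_deriv (by simp; ring)
  exact ((hkin.add hpot).add_const 1).add (HasDerivAt.fun_sum hbond)

lemma hasDerivAt_siteEnergy_of_smul_velocity {S : Set (Site d)} {γ : ℝ → Config d} {a t : ℝ}
    (h : ∀ i, HasDerivAt (fun s => γ s i) (a • S.indicator (fun j => velocity U K j (γ t)) i) t)
    (i : Site d) :
    HasDerivAt (fun s => siteEnergy U K i (γ s)) (a * energyInflux K S i (γ t)) t := by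
  refine (hasDerivAt_siteEnergy h i).congr_deriv ?_
  have hfst : ∀ j, (S.indicator (fun j => velocity U K j (γ t)) j).1 =
      S.indicator (fun k => (γ t k).2) j := fun j => by
    by_cases hj : j ∈ S <;> simp [hj, velocity]
  simp only [Prod.smul_fst, Prod.smul_snd, smul_eq_mul, hfst, energyInflux, Finset.mul_sum]
  by_cases hi : i ∈ S
  · have hforce : (γ t i).2 * (a * force U K i (γ t)) +
        U.derivative.eval (γ t i).1 * (a * (γ t i).2) =
        ∑ j ∈ neighbors i, -(K * a * (γ t i).2) * ((γ t i).1 - (γ t j).1) := by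
      rw [← Finset.mul_sum, force]
      ring
    simp only [Set.indicator_of_mem hi, velocity]
    rw [hforce, ← Finset.sum_add_distrib]
    exact Finset.sum_congr rfl fun j _ => by ring
  · simp only [Set.indicator_of_notMem hi, Prod.snd_zero, mul_zero, zero_add]
    exact Finset.sum_congr rfl fun j _ => by ring

lemma abs_bondInflux_le (hK : 0 ≤ K) {a v w E : ℝ} (ha : K * a ^ 2 ≤ 4 * E)
    (hv : v ^ 2 ≤ 2 * E) (hw : w ^ 2 ≤ 2 * E) : |-(K / 2) * a * (v + w)| ≤ (4 + 2 * K) * E := by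
  have hvw : K * (v + w) ^ 2 ≤ K * (8 * E) := by
    gcongr
    nlinarith [sq_nonneg (v - w)]
  rw [abs_le]
  constructor
  · nlinarith [mul_nonneg hK (sq_nonneg (a - (v + w)))]
  · nlinarith [mul_nonneg hK (sq_nonneg (a + (v + w)))]

lemma abs_energyInflux_le (hK : 0 ≤ K) (hU : ∀ q, 0 ≤ U.eval q) (S : Set (Site d)) (i : Site d)
    (x : Config d) :
    |energyInflux K S i x| ≤ influxConst d K * ∑ j ∈ closedNeighbors i, siteEnergy U K j x := by
  set E := ∑ j ∈ closedNeighbors i, siteEnergy U K j x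
  have hle : ∀ j ∈ closedNeighbors i, siteEnergy U K j x ≤ E := fun j hj =>
    Finset.single_le_sum (f := fun j => siteEnergy U K j x)
      (fun j _ => siteEnergy_nonneg hK hU j x) hj
  have hE : 0 ≤ E := Finset.sum_nonneg fun j _ => siteEnergy_nonneg hK hU j x
  have hv : ∀ j ∈ closedNeighbors i, (S.indicator (fun k => (x k).2) j) ^ 2 ≤ 2 * E := by
    intro j hj
    by_cases hjS : j ∈ S
    · rw [Set.indicator_of_mem hjS]
      linarith [sq_momentum_le hK hU j x, hle j hj]
    · simpa [hjS] using hE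
  have hi := self_mem_closedNeighbors i
  calc |energyInflux K S i x| ≤ ∑ _j ∈ neighbors i, (4 + 2 * K) * E := by
        refine (Finset.abs_sum_le_sum_abs _ _).trans (Finset.sum_le_sum fun j hj => ?_)
        exact abs_bondInflux_le hK ((bond_le hK hU hj x).trans (by linarith [hle i hi])) (hv i hi)
          (hv j (neighbors_subset_closedNeighbors i hj))
    _ ≤ ∑ _j ∈ closedNeighbors i, (4 + 2 * K) * E :=
        Finset.sum_le_sum_of_subset_of_nonneg (neighbors_subset_closedNeighbors i)
          fun _ _ _ => by positivity
    _ ≤ 3 ^ d * ((4 + 2 * K) * E) := sum_closedNeighbors_le (fun _ _ => le_rfl) (by positivity)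
    _ = influxConst d K * E := by unfold influxConst; ring

lemma IsPartialSolution.isSubsolution_siteEnergy (hK : 0 ≤ K) (hU : ∀ q, 0 ≤ U.eval q)
    {S : Set (Site d)} {T : ℝ} {γ : ℝ → Config d} (hγ : IsPartialSolution U K S T γ) :
    IsSubsolution T (fun _ => influxConst d K) (fun _ _ => 0)
      (fun i t => siteEnergy U K i (γ t)) (fun i t => energyInflux K S i (γ t)) where
  hasDerivAt i t ht := by
    simpa only [one_mul] using
      hasDerivAt_siteEnergy_of_smul_velocity (a := 1) (fun j => by simpa using hγ j t ht) i
  norm_deriv_le i t _ := by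
    simpa [Real.norm_of_nonneg (siteEnergy_nonneg hK hU _ _)] using
      abs_energyInflux_le hK hU S i (γ t)

theorem siteEnergy_le_expSpread (hK : 0 ≤ K) (hU : ∀ q, 0 ≤ U.eval q) {S : Set (Site d)} {T : ℝ}
    {γ : ℝ → Config d} (hγ : IsPartialSolution U K S T γ) {c : Site d} {G : ℝ}
    (hG : ∀ i t, |t| ≤ T → siteEnergy U K i (γ t) ≤ G * Real.exp (sdist i c / 2))
    {t : ℝ} (ht : |t| ≤ T) (i : Site d) :
    siteEnergy U K i (γ t) ≤
      Real.exp (energyRate d K * |t|) * expSpread (fun j => siteEnergy U K j (γ 0)) i := by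
  have hT : 0 ≤ T := (abs_nonneg t).trans ht
  have hnonneg : ∀ j, 0 ≤ siteEnergy U K j (γ 0) := fun j => siteEnergy_nonneg hK hU j _
  have hsum := summable_exp_neg_sdist_mul hnonneg fun j => hG j 0 (by simpa using hT)
  have hA := influxConst_nonneg (d := d) hK
  have hz := isSupersolution_exp_mul_expSpread (ρ := energyRate d K) hnonneg hsum hA
    (mul_le_mul_of_nonneg_left (by gcongr; norm_num) hA) T
  have hnorm : ∀ j s, ‖siteEnergy U K j (γ s)‖ = siteEnergy U K j (γ s) := fun j s =>
    Real.norm_of_nonneg (siteEnergy_nonneg hK hU j _)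
  rw [← hnorm i t]
  refine (hγ.isSubsolution_siteEnergy hK hU).norm_le c (G := G) (energyRate_nonneg hK) (fun _ => hA)
    (fun k => le_add_of_nonneg_right (div_nonneg (sdist_nonneg k c) hT)) hz (fun k => ?_)
    (fun k s hs => ?_) t ht i
  · rw [hnorm, mul_zero, Real.exp_zero, one_mul]
    exact le_expSpread hnonneg (hsum k)
  · rw [hnorm]
    exact hG k s hs

end Energy

/-! ### Logarithmic energy bounds -/

section EnergyBound

variable {d : ℕ} {U : Polynomial ℝ} {K : ℝ}

variable (U K) in
/-- The site energies of the state `x` have averages bounded by `M` over all cubes that enter the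
definition of `Q`. -/
def QBound (M : ℝ) (x : Config d) : Prop :=
  ∀ (ν : Site d) (k : ℕ), Real.log (Real.exp 1 + sdist ν 0) < (k : ℝ) ^ d →
    cubeEnergy U K ν k x ≤ M * (2 * (k : ℝ) + 1) ^ d

/-- The constant `G` for which the bound `M` on the energy averages of a state implies
`E_k ≤ G * exp (|k - c| / 2)` for all sites `k`. -/
def growthConst (d : ℕ) (M : ℝ) (c : Site d) : ℝ := 5 ^ d * M * (4 + sdist c 0)

lemma growthConst_nonneg {M : ℝ} (hM : 0 ≤ M) (c : Site d) : 0 ≤ growthConst d M c := by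
  have := sdist_nonneg c 0
  unfold growthConst
  positivity

lemma one_le_log_add {m : ℝ} (hm : 0 ≤ m) : 1 ≤ Real.log (Real.exp 1 + m) := by
  rw [Real.le_log_iff_exp_le (by positivity)]
  linarith

lemma log_exp_one_add_le {m : ℝ} (hm : 0 ≤ m) : Real.log (Real.exp 1 + m) ≤ 2 + m := by
  linarith [Real.log_le_sub_one_of_pos (show 0 < Real.exp 1 + m by positivity),
    Real.exp_one_lt_d9]

lemma rpow_lt_iff_lt_pow (hd : 1 ≤ d) {L : ℝ} (hL : 0 ≤ L) (k : ℕ) :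
    L ^ (1 / (d : ℝ)) < (k : ℝ) ↔ L < (k : ℝ) ^ d := by
  rw [one_div, Real.rpow_inv_lt_iff_of_pos hL (Nat.cast_nonneg k) (by exact_mod_cast hd),
    Real.rpow_natCast]

lemma Q_le_iff (hd : 1 ≤ d) {M : ℝ} (hM : 0 ≤ M) (x : Config d) :
    Q U K x ≤ ENNReal.ofReal M ↔ ∀ (ν : Site d) (k : ℕ),
      Real.log (Real.exp 1 + sdist ν 0) < (k : ℝ) ^ d →
        localEnergy U K ν k x ≤ M * (2 * (k : ℝ) + 1) ^ d := by
  simp only [Q, iSup_le_iff]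
  refine forall_congr' fun ν => forall_congr' fun k => ?_
  have hlog : 0 ≤ Real.log (Real.exp 1 + (siteDist ν 0 : ℝ)) :=
    zero_le_one.trans (one_le_log_add (sdist_nonneg ν 0))
  rw [rpow_lt_iff_lt_pow hd hlog]
  refine forall_congr' fun _ => ?_
  rw [ENNReal.ofReal_le_ofReal_iff hM, div_le_iff₀ (by positivity)]

lemma two_mul_succ_add_one_pow_le (d k : ℕ) :
    (2 * ((k + 1 : ℕ) : ℝ) + 1) ^ d ≤ 3 ^ d * (2 * (k : ℝ) + 1) ^ d := by
  rw [← mul_pow]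
  gcongr
  push_cast
  linarith [Nat.cast_nonneg (α := ℝ) k]

lemma QBound.of_Q_le (hd : 1 ≤ d) (hK : 0 ≤ K) (hU : ∀ q, 0 ≤ U.eval q) {M : ℝ} (hM : 0 ≤ M)
    {x : Config d} (h : Q U K x ≤ ENNReal.ofReal M) : QBound U K (3 ^ d * M) x := by
  rw [Q_le_iff hd hM] at h
  intro ν k hk
  have hk' : Real.log (Real.exp 1 + sdist ν 0) < ((k + 1 : ℕ) : ℝ) ^ d :=
    hk.trans_le (by gcongr; exact k.le_succ)
  calc cubeEnergy U K ν k x ≤ localEnergy U K ν (k + 1) x := cubeEnergy_le_localEnergy hK hU ν k x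
    _ ≤ M * (2 * ((k + 1 : ℕ) : ℝ) + 1) ^ d := h ν (k + 1) hk'
    _ ≤ M * (3 ^ d * (2 * (k : ℝ) + 1) ^ d) := by gcongr; exact two_mul_succ_add_one_pow_le d k
    _ = 3 ^ d * M * (2 * (k : ℝ) + 1) ^ d := by ring

lemma QBound.nonneg (hd : 1 ≤ d) (hK : 0 ≤ K) (hU : ∀ q, 0 ≤ U.eval q) {M : ℝ} {x : Config d}
    (h : QBound U K M x) : 0 ≤ M := by
  obtain ⟨k, hk⟩ := exists_nat_gt (Real.log (Real.exp 1 + sdist (0 : Site d) 0))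
  have hL := one_le_log_add (sdist_nonneg (0 : Site d) 0)
  have hkd := h 0 k (hk.trans_le (le_self_pow₀ (hL.trans hk.le) (by omega)))
  exact nonneg_of_mul_nonneg_left ((cubeEnergy_nonneg hK hU 0 k x).trans hkd) (by positivity)

lemma QBound.Q_le (hd : 1 ≤ d) (hK : 0 ≤ K) (hU : ∀ q, 0 ≤ U.eval q) {M : ℝ} {x : Config d}
    (h : QBound U K M x) : Q U K x ≤ ENNReal.ofReal M := by
  rw [Q_le_iff hd (h.nonneg hd hK hU)]
  exact fun ν k hk => (localEnergy_le_cubeEnergy hK ν k x).trans (h ν k hk)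

lemma QBound.mono {M M' : ℝ} (hM : M ≤ M') {x : Config d} (h : QBound U K M x) :
    QBound U K M' x := fun ν k hk => (h ν k hk).trans (by gcongr)

lemma mem_X0_iff (hd : 1 ≤ d) (hK : 0 ≤ K) (hU : ∀ q, 0 ≤ U.eval q) {x : Config d} :
    x ∈ X0 U K ↔ ∃ M, QBound U K M x := by
  constructor
  · intro h
    refine ⟨3 ^ d * (Q U K x).toReal, QBound.of_Q_le hd hK hU ENNReal.toReal_nonneg ?_⟩
    rw [ENNReal.ofReal_toReal (ne_of_lt h)]
  · rintro ⟨M, h⟩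
    exact (h.Q_le hd hK hU).trans_lt ENNReal.ofReal_lt_top

lemma siteEnergy_le_of_cubeEnergy_le (hd : 1 ≤ d) (hK : 0 ≤ K) (hU : ∀ q, 0 ≤ U.eval q)
    {M L : ℝ} (hM : 0 ≤ M) (hL : 1 ≤ L) {ν : Site d} {x : Config d}
    (h : ∀ k : ℕ, L < (k : ℝ) ^ d → cubeEnergy U K ν k x ≤ M * (2 * (k : ℝ) + 1) ^ d) :
    siteEnergy U K ν x ≤ 5 ^ d * M * L := by
  set r := L ^ (1 / (d : ℝ)) with hr
  have hL0 : 0 ≤ L := zero_le_one.trans hL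
  have hr1 : 1 ≤ r := Real.one_le_rpow hL (by positivity)
  have hrd : r ^ d = L := by
    rw [hr, one_div]
    exact Real.rpow_inv_natCast_pow hL0 (by omega)
  obtain ⟨k, hkr, hkr'⟩ : ∃ k : ℕ, r < k ∧ (k : ℝ) ≤ r + 1 :=
    ⟨⌊r⌋₊ + 1, by exact_mod_cast Nat.lt_floor_add_one r, by
      push_cast
      linarith [Nat.floor_le (zero_le_one.trans hr1)]⟩
  calc siteEnergy U K ν x ≤ cubeEnergy U K ν k x :=
        siteEnergy_le_cubeEnergy hK hU (self_mem_cube ν k) x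
    _ ≤ M * (2 * (k : ℝ) + 1) ^ d := h k ((rpow_lt_iff_lt_pow hd hL0 k).mp hkr)
    _ ≤ M * (5 * r) ^ d := by gcongr; linarith
    _ = 5 ^ d * M * L := by rw [mul_pow, hrd]; ring

lemma QBound.siteEnergy_le (hd : 1 ≤ d) (hK : 0 ≤ K) (hU : ∀ q, 0 ≤ U.eval q) {M : ℝ}
    {x : Config d} (h : QBound U K M x) (ν : Site d) :
    siteEnergy U K ν x ≤ 5 ^ d * M * Real.log (Real.exp 1 + sdist ν 0) :=
  siteEnergy_le_of_cubeEnergy_le hd hK hU (h.nonneg hd hK hU)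
    (one_le_log_add (sdist_nonneg ν 0)) fun k hk => h ν k hk

lemma QBound.siteEnergy_le_linear (hd : 1 ≤ d) (hK : 0 ≤ K) (hU : ∀ q, 0 ≤ U.eval q) {M : ℝ}
    {x : Config d} (h : QBound U K M x) (c ν : Site d) :
    siteEnergy U K ν x ≤ 5 ^ d * M * (2 + sdist c 0 + sdist ν c) := by
  have hM := h.nonneg hd hK hU
  refine (h.siteEnergy_le hd hK hU ν).trans (mul_le_mul_of_nonneg_left ?_ (by positivity))
  linarith [log_exp_one_add_le (sdist_nonneg ν 0), sdist_triangle ν c 0]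

lemma QBound.siteEnergy_le_exp (hd : 1 ≤ d) (hK : 0 ≤ K) (hU : ∀ q, 0 ≤ U.eval q) {M : ℝ}
    {x : Config d} (h : QBound U K M x) (c ν : Site d) :
    siteEnergy U K ν x ≤ growthConst d M c * Real.exp (sdist ν c / 2) := by
  have hM := h.nonneg hd hK hU
  refine (h.siteEnergy_le_linear hd hK hU c ν).trans ?_
  rw [growthConst, mul_assoc (5 ^ d * M)]
  refine mul_le_mul_of_nonneg_left ?_ (by positivity)
  nlinarith [Real.add_one_le_exp (sdist ν c / 2), sdist_nonneg c 0, sdist_nonneg ν c]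

section Propagation

variable {S : Set (Site d)} {T : ℝ} {γ : ℝ → Config d} {c : Site d} {G : ℝ}

lemma IsPartialSolution.cubeEnergy_le (hK : 0 ≤ K) (hU : ∀ q, 0 ≤ U.eval q)
    (hγ : IsPartialSolution U K S T γ)
    (hG : ∀ i t, |t| ≤ T → siteEnergy U K i (γ t) ≤ G * Real.exp (sdist i c / 2))
    {ν : Site d} {k : ℕ} {M : ℝ}
    (hM : ∀ l, k ≤ l → cubeEnergy U K ν l (γ 0) ≤ M * (2 * (l : ℝ) + 1) ^ d)
    {t : ℝ} (ht : |t| ≤ T) :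
    cubeEnergy U K ν k (γ t) ≤
      Real.exp (energyRate d K * |t|) * (spreadConst d * (M * (2 * (k : ℝ) + 1) ^ d)) := by
  have hT : 0 ≤ T := (abs_nonneg t).trans ht
  have hnonneg : ∀ j, 0 ≤ siteEnergy U K j (γ 0) := fun j => siteEnergy_nonneg hK hU j _
  have hsum := summable_exp_neg_sdist_mul hnonneg fun j => hG j 0 (by simpa using hT)
  calc cubeEnergy U K ν k (γ t)
      ≤ ∑ i ∈ cube ν k, Real.exp (energyRate d K * |t|) *
          expSpread (fun j => siteEnergy U K j (γ 0)) i :=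
        Finset.sum_le_sum fun i _ => siteEnergy_le_expSpread hK hU hγ hG ht i
    _ = Real.exp (energyRate d K * |t|) *
          ∑ i ∈ cube ν k, expSpread (fun j => siteEnergy U K j (γ 0)) i := by
        rw [Finset.mul_sum]
    _ ≤ _ := by
        gcongr
        exact sum_cube_expSpread_le hnonneg hM hsum

lemma QBound.of_isPartialSolution (hK : 0 ≤ K) (hU : ∀ q, 0 ≤ U.eval q)
    (hγ : IsPartialSolution U K S T γ)
    (hG : ∀ i t, |t| ≤ T → siteEnergy U K i (γ t) ≤ G * Real.exp (sdist i c / 2))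
    {M : ℝ} (hM : QBound U K M (γ 0)) {t : ℝ} (ht : |t| ≤ T) :
    QBound U K (Real.exp (energyRate d K * |t|) * spreadConst d * M) (γ t) := by
  intro ν k hk
  refine (hγ.cubeEnergy_le hK hU hG (ν := ν) (k := k) (M := M)
    (fun l hl => hM ν l (hk.trans_le ?_)) ht).trans (le_of_eq (by ring))
  gcongr

lemma isPartialSolution_univ_iff :
    IsPartialSolution U K univ T γ ↔
      ∀ i t, |t| ≤ T → HasDerivAt (fun s => γ s i) (velocity U K i (γ t)) t := by
  simp [IsPartialSolution]

lemma IsSolution.isPartialSolution (h : IsSolution U K γ) (T : ℝ) :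
    IsPartialSolution U K univ T γ :=
  isPartialSolution_univ_iff.mpr fun i t _ => (h.deriv_q i t).prodMk (h.deriv_p i t)

lemma IsSolution.exists_qBound (hd : 1 ≤ d) (hK : 0 ≤ K) (hU : ∀ q, 0 ≤ U.eval q)
    (h : IsSolution U K γ) (T : ℝ) : ∃ M, ∀ t, |t| ≤ T → QBound U K M (γ t) := by
  obtain ⟨M, hM⟩ := h.locally_bounded T
  exact ⟨3 ^ d * M, fun t ht => QBound.of_Q_le hd hK hU M.2 (by simpa using hM t ht)⟩

lemma IsSolution.of_qBound (hd : 1 ≤ d) (hK : 0 ≤ K) (hU : ∀ q, 0 ≤ U.eval q)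
    (h : ∀ T, IsPartialSolution U K univ T γ)
    (hM : ∀ T, ∃ M, ∀ t, |t| ≤ T → QBound U K M (γ t)) : IsSolution U K γ := by
  have hγ : ∀ i t, HasDerivAt (fun s => γ s i) (velocity U K i (γ t)) t := fun i t =>
    isPartialSolution_univ_iff.mp (h |t|) i t le_rfl
  refine ⟨fun i t => ?_, fun i t => ?_, fun T => ?_⟩
  · exact (ContinuousLinearMap.fst ℝ ℝ ℝ).hasFDerivAt.comp_hasDerivAt t (hγ i t)
  · exact (ContinuousLinearMap.snd ℝ ℝ ℝ).hasFDerivAt.comp_hasDerivAt t (hγ i t)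
  · obtain ⟨M, hM⟩ := hM T
    exact ⟨M.toNNReal, fun t ht => (hM t ht).Q_le hd hK hU⟩

lemma IsSolution.cubeEnergy_le (hd : 1 ≤ d) (hK : 0 ≤ K) (hU : ∀ q, 0 ≤ U.eval q)
    (h : IsSolution U K γ) {ν : Site d} {k : ℕ} {M : ℝ}
    (hM : ∀ l, k ≤ l → cubeEnergy U K ν l (γ 0) ≤ M * (2 * (l : ℝ) + 1) ^ d) (t : ℝ) :
    cubeEnergy U K ν k (γ t) ≤
      Real.exp (energyRate d K * |t|) * (spreadConst d * (M * (2 * (k : ℝ) + 1) ^ d)) := by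
  obtain ⟨M', hM'⟩ := h.exists_qBound hd hK hU |t|
  exact (h.isPartialSolution |t|).cubeEnergy_le hK hU
    (fun i s hs => (hM' s hs).siteEnergy_le_exp hd hK hU 0 i) hM le_rfl

lemma IsSolution.qBound (hd : 1 ≤ d) (hK : 0 ≤ K) (hU : ∀ q, 0 ≤ U.eval q)
    (h : IsSolution U K γ) {M : ℝ} (hM : QBound U K M (γ 0)) (t : ℝ) :
    QBound U K (Real.exp (energyRate d K * |t|) * spreadConst d * M) (γ t) := by
  obtain ⟨M', hM'⟩ := h.exists_qBound hd hK hU |t|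
  exact QBound.of_isPartialSolution hK hU (h.isPartialSolution |t|)
    (fun i s hs => (hM' s hs).siteEnergy_le_exp hd hK hU 0 i) hM le_rfl

end Propagation

end EnergyBound

/-! ### Stability of solutions -/

section Stability

variable {d : ℕ} {U : Polynomial ℝ} {K C : ℝ}

lemma abs_le_one_add_sq_div_two (a : ℝ) : |a| ≤ (1 + a ^ 2) / 2 := by
  nlinarith [sq_nonneg (|a| - 1), sq_abs a]

lemma abs_le_one_add_pow_four (a : ℝ) : |a| ≤ 1 + a ^ 4 := by
  nlinarith [abs_le_one_add_sq_div_two a, sq_nonneg (a ^ 2 - 1)]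

lemma pow_four_position_le (hC : QuarticBounds U C) (hK : 0 ≤ K) (i : Site d) (x : Config d) :
    (x i).1 ^ 4 ≤ C * siteEnergy U K i x :=
  (hC.pow_four_le _).trans (mul_le_mul_of_nonneg_left (eval_add_one_le hK i x) hC.pos.le)

lemma abs_momentum_le (hC : QuarticBounds U C) (hK : 0 ≤ K) (i : Site d) (x : Config d) :
    |(x i).2| ≤ 3 * siteEnergy U K i x := by
  linarith [abs_le_one_add_sq_div_two (x i).2, one_le_siteEnergy hK hC.nonneg i x,
    sq_momentum_le hK hC.nonneg i x]

lemma norm_le_siteEnergy (hC : QuarticBounds U C) (hK : 0 ≤ K) (i : Site d) (x : Config d) :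
    ‖x i‖ ≤ (3 + C) * siteEnergy U K i x := by
  have h1 := one_le_siteEnergy hK hC.nonneg i x
  have hCE := mul_nonneg hC.pos.le (zero_le_one.trans h1)
  rw [Prod.norm_def, Real.norm_eq_abs, Real.norm_eq_abs]
  refine max_le ?_ ?_
  · linarith [abs_le_one_add_pow_four (x i).1, pow_four_position_le hC hK i x]
  · linarith [abs_momentum_le hC hK i x]

lemma abs_deriv_eval_le (hC : QuarticBounds U C) (hK : 0 ≤ K) (i : Site d) (x : Config d) :
    |U.derivative.eval (x i).1| ≤ C * (1 + C) * siteEnergy U K i x := by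
  have := hC.pos
  refine (hC.deriv_le _).trans ?_
  rw [mul_assoc]
  gcongr
  linarith [pow_four_position_le hC hK i x, one_le_siteEnergy hK hC.nonneg i x]

lemma abs_bond_force_le (hC : QuarticBounds U C) (hK : 0 ≤ K) (i : Site d) (x : Config d) :
    |K * ∑ j ∈ neighbors i, ((x i).1 - (x j).1)| ≤ 3 ^ d * (K + 4) * siteEnergy U K i x := by
  have h1 := one_le_siteEnergy hK hC.nonneg i x
  have hE0 : 0 ≤ (K + 4) * siteEnergy U K i x := mul_nonneg (by linarith) (zero_le_one.trans h1)
  rw [Finset.mul_sum]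
  calc |∑ j ∈ neighbors i, K * ((x i).1 - (x j).1)|
      ≤ ∑ _j ∈ neighbors i, (K + 4) * siteEnergy U K i x := by
        refine (Finset.abs_sum_le_sum_abs _ _).trans (Finset.sum_le_sum fun j hj => ?_)
        rw [abs_mul, abs_of_nonneg hK]
        nlinarith [bond_le hK hC.nonneg hj x,
          mul_le_mul_of_nonneg_left (abs_le_one_add_sq_div_two ((x i).1 - (x j).1)) hK,
          mul_le_mul_of_nonneg_left h1 hK]
    _ ≤ ∑ _j ∈ closedNeighbors i, (K + 4) * siteEnergy U K i x :=
        Finset.sum_le_sum_of_subset_of_nonneg (neighbors_subset_closedNeighbors i)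
          fun _ _ _ => hE0
    _ ≤ 3 ^ d * ((K + 4) * siteEnergy U K i x) :=
        sum_closedNeighbors_le (fun _ _ => le_rfl) hE0
    _ = 3 ^ d * (K + 4) * siteEnergy U K i x := by ring

/-- The constant in the bound of the velocity of a site by its energy. -/
def velocityConst (d : ℕ) (K C : ℝ) : ℝ := 3 + C * (1 + C) + 3 ^ d * (K + 4)

lemma velocityConst_nonneg (hC : QuarticBounds U C) (hK : 0 ≤ K) : 0 ≤ velocityConst d K C := by
  have := hC.pos
  unfold velocityConst
  positivity

lemma norm_velocity_le (hC : QuarticBounds U C) (hK : 0 ≤ K) (i : Site d) (x : Config d) :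
    ‖velocity U K i x‖ ≤ velocityConst d K C * siteEnergy U K i x := by
  have := hC.pos
  have hE := siteEnergy_nonneg hK hC.nonneg i x
  have hbond : 0 ≤ 3 ^ d * (K + 4) * siteEnergy U K i x := by positivity
  have hderiv : 0 ≤ C * (1 + C) * siteEnergy U K i x := by positivity
  rw [Prod.norm_def, Real.norm_eq_abs, Real.norm_eq_abs, velocityConst, add_mul, add_mul]
  refine max_le ?_ ((abs_sub _ _).trans ?_)
  · exact (abs_momentum_le hC hK i x).trans (by linarith)
  · rw [abs_neg]
    linarith [abs_deriv_eval_le hC hK i x, abs_bond_force_le hC hK i x]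

lemma abs_mul_sum_neighbors_sub_le (hK : 0 ≤ K) (i : Site d) {a w : Site d → ℝ}
    (h : ∀ j, |a j| ≤ w j) :
    |K * ∑ j ∈ neighbors i, (a i - a j)| ≤ K * (3 ^ d + 1) * ∑ j ∈ closedNeighbors i, w j := by
  have hw : ∀ j, 0 ≤ w j := fun j => (abs_nonneg _).trans (h j)
  have hi : w i ≤ ∑ j ∈ closedNeighbors i, w j :=
    Finset.single_le_sum (f := w) (fun j _ => hw j) (self_mem_closedNeighbors i)
  rw [abs_mul, abs_of_nonneg hK, mul_assoc]
  refine mul_le_mul_of_nonneg_left ?_ hK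
  calc |∑ j ∈ neighbors i, (a i - a j)| ≤ ∑ j ∈ neighbors i, (w i + w j) :=
        (Finset.abs_sum_le_sum_abs _ _).trans (Finset.sum_le_sum fun j _ =>
          (abs_sub _ _).trans (add_le_add (h i) (h j)))
    _ ≤ ∑ j ∈ closedNeighbors i, (w i + w j) :=
        Finset.sum_le_sum_of_subset_of_nonneg (neighbors_subset_closedNeighbors i)
          fun j _ _ => add_nonneg (hw i) (hw j)
    _ = ∑ _j ∈ closedNeighbors i, w i + ∑ j ∈ closedNeighbors i, w j := Finset.sum_add_distrib
    _ ≤ 3 ^ d * w i + ∑ j ∈ closedNeighbors i, w j := by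
        gcongr
        exact sum_closedNeighbors_le (fun _ _ => le_rfl) (hw i)
    _ ≤ (3 ^ d + 1) * ∑ j ∈ closedNeighbors i, w j := by
        rw [add_one_mul]
        gcongr

/-- The Lipschitz constant of the velocity of a site, where `r` bounds the sum of the squares of
the two positions of that site. -/
def lipCoeff (d : ℕ) (K C r : ℝ) : ℝ := 1 + C * (1 + r) + K * (3 ^ d + 1)

lemma lipCoeff_nonneg (hC : 0 ≤ C) (hK : 0 ≤ K) {r : ℝ} (hr : 0 ≤ r) : 0 ≤ lipCoeff d K C r := by
  unfold lipCoeff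
  positivity

lemma lipCoeff_mono (hC : 0 ≤ C) : Monotone (lipCoeff d K C) := fun r s h => by
  unfold lipCoeff
  gcongr

lemma force_sub_force (i : Site d) (x y : Config d) :
    force U K i x - force U K i y =
      -(U.derivative.eval (x i).1 - U.derivative.eval (y i).1) -
        K * ∑ j ∈ neighbors i, (((x i).1 - (y i).1) - ((x j).1 - (y j).1)) := by
  have hsum : ∑ j ∈ neighbors i, (((x i).1 - (y i).1) - ((x j).1 - (y j).1)) =
      ∑ j ∈ neighbors i, ((x i).1 - (x j).1) - ∑ j ∈ neighbors i, ((y i).1 - (y j).1) := by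
    rw [← Finset.sum_sub_distrib]
    exact Finset.sum_congr rfl fun j _ => by ring
  rw [hsum, force, force]
  ring

lemma norm_velocity_sub_le (hC : QuarticBounds U C) (hK : 0 ≤ K) (i : Site d) (x y : Config d) :
    ‖velocity U K i x - velocity U K i y‖ ≤
      lipCoeff d K C ((x i).1 ^ 2 + (y i).1 ^ 2) * ∑ j ∈ closedNeighbors i, ‖x j - y j‖ := by
  have hC0 := hC.pos
  set D := ∑ j ∈ closedNeighbors i, ‖x j - y j‖
  have hi : ‖x i - y i‖ ≤ D := Finset.single_le_sum (f := fun j => ‖x j - y j‖)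
    (fun j _ => norm_nonneg _) (self_mem_closedNeighbors i)
  have hD : 0 ≤ D := (norm_nonneg _).trans hi
  have hpos : ∀ j, |(x j).1 - (y j).1| ≤ ‖x j - y j‖ := fun j => norm_fst_le (x j - y j)
  have hderiv : |U.derivative.eval (x i).1 - U.derivative.eval (y i).1| ≤
      C * (1 + ((x i).1 ^ 2 + (y i).1 ^ 2)) * D := by
    rw [abs_sub_comm]
    refine (hC.abs_deriv_sub_le (x i).1 (y i).1).trans ?_
    rw [abs_sub_comm, add_assoc]
    gcongr
    exact (hpos i).trans hi
  have hbond := abs_mul_sum_neighbors_sub_le hK i hpos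
  have hderiv0 := (abs_nonneg _).trans hderiv
  have hbond0 := (abs_nonneg _).trans hbond
  rw [Prod.norm_def, Real.norm_eq_abs, Real.norm_eq_abs, lipCoeff, add_mul, add_mul, one_mul]
  refine max_le ((norm_snd_le (x i - y i)).trans (by linarith)) ?_
  simp only [velocity, Prod.snd_sub, force_sub_force]
  refine (abs_sub _ _).trans ?_
  rw [abs_neg]
  linarith

lemma sq_le_mul_pow_four_add_inv {a : ℝ} (ha : 0 < a) (q : ℝ) : q ^ 2 ≤ a * q ^ 4 + a⁻¹ := by
  rw [← mul_le_mul_iff_of_pos_left ha, mul_add, mul_inv_cancel₀ ha.ne']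
  nlinarith [sq_nonneg (a * q ^ 2 - 1), mul_nonneg ha.le (sq_nonneg q)]

/-- As `q ^ 4` is bounded by the energy, which grows logarithmically, the growth of `q ^ 2` is
slower than any linear one. -/
lemma exists_sq_position_le (hd : 1 ≤ d) (hC : QuarticBounds U C) (hK : 0 ≤ K) (M : ℝ)
    (c : Site d) {ε : ℝ} (hε : 0 < ε) :
    ∃ ρ, 0 ≤ ρ ∧ ∀ x : Config d, QBound U K M x → ∀ k, (x k).1 ^ 2 ≤ ρ + ε * sdist k c := by
  have hC0 := hC.pos
  have hc0 := sdist_nonneg c 0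
  set B := C * (5 ^ d * (|M| + 1)) with hB
  have hB0 : 0 < B := by positivity
  set a := ε / B with ha
  have ha0 : 0 < a := by positivity
  refine ⟨ε * (2 + sdist c 0) + a⁻¹, by positivity, fun x hx k => ?_⟩
  have hX : 0 ≤ 2 + sdist c 0 + sdist k c := by linarith [sdist_nonneg k c]
  have hq : (x k).1 ^ 4 ≤ B * (2 + sdist c 0 + sdist k c) := by
    refine (pow_four_position_le hC hK k x).trans ?_
    rw [hB, mul_assoc]
    refine mul_le_mul_of_nonneg_left ((hx.siteEnergy_le_linear hd hK hC.nonneg c k).trans ?_) hC0.le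
    gcongr
    linarith [le_abs_self M]
  calc (x k).1 ^ 2 ≤ a * (x k).1 ^ 4 + a⁻¹ := sq_le_mul_pow_four_add_inv ha0 _
    _ ≤ a * (B * (2 + sdist c 0 + sdist k c)) + a⁻¹ := by gcongr
    _ = ε * (2 + sdist c 0) + a⁻¹ + ε * sdist k c := by
        rw [← mul_assoc, ha, div_mul_cancel₀ ε hB0.ne']
        ring

/-- The coefficients of the linearized system grow slower than any linear function of the distance,
so that they are absorbed by the time derivative of a sliding weight. -/
lemma exists_lipCoeff_mul_le (hd : 1 ≤ d) (hC : QuarticBounds U C) (hK : 0 ≤ K) (M : ℝ)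
    (c : Site d) {T : ℝ} (hT : 0 < T) :
    ∃ (r : Site d → ℝ) (ρ : ℝ), 0 ≤ ρ ∧ (∀ k, 0 ≤ r k) ∧
      (∀ x : Config d, QBound U K M x → ∀ k, 2 * (x k).1 ^ 2 ≤ r k) ∧
      ∀ k, lipCoeff d K C (r k) * (3 ^ d * Real.exp 2) + 1 ≤ ρ + sdist k c / T := by
  have hC0 := hC.pos
  set κ := C * (3 ^ d * Real.exp 2) with hκ
  have hκ0 : 0 < κ := by positivity
  obtain ⟨ρ₀, hρ₀, hpos⟩ :=
    exists_sq_position_le hd hC hK M c (ε := 1 / (2 * κ * T)) (by positivity)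
  have hlip : 0 ≤ lipCoeff d K C (2 * ρ₀) := lipCoeff_nonneg hC0.le hK (by positivity)
  refine ⟨fun k => 2 * (ρ₀ + 1 / (2 * κ * T) * sdist k c),
    lipCoeff d K C (2 * ρ₀) * (3 ^ d * Real.exp 2) + 1, by positivity, fun k => ?_,
    fun x hx k => mul_le_mul_of_nonneg_left (hpos x hx k) two_pos.le, fun k => le_of_eq ?_⟩
  · have := sdist_nonneg k c
    positivity
  · have hdist : κ * (2 * (1 / (2 * κ * T) * sdist k c)) = sdist k c / T := by field_simp
    rw [← hdist, hκ]
    unfold lipCoeff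
    ring

lemma QBound.norm_velocity_le_exp (hd : 1 ≤ d) (hC : QuarticBounds U C) (hK : 0 ≤ K) {M : ℝ}
    {x : Config d} (hx : QBound U K M x) (c k : Site d) :
    ‖velocity U K k x‖ ≤ velocityConst d K C * growthConst d M c * Real.exp (sdist k c / 2) := by
  rw [mul_assoc]
  exact (norm_velocity_le hC hK k x).trans (mul_le_mul_of_nonneg_left
    (hx.siteEnergy_le_exp hd hK hC.nonneg c k) (velocityConst_nonneg hC hK))

lemma QBound.norm_sub_le_exp (hd : 1 ≤ d) (hC : QuarticBounds U C) (hK : 0 ≤ K) {M : ℝ}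
    {x y : Config d} (hx : QBound U K M x) (hy : QBound U K M y) (c k : Site d) :
    ‖x k - y k‖ ≤ 2 * (3 + C) * growthConst d M c * Real.exp (sdist k c / 2) := by
  have hnorm : ∀ {z : Config d}, QBound U K M z →
      ‖z k‖ ≤ (3 + C) * (growthConst d M c * Real.exp (sdist k c / 2)) := fun {z} hz =>
    (norm_le_siteEnergy hC hK k z).trans (mul_le_mul_of_nonneg_left
      (hz.siteEnergy_le_exp hd hK hC.nonneg c k) (by linarith [hC.pos]))
  linarith [norm_sub_le (x k) (y k), hnorm hx, hnorm hy]

section PartialSolutions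

variable {S S' : Set (Site d)} {T : ℝ} {γ γ' : ℝ → Config d}

lemma IsPartialSolution.isSubsolution_sub (hC : QuarticBounds U C) (hK : 0 ≤ K) (hSS' : S ⊆ S')
    (hγ : IsPartialSolution U K S T γ) (hγ' : IsPartialSolution U K S' T γ') {r b : Site d → ℝ}
    (hr : ∀ k t, |t| ≤ T → (γ t k).1 ^ 2 + (γ' t k).1 ^ 2 ≤ r k) (hb0 : ∀ k, 0 ≤ b k)
    (hb : ∀ k ∈ S' \ S, ∀ t, |t| ≤ T → ‖velocity U K k (γ' t)‖ ≤ b k) :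
    IsSubsolution T (fun k => lipCoeff d K C (r k)) (fun k _ => b k)
      (fun k t => γ t k - γ' t k)
      (fun k t => S.indicator (fun j => velocity U K j (γ t)) k -
        S'.indicator (fun j => velocity U K j (γ' t)) k) where
  hasDerivAt k t ht := (hγ k t ht).sub (hγ' k t ht)
  norm_deriv_le k t ht := by
    have hlip : ‖velocity U K k (γ t) - velocity U K k (γ' t)‖ ≤
        lipCoeff d K C (r k) * ∑ j ∈ closedNeighbors k, ‖γ t j - γ' t j‖ := by
      refine (norm_velocity_sub_le hC hK k _ _).trans ?_
      gcongr
      exact lipCoeff_mono hC.pos.le (hr k t ht)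
    have hlip0 := (norm_nonneg _).trans hlip
    have hbk := hb0 k
    by_cases hS : k ∈ S
    · rw [indicator_of_mem hS, indicator_of_mem (hSS' hS)]
      linarith
    by_cases hS' : k ∈ S'
    · rw [indicator_of_notMem hS, indicator_of_mem hS', zero_sub, norm_neg]
      linarith [hb k ⟨hS', hS⟩ t ht]
    · rw [indicator_of_notMem hS, indicator_of_notMem hS', sub_self, norm_zero]
      positivity

theorem exists_stability (hd : 1 ≤ d) (hC : QuarticBounds U C) (hK : 0 ≤ K) (M : ℝ) (c : Site d)
    (hT : 0 < T) :
    ∃ ρ, 0 ≤ ρ ∧ ∀ {S S' : Set (Site d)} {γ γ' : ℝ → Config d} {H σ : ℝ}, S ⊆ S' →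
      IsPartialSolution U K S T γ → IsPartialSolution U K S' T γ' →
      (∀ t, |t| ≤ T → QBound U K M (γ t)) → (∀ t, |t| ≤ T → QBound U K M (γ' t)) →
      0 ≤ H → |σ| ≤ 1 →
      (∀ k ∈ S' \ S, ∀ t, |t| ≤ T → ‖velocity U K k (γ' t)‖ ≤ H * Real.exp (σ * sdist k c)) →
      (∀ k, ‖γ 0 k - γ' 0 k‖ ≤ H * Real.exp (σ * sdist k c)) →
      ∀ t, |t| ≤ T → ∀ k, ‖γ t k - γ' t k‖ ≤ H * slidingWeight c T ρ σ k |t| := by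
  obtain ⟨r, ρ, hρ, hr0, hr, hrρ⟩ := exists_lipCoeff_mul_le hd hC hK M c hT
  refine ⟨ρ, hρ, fun {S S' γ γ' H σ} hSS' hγ hγ' hM hM' hH hσ hforce h0 => ?_⟩
  exact (hγ.isSubsolution_sub hC hK hSS' hγ' (r := r)
    (fun k t ht => by linarith [hr _ (hM t ht) k, hr _ (hM' t ht) k])
    (fun k => by positivity) hforce).norm_le_slidingWeight c hρ hH hσ
    (fun k => lipCoeff_nonneg hC.pos.le hK (hr0 k)) hrρ h0
    (fun k t ht => (hM t ht).norm_sub_le_exp hd hC hK (hM' t ht) c k)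

end PartialSolutions

end Stability

/-! ### Existence and uniqueness of the dynamics -/

theorem exists_hasDerivAt_of_hasCompactSupport {E : Type*} [NormedAddCommGroup E]
    [NormedSpace ℝ E] [CompleteSpace E] {f : E → E} (hf : ContDiff ℝ 1 f)
    (hsupp : HasCompactSupport f) (x : E) {T : ℝ} (hT : 0 ≤ T) :
    ∃ y : ℝ → E, y 0 = x ∧ ∀ t, |t| ≤ T → HasDerivAt y (f (y t)) t := by
  obtain ⟨V, hV⟩ := hsupp.exists_bound_of_continuous hf.continuous
  obtain ⟨A, hA⟩ := hf.lipschitzWith_of_hasCompactSupport hsupp one_ne_zero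
  have hV0 : 0 ≤ V := (norm_nonneg _).trans (hV x)
  have h0 : (0 : ℝ) ∈ Icc (-(T + 1)) (T + 1) := ⟨by linarith, by linarith⟩
  have hPL : IsPicardLindelof (fun _ => f) (tmin := -(T + 1)) (tmax := T + 1) ⟨0, h0⟩ x
      ⟨V * (T + 1), by positivity⟩ 0 ⟨V, hV0⟩ A := by
    refine IsPicardLindelof.of_time_independent (fun y _ => hV y) hA.lipschitzOnWith ?_
    simp only [sub_zero, zero_sub, neg_neg, max_self, NNReal.coe_zero]
    exact le_rfl
  obtain ⟨y, hy0, hy⟩ := hPL.exists_eq_forall_mem_Icc_hasDerivWithinAt₀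
  refine ⟨y, hy0, fun t ht => ?_⟩
  have ht' := abs_le.mp ht
  exact (hy t ⟨by linarith, by linarith⟩).hasDerivAt
    (Icc_mem_nhds (by linarith) (by linarith))

section Existence

variable {d : ℕ} {U : Polynomial ℝ} {K C : ℝ}

theorem IsSolution.eq_of_eq_zero (hd : 1 ≤ d) (hC : QuarticBounds U C) (hK : 0 ≤ K)
    {γ γ' : ℝ → Config d} (h : IsSolution U K γ) (h' : IsSolution U K γ') (h0 : γ 0 = γ' 0) :
    γ = γ' := by
  funext t k
  obtain ⟨M, hM⟩ := h.exists_qBound hd hK hC.nonneg (|t| + 1)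
  obtain ⟨M', hM'⟩ := h'.exists_qBound hd hK hC.nonneg (|t| + 1)
  obtain ⟨ρ, -, hρ⟩ := exists_stability hd hC hK (max M M') (0 : Site d)
    (T := |t| + 1) (by positivity)
  have := hρ (σ := 0) Subset.rfl (h.isPartialSolution _) (h'.isPartialSolution _)
    (fun s hs => (hM s hs).mono (le_max_left _ _)) (fun s hs => (hM' s hs).mono (le_max_right _ _))
    le_rfl (by simp) (by simp) (by simp [h0]) t (by linarith) k
  simpa [sub_eq_zero] using this

/-- The state that agrees with `y` on `B` and with `x` elsewhere. -/
def glue (B : Finset (Site d)) (x : Config d) (y : B → ℝ × ℝ) : Config d :=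
  fun i => if h : i ∈ B then y ⟨i, h⟩ else x i

lemma glue_of_mem {B : Finset (Site d)} {x : Config d} {y : B → ℝ × ℝ} {i : Site d}
    (h : i ∈ B) : glue B x y i = y ⟨i, h⟩ := by simp [glue, h]

lemma glue_of_notMem {B : Finset (Site d)} {x : Config d} {y : B → ℝ × ℝ} {i : Site d}
    (h : i ∉ B) : glue B x y i = x i := by simp [glue, h]

lemma glue_restrict (B : Finset (Site d)) (x : Config d) : glue B x (fun i => x i) = x := by
  funext i
  by_cases hi : i ∈ B
  · rw [glue_of_mem hi]
  · rw [glue_of_notMem hi]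

lemma contDiff_glue (B : Finset (Site d)) (x : Config d) (i : Site d) {n : ℕ∞} :
    ContDiff ℝ n fun y : B → ℝ × ℝ => glue B x y i := by
  by_cases hi : i ∈ B
  · simp only [glue_of_mem hi]
    fun_prop
  · simp only [glue_of_notMem hi]
    fun_prop

lemma contDiff_eval_glue (P : Polynomial ℝ) (B : Finset (Site d)) (x : Config d) (i : Site d)
    {n : ℕ∞} : ContDiff ℝ n fun y : B → ℝ × ℝ => P.eval (glue B x y i).1 := by
  simpa only [Polynomial.coe_aeval_eq_eval, Function.comp_def] using
    (P.contDiff_aeval n).comp (contDiff_glue B x i).fst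

lemma contDiff_velocity_glue (B : Finset (Site d)) (x : Config d) (i : Site d) {n : ℕ∞} :
    ContDiff ℝ n fun y : B → ℝ × ℝ => velocity U K i (glue B x y) := by
  unfold velocity force
  exact (contDiff_glue B x i).snd.prodMk ((contDiff_eval_glue _ B x i).neg.sub
    (contDiff_const.mul (ContDiff.sum fun j _ =>
      (contDiff_glue B x i).fst.sub (contDiff_glue B x j).fst)))

lemma sum_energyInflux_eq_zero {S : Set (Site d)} {B : Finset (Site d)}
    (hB : ∀ i ∈ S, closedNeighbors i ⊆ B) (x : Config d) :
    ∑ i ∈ B, energyInflux K S i x = 0 := by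
  classical
  set P := S.indicator fun k => (x k).2
  set F : Site d → Site d → ℝ := fun i j =>
    if j ∈ neighbors i then -(K / 2) * ((x i).1 - (x j).1) * (P i + P j) else 0 with hF
  have hinner : ∀ i ∈ B, energyInflux K S i x = ∑ j ∈ B, F i j := by
    intro i _
    rw [Finset.sum_ite_mem, energyInflux]
    refine (Finset.sum_subset Finset.inter_subset_right fun j hj hj' => ?_).symm
    have hjB : j ∉ B := fun h => hj' (Finset.mem_inter.mpr ⟨h, hj⟩)
    have hiS : i ∉ S := fun h => hjB (hB i h (neighbors_subset_closedNeighbors i hj))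
    have hjS : j ∉ S := fun h => hjB (hB j h (self_mem_closedNeighbors j))
    simp [hiS, hjS]
  have hanti : ∀ i j, F i j = -F j i := by
    intro i j
    simp only [hF, mem_neighbors, siteDist_comm i j]
    split_ifs <;> ring
  have hswap : ∑ i ∈ B, ∑ j ∈ B, F i j = -∑ i ∈ B, ∑ j ∈ B, F i j := by
    refine Finset.sum_comm.trans ?_
    simp only [← Finset.sum_neg_distrib]
    exact Finset.sum_congr rfl fun i _ => Finset.sum_congr rfl fun j _ => hanti j i
  rw [Finset.sum_congr rfl hinner]
  linarith

lemma sum_siteEnergy_eq_of_smul_velocity {S : Set (Site d)} {B : Finset (Site d)}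
    (hB : ∀ i ∈ S, closedNeighbors i ⊆ B) {γ : ℝ → Config d} {a : ℝ → ℝ} {T : ℝ}
    (h : ∀ i t, |t| ≤ T →
      HasDerivAt (fun s => γ s i) (a t • S.indicator (fun j => velocity U K j (γ t)) i) t)
    {t : ℝ} (ht : |t| ≤ T) :
    ∑ i ∈ B, siteEnergy U K i (γ t) = ∑ i ∈ B, siteEnergy U K i (γ 0) := by
  have hderiv : ∀ s ∈ Icc (-T) T,
      HasDerivWithinAt (fun s => ∑ i ∈ B, siteEnergy U K i (γ s)) 0 (Icc (-T) T) s := by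
    intro s hs
    have := HasDerivAt.fun_sum (u := B) fun i _ =>
      hasDerivAt_siteEnergy_of_smul_velocity (fun j => h j s (abs_le.mpr hs)) i
    rw [← Finset.mul_sum, sum_energyInflux_eq_zero hB, mul_zero] at this
    exact this.hasDerivWithinAt
  have := (convex_Icc (-T) T).norm_image_sub_le_of_norm_hasDerivWithin_le (C := 0) hderiv (by simp)
    (abs_le.mp (show |(0 : ℝ)| ≤ T by simpa using (abs_nonneg t).trans ht)) (abs_le.mp ht)
  simpa [sub_eq_zero] using this

lemma siteEnergy_le_of_eqOn_compl (hK : 0 ≤ K) (hU : ∀ q, 0 ≤ U.eval q) {B : Finset (Site d)}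
    {x y : Config d} (hxy : ∀ i ∉ B, y i = x i) (i : Site d) :
    siteEnergy U K i y ≤
      siteEnergy U K i x + ∑ j ∈ B.biUnion closedNeighbors, siteEnergy U K j y := by
  by_cases hi : i ∈ B.biUnion closedNeighbors
  · have := Finset.single_le_sum (f := fun j => siteEnergy U K j y)
      (fun j _ => siteEnergy_nonneg hK hU j y) hi
    linarith [siteEnergy_nonneg hK hU i x]
  · have hout : ∀ j ∈ closedNeighbors i, y j = x j := fun j hj => hxy j fun hjB =>
      hi (Finset.mem_biUnion.mpr ⟨j, hjB, mem_closedNeighbors_comm.mp hj⟩)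
    have heq : siteEnergy U K i y = siteEnergy U K i x := by
      unfold siteEnergy
      rw [hout i (self_mem_closedNeighbors i)]
      exact congrArg _ (Finset.sum_congr rfl fun j hj => by
        rw [hout j (neighbors_subset_closedNeighbors i hj)])
    linarith [Finset.sum_nonneg fun j (_ : j ∈ B.biUnion closedNeighbors) =>
      siteEnergy_nonneg hK hU j y]

lemma norm_le_sum_siteEnergy (hC : QuarticBounds U C) (hK : 0 ≤ K) {B : Finset (Site d)}
    {i : Site d} (hi : i ∈ B) (x : Config d) :
    ‖x i‖ ≤ (3 + C) * ∑ j ∈ B, siteEnergy U K j x := by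
  have hC0 := hC.pos
  refine (norm_le_siteEnergy hC hK i x).trans ?_
  gcongr
  exact Finset.single_le_sum (f := fun j => siteEnergy U K j x)
    (fun j _ => siteEnergy_nonneg hK hC.nonneg j x) hi

/- The velocity is cut off at large states by a scalar factor, which makes the vector field bounded
and Lipschitz and still conserves the energy; by energy conservation the solution never feels the
cut-off. -/
theorem exists_isPartialSolution (hC : QuarticBounds U C) (hK : 0 ≤ K) (B : Finset (Site d))
    (x : Config d) {T : ℝ} (hT : 0 ≤ T) :
    ∃ γ : ℝ → Config d, γ 0 = x ∧ IsPartialSolution U K B T γ ∧ ∀ i t, |t| ≤ T →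
      siteEnergy U K i (γ t) ≤
        siteEnergy U K i x + ∑ j ∈ B.biUnion closedNeighbors, siteEnergy U K j x := by
  set B' := B.biUnion closedNeighbors
  have hBB' : ∀ i ∈ (B : Set (Site d)), closedNeighbors i ⊆ B' := fun i hi =>
    Finset.subset_biUnion_of_mem closedNeighbors (Finset.mem_coe.mp hi)
  set H := ∑ j ∈ B', siteEnergy U K j x
  have hH : 0 ≤ H := Finset.sum_nonneg fun j _ => siteEnergy_nonneg hK hC.nonneg j x
  have hC0 := hC.pos
  have hr : 0 < (3 + C) * H + 1 := by positivity
  let χ : ContDiffBump (0 : B → ℝ × ℝ) := ⟨(3 + C) * H + 1, (3 + C) * H + 2, hr, by linarith⟩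
  obtain ⟨y, hy0, hy⟩ := exists_hasDerivAt_of_hasCompactSupport
    (f := fun z => χ z • fun i : B => velocity U K (i : Site d) (glue B x z))
    (χ.contDiff.smul (contDiff_pi.mpr fun i => contDiff_velocity_glue B x i (n := 1)))
    (χ.hasCompactSupport.smul_right) (fun i => x i) hT
  set γ : ℝ → Config d := fun t => glue B x (y t) with hγ
  have hγ0 : γ 0 = x := by simp only [hγ, hy0, glue_restrict]
  have hderiv : ∀ i t, |t| ≤ T → HasDerivAt (fun s => γ s i)
      (χ (y t) • (B : Set (Site d)).indicator (fun j => velocity U K j (γ t)) i) t := by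
    intro i t ht
    by_cases hi : i ∈ B
    · simp only [hγ, glue_of_mem hi, indicator_of_mem (Finset.mem_coe.mpr hi)]
      exact hasDerivAt_pi.mp (hy t ht) ⟨i, hi⟩
    · simpa only [hγ, glue_of_notMem hi, indicator_of_notMem (mt Finset.mem_coe.mp hi), smul_zero]
        using hasDerivAt_const t (x i)
  have henergy : ∀ t, |t| ≤ T → ∑ j ∈ B', siteEnergy U K j (γ t) = H := fun t ht => by
    rw [sum_siteEnergy_eq_of_smul_velocity hBB' hderiv ht, hγ0]
  have hχ : ∀ t, |t| ≤ T → χ (y t) = 1 := by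
    intro t ht
    refine χ.one_of_mem_closedBall (mem_closedBall_zero_iff.mpr ?_)
    refine (pi_norm_le_iff_of_nonneg hr.le).mpr fun i => ?_
    calc ‖y t i‖ = ‖γ t i‖ := by simp only [hγ, glue_of_mem i.2]
      _ ≤ (3 + C) * H := henergy t ht ▸
        norm_le_sum_siteEnergy hC hK (hBB' i i.2 (self_mem_closedNeighbors _)) (γ t)
      _ ≤ (3 + C) * H + 1 := by linarith
  refine ⟨γ, hγ0, fun i t ht => by simpa [hχ t ht] using hderiv i t ht, fun i t ht => ?_⟩
  rw [← henergy t ht]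
  exact siteEnergy_le_of_eqOn_compl hK hC.nonneg (fun j hj => glue_of_notMem hj) i

lemma QBound.exists_isPartialSolution_cube (hd : 1 ≤ d) (hC : QuarticBounds U C) (hK : 0 ≤ K)
    {M : ℝ} {x : Config d} (hx : QBound U K M x) (N : ℕ) {T : ℝ} (hT : 0 ≤ T) :
    ∃ γ : ℝ → Config d, γ 0 = x ∧ IsPartialSolution U K (cube 0 N : Finset (Site d)) T γ ∧
      ∀ t, |t| ≤ T → QBound U K (Real.exp (energyRate d K * |t|) * spreadConst d * M) (γ t) := by
  obtain ⟨γ, hγ0, hγ, hE⟩ := exists_isPartialSolution hC hK (cube 0 N) x hT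
  refine ⟨γ, hγ0, hγ, fun t ht => QBound.of_isPartialSolution hK hC.nonneg hγ (c := 0)
    (G := growthConst d M 0 + ∑ j ∈ (cube 0 N).biUnion closedNeighbors, siteEnergy U K j x)
    (fun i s hs => ?_) (hγ0.symm ▸ hx) ht⟩
  refine (hE i s hs).trans ?_
  rw [add_mul]
  refine add_le_add (hx.siteEnergy_le_exp hd hK hC.nonneg 0 i) (le_mul_of_one_le_right
    (Finset.sum_nonneg fun j _ => siteEnergy_nonneg hK hC.nonneg j x) (Real.one_le_exp ?_))
  linarith [sdist_nonneg i 0]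

lemma continuous_siteEnergy (i : Site d) : Continuous (siteEnergy U K i) := by
  unfold siteEnergy
  exact (((by fun_prop : Continuous fun x : Config d => (x i).2 ^ 2 / 2).add
    (U.continuous.comp (by fun_prop))).add continuous_const).add (by fun_prop)

lemma continuous_cubeEnergy (ν : Site d) (k : ℕ) : Continuous (cubeEnergy U K ν k) :=
  continuous_finsetSum _ fun i _ => continuous_siteEnergy i

lemma QBound.of_tendsto {M : ℝ} {ι : Type*} {l : Filter ι} [l.NeBot] {f : ι → Config d}
    {x : Config d} (hf : Tendsto f l (𝓝 x)) (h : ∀ᶠ n in l, QBound U K M (f n)) :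
    QBound U K M x := fun ν k hk =>
  le_of_tendsto (((continuous_cubeEnergy ν k).tendsto x).comp hf) (h.mono fun _ hn => hn ν k hk)

lemma tendstoUniformlyOn_velocity (hC : QuarticBounds U C) (hK : 0 ≤ K) {α ι : Type*}
    {l : Filter ι} {s : Set α} {f : ι → α → Config d} {g : α → Config d} {k : Site d} {r : ℝ}
    (hf : ∀ᶠ n in l, ∀ a ∈ s, (f n a k).1 ^ 2 ≤ r) (hg : ∀ a ∈ s, (g a k).1 ^ 2 ≤ r)
    (hfg : ∀ j, TendstoUniformlyOn (fun n a => f n a j) (fun a => g a j) l s) :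
    TendstoUniformlyOn (fun n a => velocity U K k (f n a)) (fun a => velocity U K k (g a)) l s := by
  rw [Metric.tendstoUniformlyOn_iff]
  intro ε hε
  set A := |lipCoeff d K C (r + r)| * 3 ^ d with hA
  have hclose : ∀ᶠ n in l, ∀ j ∈ closedNeighbors k, ∀ a ∈ s, dist (g a j) (f n a j) < ε / (A + 1) :=
    (Finset.eventually_all _).mpr fun j _ =>
      Metric.tendstoUniformlyOn_iff.mp (hfg j) _ (by positivity)
  filter_upwards [hf, hclose] with n hfn hn a ha
  rw [dist_eq_norm]
  calc ‖velocity U K k (g a) - velocity U K k (f n a)‖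
      ≤ lipCoeff d K C ((g a k).1 ^ 2 + (f n a k).1 ^ 2) *
          ∑ j ∈ closedNeighbors k, ‖g a j - f n a j‖ := norm_velocity_sub_le hC hK k _ _
    _ ≤ |lipCoeff d K C (r + r)| * (3 ^ d * (ε / (A + 1))) := by
        gcongr
        · exact (lipCoeff_mono hC.pos.le (add_le_add (hg a ha) (hfn a ha))).trans (le_abs_self _)
        · exact sum_closedNeighbors_le (fun j hj => by simpa [dist_eq_norm] using (hn j hj a ha).le)
            (by positivity)
    _ = A / (A + 1) * ε := by rw [hA]; ring
    _ < ε := mul_lt_of_lt_one_left hε ((div_lt_one (by positivity)).mpr (lt_add_one A))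

section Limit

variable {g : ℕ → ℝ → Config d} {T M : ℝ}

lemma exists_norm_sub_le_of_isPartialSolution_cube (hd : 1 ≤ d) (hC : QuarticBounds U C)
    (hK : 0 ≤ K) (M : ℝ) (hT : 0 < T) (k : Site d) :
    ∃ A, ∀ {N N' : ℕ} {γ γ' : ℝ → Config d}, N ≤ N' →
      IsPartialSolution U K (cube 0 N : Finset (Site d)) T γ →
      IsPartialSolution U K (cube 0 N' : Finset (Site d)) T γ' →
      (∀ t, |t| ≤ T → QBound U K M (γ t)) → (∀ t, |t| ≤ T → QBound U K M (γ' t)) →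
      γ 0 = γ' 0 → ∀ t, |t| ≤ T → ‖γ t k - γ' t k‖ ≤ A * Real.exp (-(N / 2)) := by
  obtain ⟨ρ, hρ0, hρ⟩ := exists_stability hd hC hK M (0 : Site d) hT
  set H := velocityConst d K C * growthConst d M (0 : Site d)
  refine ⟨H * Real.exp (2 * sdist k 0 + ρ * T),
    fun {N N' γ γ'} hN hγ hγ' hM hM' h0 t ht => ?_⟩
  have hM0 := (hM t ht).nonneg hd hK hC.nonneg
  have hH : 0 ≤ H := mul_nonneg (velocityConst_nonneg hC hK) (growthConst_nonneg hM0 0)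
  have h := hρ (σ := 1) (H := H * Real.exp (-(N / 2))) (mod_cast cube_mono 0 hN) hγ hγ' hM hM'
    (by positivity) (by simp) (fun j hj s hs => ?_)
    (fun j => by rw [h0, sub_self, norm_zero]; positivity) t ht k
  · refine h.trans ?_
    rw [slidingWeight, mul_right_comm]
    gcongr H * Real.exp ?_ * _
    have := mul_le_mul_of_nonneg_right ((div_le_one hT).mpr ht) (sdist_nonneg k 0)
    have := mul_le_mul_of_nonneg_left ht hρ0
    linarith
  · refine ((hM' s hs).norm_velocity_le_exp hd hC hK 0 j).trans ?_
    rw [mul_assoc H, ← Real.exp_add]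
    gcongr
    linarith [lt_sdist_of_notMem_cube (mt Finset.mem_coe.mpr hj.2)]

lemma uniformCauchySeqOn_of_isPartialSolution_cube (hd : 1 ≤ d) (hC : QuarticBounds U C)
    (hK : 0 ≤ K) (hT : 0 < T)
    (hg : ∀ᶠ N : ℕ in atTop, IsPartialSolution U K (cube 0 N : Finset (Site d)) T (g N))
    (hM : ∀ᶠ N in atTop, ∀ t, |t| ≤ T → QBound U K M (g N t)) {x : Config d}
    (h0 : ∀ N, g N 0 = x) (k : Site d) :
    UniformCauchySeqOn (fun N t => g N t k) atTop {t | |t| ≤ T} := by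
  obtain ⟨A, hA⟩ := exists_norm_sub_le_of_isPartialSolution_cube hd hC hK M hT k
  have hdecay : Tendsto (fun N : ℕ => A * Real.exp (-(N / 2))) atTop (𝓝 0) := by
    simpa using (Real.tendsto_exp_neg_atTop_nhds_zero.comp
      (tendsto_natCast_atTop_atTop.atTop_div_const two_pos)).const_mul A
  rw [Metric.uniformCauchySeqOn_iff]
  intro ε hε
  obtain ⟨N₀, hN₀⟩ := eventually_atTop.mp
    ((hg.and hM).and (hdecay.eventually_lt_const (half_pos hε)))
  have hclose : ∀ n ≥ N₀, ∀ t, |t| ≤ T → dist (g n t k) (g N₀ t k) < ε / 2 := by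
    intro n hn t ht
    obtain ⟨⟨hg₀, hM₀⟩, hsmall⟩ := hN₀ N₀ le_rfl
    obtain ⟨⟨hgn, hMn⟩, -⟩ := hN₀ n hn
    rw [dist_comm, dist_eq_norm]
    exact (hA hn hg₀ hgn hM₀ hMn ((h0 N₀).trans (h0 n).symm) t ht).trans_lt hsmall
  exact ⟨N₀, fun m hm n hn t ht => (dist_triangle_right _ _ (g N₀ t k)).trans_lt
    ((add_lt_add (hclose m hm t ht) (hclose n hn t ht)).trans_eq (add_halves ε))⟩

lemma hasDerivAt_of_tendsto_isPartialSolution_cube (hd : 1 ≤ d) (hC : QuarticBounds U C)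
    (hK : 0 ≤ K) (hT : 0 < T)
    (hg : ∀ᶠ N : ℕ in atTop, IsPartialSolution U K (cube 0 N : Finset (Site d)) T (g N))
    (hM : ∀ᶠ N in atTop, ∀ t, |t| ≤ T → QBound U K M (g N t)) {x : Config d}
    (h0 : ∀ N, g N 0 = x) {γ : ℝ → Config d} (hγ : ∀ t, Tendsto (fun N => g N t) atTop (𝓝 (γ t)))
    (k : Site d) {t : ℝ} (ht : |t| < T) :
    HasDerivAt (fun s => γ s k) (velocity U K k (γ t)) t := by
  have hγ' : ∀ t k, Tendsto (fun N => g N t k) atTop (𝓝 (γ t k)) := fun t =>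
    tendsto_pi_nhds.mp (hγ t)
  have hball : Metric.ball (0 : ℝ) T ⊆ {t | |t| ≤ T} := fun s hs => (mem_ball_zero_iff.mp hs).le
  obtain ⟨ρ, -, hρ⟩ := exists_sq_position_le hd hC hK M (0 : Site d) one_pos
  refine hasDerivAt_of_tendstoUniformlyOn (l := atTop) (f := fun N s => g N s k)
    (f' := fun N s => velocity U K k (g N s)) (g' := fun s => velocity U K k (γ s))
    Metric.isOpen_ball
    (tendstoUniformlyOn_velocity hC hK (r := ρ + 1 * sdist k 0) ?_ ?_ fun j => ?_) ?_
    (fun s _ => hγ' s k) (mem_ball_zero_iff.mpr ht)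
  · filter_upwards [hM] with N hN s hs
    exact hρ _ (hN s (hball hs)) k
  · intro s hs
    exact hρ _ (QBound.of_tendsto (hγ s) (hM.mono fun N hN => hN s (hball hs))) k
  · exact ((uniformCauchySeqOn_of_isPartialSolution_cube hd hC hK hT hg hM h0 j)
      |>.tendstoUniformlyOn_of_tendsto fun s _ => hγ' s j).mono hball
  · obtain ⟨N₀, hN₀⟩ := exists_nat_ge (sdist k 0)
    filter_upwards [hg, eventually_ge_atTop N₀] with N hN hNN₀ s hs
    have hk : k ∈ cube (0 : Site d) N := by
      by_contra hk
      have : (N₀ : ℝ) ≤ N := mod_cast hNN₀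
      linarith [lt_sdist_of_notMem_cube hk]
    simpa only [indicator_of_mem (Finset.mem_coe.mpr hk)] using hN k s (hball hs)

end Limit

theorem QBound.exists_isSolution (hd : 1 ≤ d) (hC : QuarticBounds U C) (hK : 0 ≤ K) {M : ℝ}
    {x : Config d} (hx : QBound U K M x) : ∃ γ : ℝ → Config d, IsSolution U K γ ∧ γ 0 = x := by
  choose g hg0 hg hgM using fun N : ℕ =>
    hx.exists_isPartialSolution_cube hd hC hK N (Nat.cast_nonneg (α := ℝ) N)
  set M' : ℝ → ℝ := fun T => Real.exp (energyRate d K * T) * spreadConst d * M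
  have hsol : ∀ T, ∀ᶠ N : ℕ in atTop,
      IsPartialSolution U K (cube 0 N : Finset (Site d)) T (g N) := fun T => by
    filter_upwards [eventually_ge_atTop ⌈T⌉₊] with N hN i t ht
    exact hg N i t (ht.trans (Nat.ceil_le.mp hN))
  have hM : ∀ T, ∀ᶠ N in atTop, ∀ t, |t| ≤ T → QBound U K (M' T) (g N t) := fun T => by
    filter_upwards [eventually_ge_atTop ⌈T⌉₊] with N hN t ht
    have hM0 := hx.nonneg hd hK hC.nonneg
    have hsp := one_le_spreadConst (d := d)
    have hrate := energyRate_nonneg (d := d) hK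
    refine (hgM N t (ht.trans (Nat.ceil_le.mp hN))).mono ?_
    change _ ≤ Real.exp (energyRate d K * T) * spreadConst d * M
    gcongr
  have hlim : ∀ t k, ∃ z, Tendsto (fun N => g N t k) atTop (𝓝 z) := fun t k =>
    cauchySeq_tendsto_of_complete <|
      (uniformCauchySeqOn_of_isPartialSolution_cube hd hC hK (by positivity) (hsol (|t| + 1))
        (hM (|t| + 1)) hg0 k).cauchySeq (lt_add_one |t|).le
  choose γ hγ using hlim
  have hγ' : ∀ t, Tendsto (fun N => g N t) atTop (𝓝 (γ t)) := fun t => tendsto_pi_nhds.mpr (hγ t)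
  refine ⟨γ, IsSolution.of_qBound hd hK hC.nonneg (fun T => ?_) (fun T => ⟨M' T, fun t ht => ?_⟩),
    tendsto_nhds_unique (hγ' 0) (by simp only [hg0]; exact tendsto_const_nhds)⟩
  · exact isPartialSolution_univ_iff.mpr fun i t _ =>
      hasDerivAt_of_tendsto_isPartialSolution_cube hd hC hK (by positivity) (hsol (|t| + 1))
        (hM (|t| + 1)) hg0 hγ' i (lt_add_one |t|)
  · exact QBound.of_tendsto (hγ' t) ((hM T).mono fun N hN => hN t ht)

theorem existsUnique_isSolution (hd : 1 ≤ d) (hC : QuarticBounds U C) (hK : 0 ≤ K)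
    {x : Config d} (hx : x ∈ X0 U K) :
    ∃! γ : ℝ → Config d, IsSolution U K γ ∧ γ 0 = x := by
  obtain ⟨M, hM⟩ := (mem_X0_iff hd hK hC.nonneg).mp hx
  obtain ⟨γ, hγ, h0⟩ := hM.exists_isSolution hd hC hK
  exact ⟨γ, ⟨hγ, h0⟩, fun γ' h' => h'.1.eq_of_eq_zero hd hC hK hγ (h'.2.trans h0.symm)⟩

end Existence

/-! ### The flow -/

section Flow

variable {d : ℕ} {U : Polynomial ℝ} {K C M T t : ℝ} {x : Config d}

lemma flow_eq (hd : 1 ≤ d) (hC : QuarticBounds U C) (hK : 0 ≤ K) {γ : ℝ → Config d}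
    (hγ : IsSolution U K γ) (t : ℝ) : flow U K t (γ 0) = γ t := by
  have h : ∃ γ' : ℝ → Config d, IsSolution U K γ' ∧ γ' 0 = γ 0 := ⟨γ, hγ, rfl⟩
  rw [flow, dif_pos h, h.choose_spec.1.eq_of_eq_zero hd hC hK hγ h.choose_spec.2]

theorem QBound.isSolution_flow (hx : QBound U K M x) (hd : 1 ≤ d) (hC : QuarticBounds U C)
    (hK : 0 ≤ K) : IsSolution U K (fun t => flow U K t x) ∧ flow U K 0 x = x := by
  obtain ⟨γ, hγ, rfl⟩ := hx.exists_isSolution hd hC hK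
  have heq : (fun t => flow U K t (γ 0)) = γ := funext (flow_eq hd hC hK hγ)
  exact ⟨heq.symm ▸ hγ, congrFun heq 0⟩

lemma QBound.map_flow (hx : QBound U K M x) (hd : 1 ≤ d) (hC : QuarticBounds U C) (hK : 0 ≤ K)
    (ht : |t| ≤ T) :
    QBound U K (Real.exp (energyRate d K * T) * spreadConst d * M) (flow U K t x) := by
  obtain ⟨h, h0⟩ := hx.isSolution_flow hd hC hK
  refine (h.qBound hd hK hC.nonneg (M := M) (by rwa [h0]) t).mono ?_
  have := energyRate_nonneg (d := d) hK
  have := hx.nonneg hd hK hC.nonneg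
  have := one_le_spreadConst (d := d)
  gcongr

lemma IsSolution.comp_add_const {γ : ℝ → Config d} (h : IsSolution U K γ) (t₀ : ℝ) :
    IsSolution U K (fun s => γ (s + t₀)) := by
  refine ⟨fun i t => (h.deriv_q i (t + t₀)).comp_add_const t t₀,
    fun i t => (h.deriv_p i (t + t₀)).comp_add_const t t₀, fun T => ?_⟩
  obtain ⟨M, hM⟩ := h.locally_bounded (T + |t₀|)
  exact ⟨M, fun t ht => hM _ ((abs_add_le t t₀).trans (by linarith))⟩

lemma QBound.exists_update (hx : QBound U K M x) (hK : 0 ≤ K) (hU : ∀ q, 0 ≤ U.eval q)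
    (i : Site d) :
    ∃ M', ∀ z, ‖z - x i‖ ≤ 1 → QBound U K M' (Function.update x i z) := by
  obtain ⟨D, hD⟩ := (isCompact_closedBall (x i) 1).exists_bound_of_continuousOn
    (f := fun z => ∑ l ∈ closedNeighbors i, siteEnergy U K l (Function.update x i z))
    (continuous_finsetSum _ fun l _ => (continuous_siteEnergy l).comp
      (continuous_const.update i continuous_id)).continuousOn
  have hD0 : 0 ≤ D := (norm_nonneg _).trans (hD (x i) (Metric.mem_closedBall_self zero_le_one))
  refine ⟨(1 + D) * M, fun z hz ν k hk => ?_⟩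
  have hsite : ∀ l, siteEnergy U K l (Function.update x i z) ≤ (1 + D) * siteEnergy U K l x := by
    intro l
    have h₁ := siteEnergy_le_of_eqOn_compl hK hU (B := {i}) (x := x) (y := Function.update x i z)
      (fun j hj => Function.update_of_ne (Finset.notMem_singleton.mp hj) z x) l
    rw [Finset.singleton_biUnion] at h₁
    have h₂ := (le_abs_self _).trans (hD z (mem_closedBall_iff_norm.mpr hz))
    have h₃ := mul_le_mul_of_nonneg_left (one_le_siteEnergy hK hU l x) hD0
    linarith
  calc cubeEnergy U K ν k (Function.update x i z) ≤ (1 + D) * cubeEnergy U K ν k x := by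
        unfold cubeEnergy
        rw [Finset.mul_sum]
        exact Finset.sum_le_sum fun l _ => hsite l
    _ ≤ (1 + D) * (M * (2 * (k : ℝ) + 1) ^ d) := by
        gcongr
        exact hx ν k hk
    _ = (1 + D) * M * (2 * (k : ℝ) + 1) ^ d := by ring

theorem QBound.exists_lipschitz (hx : QBound U K M x) (hd : 1 ≤ d) (hC : QuarticBounds U C)
    (hK : 0 ≤ K) (i : Site d) (hT : 0 < T) :
    ∃ M' Λ : ℝ, 0 ≤ Λ ∧ ∀ z, ‖z - x i‖ ≤ 1 →
      IsSolution U K (fun t => flow U K t (Function.update x i z)) ∧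
      flow U K 0 (Function.update x i z) = Function.update x i z ∧
      (∀ t, |t| ≤ T → QBound U K M' (flow U K t (Function.update x i z))) ∧
      ∀ t, |t| ≤ T → ∀ k, ‖flow U K t (Function.update x i z) k - flow U K t x k‖ ≤
        Λ * ‖z - x i‖ * Real.exp (-(sdist k i / 2)) := by
  obtain ⟨M₁, hM₁⟩ := hx.exists_update hK hC.nonneg i
  set M' := Real.exp (energyRate d K * (2 * T)) * spreadConst d * M₁
  have hself : Function.update x i (x i) = x := Function.update_eq_self i x
  obtain ⟨ρ, hρ0, hρ⟩ := exists_stability hd hC hK M' i (T := 2 * T) (by positivity)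
  have hQ : ∀ z, ‖z - x i‖ ≤ 1 → ∀ t, |t| ≤ 2 * T →
      QBound U K M' (flow U K t (Function.update x i z)) := fun z hz t ht =>
    (hM₁ z hz).map_flow hd hC hK ht
  refine ⟨M', Real.exp (ρ * T), (Real.exp_pos _).le, fun z hz => ?_⟩
  obtain ⟨hsol, h0⟩ := (hM₁ z hz).isSolution_flow hd hC hK
  obtain ⟨hsol', h0'⟩ := hx.isSolution_flow hd hC hK
  have hinit : ∀ k, ‖flow U K 0 (Function.update x i z) k - flow U K 0 x k‖ ≤
      ‖z - x i‖ * Real.exp (-1 * sdist k i) := by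
    intro k
    rw [h0, h0']
    by_cases hk : k = i
    · subst hk
      simp [sdist_self]
    · rw [Function.update_of_ne hk, sub_self, norm_zero]
      positivity
  refine ⟨hsol, h0, fun t ht => hQ z hz t (by linarith), fun t ht k => ?_⟩
  refine (hρ subset_rfl (hsol.isPartialSolution _) (hsol'.isPartialSolution _) (hQ z hz)
    (by simpa only [hself] using hQ (x i) (by simp)) (norm_nonneg _) (by simp)
    (by simp) hinit t (by linarith) k).trans ?_
  rw [mul_comm (Real.exp (ρ * T)), mul_assoc, ← Real.exp_add, slidingWeight]
  have h₁ : |t| / (2 * T) ≤ 1 / 2 := by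
    rw [div_le_div_iff₀ (by positivity) (by norm_num)]
    linarith
  refine mul_le_mul_of_nonneg_left (Real.exp_le_exp.mpr ?_) (norm_nonneg _)
  linarith [mul_le_mul_of_nonneg_right h₁ (sdist_nonneg k i), mul_le_mul_of_nonneg_left ht hρ0]

end Flow

/-! ### Differentiability with respect to the initial state -/

section ApproxLinear

variable {E F : Type*} [NormedAddCommGroup E] [NormedSpace ℝ E] [NormedAddCommGroup F]
  [NormedSpace ℝ F] {B : ℝ} {f : E → F}

/-- Linearity on the unit ball up to quadratic errors. This is a Cauchy criterion: it gives the
differentiability of `f` at `0` without a candidate for the derivative. -/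
def IsApproxLinear (B : ℝ) (f : E → F) : Prop :=
  ∀ ⦃v v' v'' : E⦄ ⦃a b : ℝ⦄, ‖v‖ ≤ 1 → ‖v'‖ ≤ 1 → ‖v''‖ ≤ 1 → v = a • v' + b • v'' →
    ‖f v - a • f v' - b • f v''‖ ≤ B * (‖v‖ ^ 2 + |a| * ‖v'‖ ^ 2 + |b| * ‖v''‖ ^ 2)

lemma norm_sub_smul_sub_smul_le {w w' w'' : F} {c c' c'' : ℝ} (a b : ℝ) (h : ‖w‖ ≤ c)
    (h' : ‖w'‖ ≤ c') (h'' : ‖w''‖ ≤ c'') :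
    ‖w - a • w' - b • w''‖ ≤ c + |a| * c' + |b| * c'' := by
  refine (norm_sub_le _ _).trans (add_le_add ((norm_sub_le _ _).trans (add_le_add h ?_)) ?_) <;>
  · rw [norm_smul, Real.norm_eq_abs]
    gcongr

lemma eventually_norm_smul_le_one (v : E) : ∀ᶠ r : ℝ in 𝓝[>] 0, ‖r • v‖ ≤ 1 := by
  have h : Tendsto (fun r : ℝ => ‖r • v‖) (𝓝 0) (𝓝 0) := by
    simpa using (continuous_id.smul continuous_const).norm.tendsto' (0 : ℝ) ‖(0 : ℝ) • v‖ rfl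
  exact (h.mono_left nhdsWithin_le_nhds).eventually_le_const one_pos

lemma tendsto_mul_const_nhdsGT_zero (c : ℝ) : Tendsto (fun r : ℝ => r * c) (𝓝[>] 0) (𝓝 0) := by
  have h : Tendsto (fun r : ℝ => r) (𝓝[>] 0) (𝓝 0) := nhdsWithin_le_nhds
  simpa using h.mul_const c

namespace IsApproxLinear

lemma exists_tendsto_smul [CompleteSpace F] (hf : IsApproxLinear B f) (v : E) :
    ∃ w, Tendsto (fun r : ℝ => r⁻¹ • f (r • v)) (𝓝[>] 0) (𝓝 w) := by
  refine cauchy_map_iff_exists_tendsto.mp (cauchy_map_iff'.mpr ?_)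
  rw [tendsto_uniformity_iff_dist_tendsto_zero]
  have hlim : Tendsto (fun p : ℝ × ℝ => p.1 * (B * ‖v‖ ^ 2) + p.2 * (B * ‖v‖ ^ 2))
      (𝓝[>] 0 ×ˢ 𝓝[>] 0) (𝓝 0) := by
    simpa using ((tendsto_mul_const_nhdsGT_zero _).comp tendsto_fst).add
      ((tendsto_mul_const_nhdsGT_zero _).comp tendsto_snd)
  have hsmall : ∀ᶠ r : ℝ in 𝓝[>] 0, 0 < r ∧ ‖r • v‖ ≤ 1 :=
    (eventually_mem_nhdsWithin).and (eventually_norm_smul_le_one v)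
  refine squeeze_zero' (.of_forall fun _ => dist_nonneg) ?_ hlim
  filter_upwards [hsmall.prod_mk hsmall] with ⟨r, s⟩ ⟨⟨hr, hr1⟩, hs, hs1⟩
  have key := hf (v'' := 0) (a := r / s) (b := 0) hr1 hs1 (by simp)
    (by rw [smul_smul, div_mul_cancel₀ r hs.ne', smul_zero, add_zero])
  have heq : r⁻¹ • f (r • v) - s⁻¹ • f (s • v) =
      r⁻¹ • (f (r • v) - (r / s) • f (s • v) - (0 : ℝ) • f 0) := by
    rw [zero_smul, sub_zero, smul_sub, smul_smul, div_eq_mul_inv, inv_mul_cancel_left₀ hr.ne']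
  rw [dist_eq_norm, heq, norm_smul, norm_inv, Real.norm_of_nonneg hr.le, inv_mul_le_iff₀ hr]
  refine key.trans (le_of_eq ?_)
  rw [norm_smul, norm_smul, Real.norm_of_nonneg hr.le, Real.norm_of_nonneg hs.le,
    abs_of_pos (div_pos hr hs)]
  simp only [abs_zero, zero_mul, add_zero]
  field_simp

lemma norm_smul_sub_le (hf : IsApproxLinear B f) (v v' : E) (a b : ℝ) :
    ∀ᶠ r : ℝ in 𝓝[>] 0,
      ‖r⁻¹ • f (r • (a • v + b • v')) - a • r⁻¹ • f (r • v) - b • r⁻¹ • f (r • v')‖ ≤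
        r * (B * (‖a • v + b • v'‖ ^ 2 + |a| * ‖v‖ ^ 2 + |b| * ‖v'‖ ^ 2)) := by
  filter_upwards [eventually_norm_smul_le_one (a • v + b • v'), eventually_norm_smul_le_one v,
    eventually_norm_smul_le_one v', eventually_mem_nhdsWithin] with r h h₁ h₂ (hr : 0 < r)
  have key := hf (a := a) (b := b) h h₁ h₂ (by
    rw [smul_add, smul_comm r a, smul_comm r b])
  have heq : r⁻¹ • f (r • (a • v + b • v')) - a • r⁻¹ • f (r • v) - b • r⁻¹ • f (r • v') =
      r⁻¹ • (f (r • (a • v + b • v')) - a • f (r • v) - b • f (r • v')) := by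
    rw [smul_sub, smul_sub, smul_comm r⁻¹ a, smul_comm r⁻¹ b]
  rw [heq, norm_smul, norm_inv, Real.norm_of_nonneg hr.le, inv_mul_le_iff₀ hr]
  refine key.trans (le_of_eq ?_)
  rw [norm_smul r, norm_smul r, norm_smul r, Real.norm_of_nonneg hr.le]
  ring

lemma norm_sub_smul_le (hf : IsApproxLinear B f) {v : E} (hv : ‖v‖ ≤ 1) :
    ∀ᶠ r : ℝ in 𝓝[>] 0, ‖f v - r⁻¹ • f (r • v)‖ ≤ B * ‖v‖ ^ 2 + r * (B * ‖v‖ ^ 2) := by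
  filter_upwards [eventually_norm_smul_le_one v, eventually_mem_nhdsWithin] with r hr1 (hr : 0 < r)
  have key := hf (v'' := 0) (a := r⁻¹) (b := 0) hv hr1 (by simp)
    (by rw [smul_smul, inv_mul_cancel₀ hr.ne', one_smul, smul_zero, add_zero])
  rw [zero_smul, sub_zero, norm_smul, Real.norm_of_nonneg hr.le, abs_of_pos (inv_pos.mpr hr)] at key
  refine key.trans (le_of_eq ?_)
  simp only [abs_zero, zero_mul, add_zero]
  field_simp

lemma exists_linearMap [CompleteSpace F] (hf : IsApproxLinear B f) :
    ∃ L : E →ₗ[ℝ] F, ∀ v, ‖v‖ ≤ 1 → ‖f v - L v‖ ≤ B * ‖v‖ ^ 2 := by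
  choose L hL using hf.exists_tendsto_smul
  have hlin : ∀ v v' (a b : ℝ), L (a • v + b • v') = a • L v + b • L v' := fun v v' a b => by
    have h₁ := (((hL (a • v + b • v')).sub ((hL v).const_smul a)).sub ((hL v').const_smul b)).norm
    have h₂ := le_of_tendsto_of_tendsto h₁ (tendsto_mul_const_nhdsGT_zero _)
      (hf.norm_smul_sub_le v v' a b)
    rwa [norm_le_zero_iff, sub_sub, sub_eq_zero] at h₂
  refine ⟨⟨⟨L, fun v v' => by simpa using hlin v v' 1 1⟩,
    fun a v => by simpa using hlin v 0 a 0⟩, fun v hv => ?_⟩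
  have hbound : Tendsto (fun r : ℝ => B * ‖v‖ ^ 2 + r * (B * ‖v‖ ^ 2)) (𝓝[>] 0)
      (𝓝 (B * ‖v‖ ^ 2)) := by
    simpa using (tendsto_mul_const_nhdsGT_zero (B * ‖v‖ ^ 2)).const_add (B * ‖v‖ ^ 2)
  exact le_of_tendsto_of_tendsto ((hL v).const_sub (f v)).norm hbound (hf.norm_sub_smul_le hv)

theorem differentiableAt_zero [FiniteDimensional ℝ E] [CompleteSpace F]
    (hf : IsApproxLinear B f) : DifferentiableAt ℝ f 0 := by
  obtain ⟨L, hL⟩ := hf.exists_linearMap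
  have h0 : f 0 = 0 := by simpa using hL 0 (by simp)
  have hderiv : HasFDerivAt f L.toContinuousLinearMap 0 := by
    rw [hasFDerivAt_iff_isLittleO_nhds_zero]
    refine Asymptotics.IsBigO.trans_isLittleO (g := fun v : E => ‖v‖ ^ 2) ?_
      (Asymptotics.isLittleO_norm_pow_id one_lt_two)
    refine Asymptotics.IsBigO.of_bound B ?_
    filter_upwards [Metric.closedBall_mem_nhds (0 : E) one_pos] with v hv
    simpa [h0] using hL v (by simpa using hv)
  exact hderiv.differentiableAt

end IsApproxLinear

end ApproxLinear

section Linearization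

variable {d : ℕ} {U : Polynomial ℝ} {K C M T : ℝ} {x : Config d}

variable (U K) in
/-- The linearization at `x` of the velocity of the site `k`. -/
def linVelocity (x : Config d) (k : Site d) : Config d →ₗ[ℝ] ℝ × ℝ where
  toFun v := ((v k).2, -(U.derivative.derivative.eval (x k).1 * (v k).1) -
    K * ∑ j ∈ neighbors k, ((v k).1 - (v j).1))
  map_add' v w := by
    ext
    · simp
    · simp only [Pi.add_apply, Prod.fst_add, Prod.snd_add, add_sub_add_comm,
        Finset.sum_add_distrib]
      ring
  map_smul' a v := by
    ext
    · simp
    · simp only [Pi.smul_apply, Prod.smul_fst, Prod.smul_snd, smul_eq_mul, ← mul_sub,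
        ← Finset.mul_sum, RingHom.id_apply]
      ring

lemma linVelocity_apply (x : Config d) (k : Site d) (v : Config d) :
    linVelocity U K x k v = ((v k).2, -(U.derivative.derivative.eval (x k).1 * (v k).1) -
      K * ∑ j ∈ neighbors k, ((v k).1 - (v j).1)) := rfl

lemma norm_linVelocity_le (hC : QuarticBounds U C) (hK : 0 ≤ K) (x : Config d) (k : Site d)
    (v : Config d) :
    ‖linVelocity U K x k v‖ ≤ lipCoeff d K C ((x k).1 ^ 2) * ∑ j ∈ closedNeighbors k, ‖v j‖ := by
  have hC0 := hC.pos
  set D := ∑ j ∈ closedNeighbors k, ‖v j‖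
  have hk : ‖v k‖ ≤ D := Finset.single_le_sum (f := fun j => ‖v j‖)
    (fun j _ => norm_nonneg _) (self_mem_closedNeighbors k)
  have hderiv : |U.derivative.derivative.eval (x k).1 * (v k).1| ≤ C * (1 + (x k).1 ^ 2) * D := by
    rw [abs_mul]
    exact mul_le_mul (hC.deriv2_le _) ((norm_fst_le (v k)).trans hk) (abs_nonneg _) (by positivity)
  have hbond := abs_mul_sum_neighbors_sub_le hK k fun j => norm_fst_le (v j)
  have hderiv0 := (abs_nonneg _).trans hderiv
  have hbond0 := (abs_nonneg _).trans hbond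
  rw [linVelocity_apply, Prod.norm_def, Real.norm_eq_abs, Real.norm_eq_abs, lipCoeff, add_mul,
    add_mul, one_mul]
  refine max_le ((norm_snd_le (v k)).trans (by linarith)) ((abs_sub _ _).trans ?_)
  rw [abs_neg]
  exact (add_le_add hderiv hbond).trans (by linarith [norm_nonneg (v k)])

lemma norm_velocity_sub_sub_linVelocity_le (hC : QuarticBounds U C) (x y : Config d) (k : Site d) :
    ‖velocity U K k y - velocity U K k x - linVelocity U K x k (y - x)‖ ≤
      C * (1 + (x k).1 ^ 2 + (y k).1 ^ 2) * ‖y k - x k‖ ^ 2 := by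
  have hC0 := hC.pos
  have heq : velocity U K k y - velocity U K k x - linVelocity U K x k (y - x) =
      (0, -(U.derivative.eval (y k).1 - U.derivative.eval (x k).1 -
        U.derivative.derivative.eval (x k).1 * ((y k).1 - (x k).1))) := by
    ext
    · simp [velocity, linVelocity_apply]
    · simp only [velocity, linVelocity_apply, Prod.snd_sub, Prod.fst_sub, Pi.sub_apply,
        force_sub_force]
      ring
  rw [heq, Prod.norm_def, Real.norm_eq_abs, Real.norm_eq_abs, abs_neg, abs_zero]
  refine max_le (by positivity) ((hC.abs_deriv_taylor_le _ _).trans ?_)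
  refine mul_le_mul_of_nonneg_left ?_ (by positivity)
  rw [← sq_abs]
  gcongr
  exact norm_fst_le (y k - x k)

theorem exists_variation_stability (hd : 1 ≤ d) (hC : QuarticBounds U C) (hK : 0 ≤ K) (M : ℝ)
    (c : Site d) (hT : 0 < T) :
    ∃ ρ, 0 ≤ ρ ∧ ∀ {γ u u' : ℝ → Config d} {G H : ℝ},
      (∀ t, |t| ≤ T → QBound U K M (γ t)) → 0 ≤ H → u 0 = 0 →
      (∀ k t, |t| ≤ T → HasDerivAt (fun s => u s k) (u' t k) t) →
      (∀ k t, |t| ≤ T → ‖u' t k - linVelocity U K (γ t) k (u t)‖ ≤ H) →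
      (∀ k t, |t| ≤ T → ‖u t k‖ ≤ G) →
      ∀ t, |t| ≤ T → ∀ k, ‖u t k‖ ≤ H * slidingWeight c T ρ 0 k |t| := by
  obtain ⟨r, ρ, hρ, hr0, hr, hrρ⟩ := exists_lipCoeff_mul_le hd hC hK M c hT
  refine ⟨ρ, hρ, fun {γ u u' G H} hM hH h0 hu hu' hG => ?_⟩
  have hsub : IsSubsolution T (fun k => lipCoeff d K C (r k))
      (fun k _ => H * Real.exp (0 * sdist k c)) (fun k t => u t k) (fun k t => u' t k) :=
    ⟨hu, fun k t ht => ?_⟩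
  · refine hsub.norm_le_slidingWeight c hρ hH (by simp)
      (fun k => lipCoeff_nonneg hC.pos.le hK (hr0 k)) hrρ (fun k => ?_) (G := G) fun k t ht => ?_
    · simpa [h0] using hH
    · exact (hG k t ht).trans (le_mul_of_one_le_right ((norm_nonneg _).trans (hG k t ht))
        (Real.one_le_exp (by linarith [sdist_nonneg k c])))
  · have hlip := lipCoeff_mono (d := d) (K := K) hC.pos.le
      (by linarith [hr _ (hM t ht) k, sq_nonneg (γ t k).1] : (γ t k).1 ^ 2 ≤ r k)
    calc ‖u' t k‖ ≤ ‖linVelocity U K (γ t) k (u t)‖ + H := by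
          linarith [norm_le_norm_add_norm_sub' (u' t k) (linVelocity U K (γ t) k (u t)),
            hu' k t ht]
      _ ≤ lipCoeff d K C (r k) * ∑ j ∈ closedNeighbors k, ‖u t j‖ +
          H * Real.exp (0 * sdist k c) := by
          rw [zero_mul, Real.exp_zero, mul_one]
          gcongr
          exact (norm_linVelocity_le hC hK _ k _).trans (by gcongr)

variable (U K) in
/-- The change of the state at time `s` when the initial state `x` is moved by `v` at the site
`i`. -/
def displacement (x : Config d) (i : Site d) (v : ℝ × ℝ) (s : ℝ) : Config d :=
  flow U K s (Function.update x i (x i + v)) - flow U K s x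

lemma QBound.exists_displacement (hx : QBound U K M x) (hd : 1 ≤ d) (hC : QuarticBounds U C)
    (hK : 0 ≤ K) (i : Site d) (hT : 0 < T) :
    ∃ M' Λ : ℝ, (∀ s, |s| ≤ T → QBound U K M' (flow U K s x)) ∧ ∀ v, ‖v‖ ≤ 1 →
      displacement U K x i v 0 = Pi.single i v ∧
      (∀ k s, HasDerivAt (fun s => displacement U K x i v s k)
        (velocity U K k (flow U K s (Function.update x i (x i + v))) -
          velocity U K k (flow U K s x)) s) ∧
      ∀ k s, |s| ≤ T → ‖displacement U K x i v s k‖ ≤ Λ := by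
  obtain ⟨M', Λ, hΛ0, hΛ⟩ := hx.exists_lipschitz hd hC hK i hT
  obtain ⟨hsol, h0, hQ⟩ : IsSolution U K (fun t => flow U K t x) ∧ flow U K 0 x = x ∧
      ∀ t, |t| ≤ T → QBound U K M' (flow U K t x) := by
    simpa using hΛ (x i) (by simp)
  refine ⟨M', Λ, hQ, fun v hv => ?_⟩
  obtain ⟨hsol', h0', -, hlip⟩ := hΛ (x i + v) (by simpa using hv)
  refine ⟨?_, fun k s => ?_, fun k s hs => ?_⟩
  · ext1 k
    simp only [displacement, h0, h0', Pi.sub_apply]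
    by_cases hk : k = i
    · subst hk; simp
    · simp [hk]
  · exact (isPartialSolution_univ_iff.mp (hsol'.isPartialSolution |s|) k s le_rfl).sub
      (isPartialSolution_univ_iff.mp (hsol.isPartialSolution |s|) k s le_rfl)
  · refine (hlip s hs k).trans ?_
    rw [add_sub_cancel_left, mul_assoc]
    refine mul_le_of_le_one_right hΛ0 (mul_le_one₀ hv (Real.exp_pos _).le ?_)
    exact Real.exp_le_one_iff.mpr (by linarith [sdist_nonneg k i])

lemma QBound.exists_remainder_le (hx : QBound U K M x) (hd : 1 ≤ d) (hC : QuarticBounds U C)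
    (hK : 0 ≤ K) (i : Site d) (hT : 0 < T) :
    ∃ R, 0 ≤ R ∧ ∀ v : ℝ × ℝ, ‖v‖ ≤ 1 → ∀ s, |s| ≤ T → ∀ k,
      ‖velocity U K k (flow U K s (Function.update x i (x i + v))) -
        velocity U K k (flow U K s x) - linVelocity U K (flow U K s x) k
          (displacement U K x i v s)‖ ≤ R * ‖v‖ ^ 2 := by
  have hC0 := hC.pos
  obtain ⟨M', Λ, -, hΛ⟩ := hx.exists_lipschitz hd hC hK i hT
  obtain ⟨ρ, hρ0, hρ⟩ := exists_sq_position_le hd hC hK M' i one_pos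
  have hQ : ∀ s, |s| ≤ T → QBound U K M' (flow U K s x) := by
    simpa using (hΛ (x i) (by simp)).2.2.1
  refine ⟨C * (1 + 2 * (ρ + 1)) * Λ ^ 2, by positivity, fun v hv s hs k => ?_⟩
  obtain ⟨-, -, hQv, hlip⟩ := hΛ (x i + v) (by simpa using hv)
  have hdiff := hlip s hs k
  rw [add_sub_cancel_left] at hdiff
  set y := flow U K s x
  set y' := flow U K s (Function.update x i (x i + v))
  have hδ0 := sdist_nonneg k i
  have hexp : 1 + sdist k i ≤ Real.exp (sdist k i) := by
    linarith [Real.add_one_le_exp (sdist k i)]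
  have hpos : 1 + (y k).1 ^ 2 + (y' k).1 ^ 2 ≤ (1 + 2 * (ρ + 1)) * Real.exp (sdist k i) := by
    have hsum : 1 + (y k).1 ^ 2 + (y' k).1 ^ 2 ≤ (1 + 2 * (ρ + 1)) * (1 + sdist k i) := by
      linarith [hρ y (hQ s hs) k, hρ y' (hQv s hs) k, mul_nonneg hρ0 hδ0]
    exact hsum.trans (by gcongr)
  calc ‖velocity U K k y' - velocity U K k y - linVelocity U K y k (y' - y)‖
      ≤ C * (1 + (y k).1 ^ 2 + (y' k).1 ^ 2) * ‖y' k - y k‖ ^ 2 :=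
        norm_velocity_sub_sub_linVelocity_le hC y y' k
    _ ≤ C * ((1 + 2 * (ρ + 1)) * Real.exp (sdist k i)) *
          (Λ * ‖v‖ * Real.exp (-(sdist k i / 2))) ^ 2 := by gcongr
    _ = C * (1 + 2 * (ρ + 1)) * Λ ^ 2 * ‖v‖ ^ 2 := by
        have : Real.exp (sdist k i) * Real.exp (-(sdist k i / 2)) ^ 2 = 1 := by
          rw [← Real.exp_nat_mul, ← Real.exp_add, Real.exp_eq_one_iff]
          push_cast
          ring
        linear_combination C * (1 + 2 * (ρ + 1)) * Λ ^ 2 * ‖v‖ ^ 2 * this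

theorem QBound.exists_isApproxLinear_displacement (hx : QBound U K M x) (hd : 1 ≤ d)
    (hC : QuarticBounds U C) (hK : 0 ≤ K) (i : Site d) (hT : 0 < T) {t : ℝ} (ht : |t| ≤ T)
    (j : Site d) : ∃ B, IsApproxLinear B fun v => displacement U K x i v t j := by
  obtain ⟨M', Λ, hQ, hD⟩ := hx.exists_displacement hd hC hK i hT
  obtain ⟨R, hR0, hR⟩ := hx.exists_remainder_le hd hC hK i hT
  obtain ⟨ρ, -, hρ⟩ := exists_variation_stability hd hC hK M' i hT
  set D := displacement U K x i
  set D' : ℝ × ℝ → ℝ → Config d := fun v s k =>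
    velocity U K k (flow U K s (Function.update x i (x i + v))) - velocity U K k (flow U K s x)
  refine ⟨R * slidingWeight i T ρ 0 j |t|, fun v v' v'' a b hv hv' hv'' hlin => ?_⟩
  obtain ⟨h0, hderiv, hbound⟩ := hD v hv
  obtain ⟨h0', hderiv', hbound'⟩ := hD v' hv'
  obtain ⟨h0'', hderiv'', hbound''⟩ := hD v'' hv''
  refine (hρ (u := fun s => D v s - a • D v' s - b • D v'' s)
    (u' := fun s => D' v s - a • D' v' s - b • D' v'' s) (G := Λ + |a| * Λ + |b| * Λ)
    (H := R * (‖v‖ ^ 2 + |a| * ‖v'‖ ^ 2 + |b| * ‖v''‖ ^ 2)) hQ (by positivity) ?_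
    (fun k s _ => ((hderiv k s).sub ((hderiv' k s).const_smul a)).sub
      ((hderiv'' k s).const_smul b)) (fun k s hs => ?_) (fun k s hs => ?_) t ht j).trans ?_
  · have hsingle := map_add (LinearMap.single ℝ (fun _ : Site d => ℝ × ℝ) i) (a • v') (b • v'')
    rw [map_smul, map_smul, ← hlin] at hsingle
    simp only [LinearMap.single_apply] at hsingle
    rw [h0, h0', h0'', hsingle]
    abel
  · have heq : (D' v s - a • D' v' s - b • D' v'' s) k -
        linVelocity U K (flow U K s x) k (D v s - a • D v' s - b • D v'' s) =
        (D' v s k - linVelocity U K (flow U K s x) k (D v s)) -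
          a • (D' v' s k - linVelocity U K (flow U K s x) k (D v' s)) -
          b • (D' v'' s k - linVelocity U K (flow U K s x) k (D v'' s)) := by
      simp only [map_sub, map_smul, Pi.sub_apply, Pi.smul_apply, smul_sub]
      abel
    rw [heq]
    refine (norm_sub_smul_sub_smul_le a b (hR v hv s hs k) (hR v' hv' s hs k)
      (hR v'' hv'' s hs k)).trans (le_of_eq (by ring))
  · exact norm_sub_smul_sub_smul_le a b (hbound k s hs) (hbound' k s hs) (hbound'' k s hs)
  · exact le_of_eq (by ring)

theorem differentiableAt_flow (hd : 1 ≤ d) (hC : QuarticBounds U C) (hK : 0 ≤ K)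
    (hx : x ∈ X0 U K) (t : ℝ) (i j : Site d) :
    DifferentiableAt ℝ (fun z : ℝ × ℝ => flow U K t (Function.update x i z) j) (x i) := by
  obtain ⟨M, hM⟩ := (mem_X0_iff hd hK hC.nonneg).mp hx
  obtain ⟨B, hB⟩ := hM.exists_isApproxLinear_displacement hd hC hK i (T := |t| + 1)
    (by positivity) (by linarith) j
  have h : DifferentiableAt ℝ (fun v => displacement U K x i v t j) (x i - x i) := by
    rw [sub_self]
    exact hB.differentiableAt_zero
  simpa [displacement, Function.comp_def] using
    (DifferentiableAt.comp (f := fun z => z - x i) (x i) h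
      (differentiableAt_id.sub_const (x i))).add_const (flow U K t x j)

end Linearization

/-! ### Measurability of the flow -/

section Measurability

variable {d : ℕ} {U : Polynomial ℝ} {K C M : ℝ}

lemma continuous_localEnergy (ν : Site d) (k : ℕ) : Continuous (localEnergy U K ν k) := by
  unfold localEnergy
  have (i : Site d) : Continuous fun x : Config d => U.eval (x i).1 :=
    U.continuous.comp (by fun_prop)
  fun_prop

lemma isClosed_setOf_qBound (M : ℝ) : IsClosed {x : Config d | QBound U K M x} := by
  simp only [QBound, ofPred_forall]
  exact isClosed_iInter fun ν => isClosed_iInter fun k => isClosed_iInter fun _ =>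
    isClosed_le (continuous_cubeEnergy ν k) continuous_const

lemma QBound.eventually_norm_sub_le {x : Config d} (hx : QBound U K M x) (hd : 1 ≤ d)
    (hC : QuarticBounds U C) (hK : 0 ≤ K) (c : Site d) {η : ℝ} (hη : 0 < η) :
    ∀ᶠ y in 𝓝[{y | QBound U K M y}] x, ∀ k, ‖y k - x k‖ ≤ η * Real.exp (sdist k c) := by
  obtain ⟨N, hN⟩ := exists_nat_le_mul_exp (2 * (3 + C) * growthConst d M c) hη
  have hnear : ∀ᶠ y in 𝓝 x, ∀ k ∈ cube c N, ‖y k - x k‖ < η := by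
    rw [Filter.eventually_all_finset]
    intro k _
    filter_upwards [((continuous_apply k).tendsto x).eventually (Metric.ball_mem_nhds (x k) hη)]
      with y hy
    rwa [dist_eq_norm] at hy
  filter_upwards [hnear.filter_mono nhdsWithin_le_nhds, self_mem_nhdsWithin] with y hy hyM k
  by_cases hk : k ∈ cube c N
  · exact (hy k hk).le.trans (le_mul_of_one_le_right hη.le (Real.one_le_exp (sdist_nonneg k c)))
  · calc ‖y k - x k‖ ≤ 2 * (3 + C) * growthConst d M c * Real.exp (sdist k c / 2) :=
          hyM.norm_sub_le_exp hd hC hK hx c k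
      _ ≤ η * Real.exp (sdist k c / 2) * Real.exp (sdist k c / 2) :=
          mul_le_mul_of_nonneg_right (hN _ (lt_sdist_of_notMem_cube hk).le) (Real.exp_pos _).le
      _ = η * Real.exp (sdist k c) := by
          rw [mul_assoc, ← Real.exp_add, add_halves]

theorem continuousOn_flow (hd : 1 ≤ d) (hC : QuarticBounds U C) (hK : 0 ≤ K) (M t : ℝ) :
    ContinuousOn (flow U K t) {x : Config d | QBound U K M x} := by
  intro x hx
  refine tendsto_pi_nhds.mpr fun j => Metric.tendsto_nhds.mpr fun ε hε => ?_
  set T := |t| + 1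
  have hT : 0 < T := by positivity
  have htT : |t| ≤ T := by linarith
  obtain ⟨ρ, -, hρ⟩ := exists_stability hd hC hK
    (Real.exp (energyRate d K * T) * spreadConst d * M) j hT
  have hA := slidingWeight_pos j T ρ 1 j |t|
  set A := slidingWeight j T ρ 1 j |t|
  have hη : 0 < ε / (2 * A) := by positivity
  filter_upwards [QBound.eventually_norm_sub_le hx hd hC hK j hη, self_mem_nhdsWithin]
    with y hyx hy
  obtain ⟨hsolx, hx0⟩ := QBound.isSolution_flow hx hd hC hK
  obtain ⟨hsoly, hy0⟩ := QBound.isSolution_flow hy hd hC hK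
  have hstab := hρ (S := univ) (S' := univ) subset_rfl (hsoly.isPartialSolution T)
    (hsolx.isPartialSolution T) (fun s hs => QBound.map_flow hy hd hC hK hs)
    (fun s hs => QBound.map_flow hx hd hC hK hs) hη.le (σ := 1) (by simp) (by simp)
    (by simpa only [hx0, hy0, one_mul] using hyx) t htT j
  rw [dist_eq_norm]
  calc ‖flow U K t y j - flow U K t x j‖ ≤ ε / (2 * A) * A := hstab
    _ = ε / 2 := by field_simp
    _ < ε := half_lt_self hε

theorem aemeasurable_flow (hd : 1 ≤ d) (hC : QuarticBounds U C) (hK : 0 ≤ K)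
    {ω : Measure (Config d)} (hX : ∀ᵐ x ∂ω, x ∈ X0 U K) (t : ℝ) : AEMeasurable (flow U K t) ω := by
  have hcover : ∀ᵐ x ∂ω, x ∈ ⋃ n : ℕ, {x : Config d | QBound U K n x} := by
    filter_upwards [hX] with x hx
    obtain ⟨M, hM⟩ := (mem_X0_iff hd hK hC.nonneg).mp hx
    obtain ⟨n, hn⟩ := exists_nat_ge M
    exact mem_iUnion.mpr ⟨n, hM.mono hn⟩
  rw [← Measure.restrict_eq_self_of_ae_mem hcover, aemeasurable_iUnion_iff]
  exact fun n => (continuousOn_flow hd hC hK n t).aemeasurable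
    (isClosed_setOf_qBound _).measurableSet

end Measurability

/-! ### Energy estimates in invariant states -/

section BoundedDifferentiable

variable {E : Type*} [NormedAddCommGroup E] [NormedSpace ℝ E] {φ : E → ℝ}

lemma boundedDifferentiable_of_hasCompactSupport (hφ : ContDiff ℝ 1 φ)
    (hsupp : HasCompactSupport φ) : BoundedDifferentiable φ := by
  obtain ⟨A, hA⟩ := hφ.continuous.bounded_above_of_compact_support hsupp
  obtain ⟨B, hB⟩ := (hφ.continuous_fderiv one_ne_zero).bounded_above_of_compact_support
    (hsupp.fderiv ℝ)
  exact ⟨hφ.differentiable one_ne_zero, max A B, fun y =>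
    ⟨(hA y).trans (le_max_left A B), (hB y).trans (le_max_right A B)⟩⟩

lemma BoundedDifferentiable.const_sub (hφ : BoundedDifferentiable φ) (a : ℝ) :
    BoundedDifferentiable fun y => a - φ y := by
  obtain ⟨hdiff, C, hC⟩ := hφ
  refine ⟨hdiff.const_sub a, |a| + C, fun y => ⟨?_, ?_⟩⟩
  · exact (abs_sub _ _).trans (by linarith [(hC y).1])
  · rw [fderiv_const_sub, norm_neg]
    exact (hC y).2.trans (le_add_of_nonneg_left (abs_nonneg a))

end BoundedDifferentiable

section EnergyCutoff

variable {d : ℕ} {U : Polynomial ℝ} {K C : ℝ}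

lemma localEnergy_congr {ν : Site d} {k : ℕ} {x y : Config d} (h : ∀ i ∈ cube ν k, x i = y i) :
    localEnergy U K ν k x = localEnergy U K ν k y := by
  unfold localEnergy
  congr 1
  · exact Finset.sum_congr rfl fun i hi => by rw [h i hi]
  · exact Finset.sum_congr rfl fun i hi => Finset.sum_congr rfl fun j hj => by
      rw [h i hi, h j (Finset.mem_of_mem_filter j hj)]

lemma cubeEnergy_zero_le_localEnergy (hK : 0 ≤ K) (ν : Site d) (k : ℕ) (x : Config d) :
    cubeEnergy U 0 ν k x ≤ localEnergy U K ν k x := by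
  simp only [cubeEnergy, siteEnergy, localEnergy, zero_div, zero_mul, Finset.sum_const_zero,
    add_zero]
  exact le_add_of_nonneg_right
    (Finset.sum_nonneg fun _ _ => Finset.sum_nonneg fun _ _ => by positivity)

lemma norm_le_localEnergy (hC : QuarticBounds U C) (hK : 0 ≤ K) {ν i : Site d} {k : ℕ}
    (hi : i ∈ cube ν k) (x : Config d) : ‖x i‖ ≤ (3 + C) * localEnergy U K ν k x := by
  have := hC.pos
  refine (norm_le_siteEnergy hC le_rfl i x).trans ?_
  gcongr
  exact (siteEnergy_le_cubeEnergy le_rfl hC.nonneg hi x).trans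
    (cubeEnergy_zero_le_localEnergy hK ν k x)

lemma contDiff_localEnergy_glue (B : Finset (Site d)) (x : Config d) (ν : Site d) (k : ℕ)
    {n : ℕ∞} : ContDiff ℝ n fun y : B → ℝ × ℝ => localEnergy U K ν k (glue B x y) := by
  unfold localEnergy
  exact (ContDiff.sum fun i _ => ((((contDiff_glue B x i).snd.pow 2).div_const 2).add
    (contDiff_eval_glue U B x i)).add contDiff_const).add
    (ContDiff.sum fun i _ => ContDiff.sum fun j _ =>
      contDiff_const.mul (((contDiff_glue B x i).fst.sub (contDiff_glue B x j).fst).pow 2))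

variable (U K) in
/-- A smooth version of the indicator of the event that the local energy exceeds `A`: it is `0` if
the energy is at most `A` and `1` if it is at least `A + 1`. -/
def energyCutoff (ν : Site d) (k : ℕ) (A : ℝ) (x : Config d) : ℝ :=
  Real.smoothTransition (localEnergy U K ν k x - A)

lemma continuous_energyCutoff (ν : Site d) (k : ℕ) (A : ℝ) :
    Continuous (energyCutoff U K ν k A) :=
  Real.smoothTransition.continuous.comp ((continuous_localEnergy ν k).sub continuous_const)

lemma energyCutoff_nonneg (ν : Site d) (k : ℕ) (A : ℝ) (x : Config d) :
    0 ≤ energyCutoff U K ν k A x := Real.smoothTransition.nonneg _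

lemma energyCutoff_le_one (ν : Site d) (k : ℕ) (A : ℝ) (x : Config d) :
    energyCutoff U K ν k A x ≤ 1 := Real.smoothTransition.le_one _

lemma energyCutoff_eq_one {ν : Site d} {k : ℕ} {A : ℝ} {x : Config d}
    (h : A + 1 ≤ localEnergy U K ν k x) : energyCutoff U K ν k A x = 1 :=
  Real.smoothTransition.one_of_one_le (by linarith)

lemma energyCutoff_le_indicator (ν : Site d) (k : ℕ) (A : ℝ) (x : Config d) :
    energyCutoff U K ν k A x ≤ {x | A ≤ localEnergy U K ν k x}.indicator 1 x := by
  by_cases hx : A ≤ localEnergy U K ν k x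
  · rw [indicator_of_mem (by exact hx)]
    exact energyCutoff_le_one ν k A x
  · rw [indicator_of_notMem (by exact hx)]
    exact (Real.smoothTransition.zero_of_nonpos (by linarith)).le

theorem isLocalObservable_energyCutoff (hC : QuarticBounds U C) (hK : 0 ≤ K) (ν : Site d) (k : ℕ)
    (A : ℝ) : IsLocalObservable (energyCutoff U K ν k A) := by
  have hC0 := hC.pos
  set B := cube ν k
  set φ : (B → ℝ × ℝ) → ℝ := fun y => energyCutoff U K ν k A (glue B 0 y)
  have hsmooth : ContDiff ℝ 1 fun y => 1 - φ y :=
    contDiff_const.sub ((Real.smoothTransition.contDiff (n := 1)).comp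
      ((contDiff_localEnergy_glue B 0 ν k (n := 1)).sub contDiff_const))
  have hsupp : HasCompactSupport fun y => 1 - φ y := by
    refine HasCompactSupport.intro
      (isCompact_closedBall (0 : B → ℝ × ℝ) ((3 + C) * |A + 1|)) fun y hy => ?_
    suffices h : A + 1 ≤ localEnergy U K ν k (glue B 0 y) by
      simp only [φ, energyCutoff_eq_one h, sub_self]
    by_contra! hlt
    refine hy (mem_closedBall_zero_iff.mpr ((pi_norm_le_iff_of_nonneg (by positivity)).mpr
      fun i => ?_))
    have hnorm := norm_le_localEnergy hC hK i.2 (glue B 0 y)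
    rw [glue_of_mem i.2] at hnorm
    refine hnorm.trans ?_
    gcongr
    exact hlt.le.trans (le_abs_self _)
  refine ⟨B, φ, ?_, fun x => ?_⟩
  · simpa using (boundedDifferentiable_of_hasCompactSupport hsmooth hsupp).const_sub 1
  · simp only [φ, energyCutoff]
    have hglue (i) (hi : i ∈ cube ν k) : x i = glue B 0 (fun i => x i) i := by
      rw [glue_of_mem hi]
    rw [localEnergy_congr hglue]

theorem measure_energy_flow_le (hd : 1 ≤ d) (hC : QuarticBounds U C) (hK : 0 ≤ K)
    {ω : Measure (Config d)} [IsFiniteMeasure ω] (hinv : TimeInvariant U K ω)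
    (hX : ∀ᵐ x ∂ω, x ∈ X0 U K) (t : ℝ) (ν : Site d) (k : ℕ) (A : ℝ) :
    ω {x | A + 1 ≤ localEnergy U K ν k (flow U K t x)} ≤ ω {x | A ≤ localEnergy U K ν k x} := by
  set F := energyCutoff U K ν k A
  have hF : Measurable F := (continuous_energyCutoff ν k A).measurable
  have hbound : ∀ x, ‖F x‖ ≤ 1 := fun x =>
    (Real.norm_of_nonneg (energyCutoff_nonneg ν k A x)).trans_le (energyCutoff_le_one ν k A x)
  have hint : Integrable F ω := .of_bound hF.aestronglyMeasurable 1 (.of_forall hbound)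
  have hint_flow : Integrable (fun x => F (flow U K t x)) ω :=
    .of_bound (hF.comp_aemeasurable (aemeasurable_flow hd hC hK hX t)).aestronglyMeasurable 1
      (.of_forall fun x => hbound _)
  have hmeas : MeasurableSet {x : Config d | A ≤ localEnergy U K ν k x} :=
    (isClosed_le continuous_const (continuous_localEnergy ν k)).measurableSet
  rw [← ENNReal.toReal_le_toReal (measure_ne_top _ _) (measure_ne_top _ _)]
  calc ω.real {x | A + 1 ≤ localEnergy U K ν k (flow U K t x)}
      ≤ 1 * ω.real {x | 1 ≤ F (flow U K t x)} := by
        rw [one_mul]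
        exact measureReal_mono fun x hx => (energyCutoff_eq_one hx).ge
    _ ≤ ∫ x, F (flow U K t x) ∂ω :=
        mul_meas_ge_le_integral_of_nonneg (.of_forall fun x => energyCutoff_nonneg ν k A _)
          hint_flow 1
    _ = ∫ x, F x ∂ω := hinv F (isLocalObservable_energyCutoff hC hK ν k A) t
    _ ≤ ∫ x, {x | A ≤ localEnergy U K ν k x}.indicator 1 x ∂ω :=
        integral_mono hint ((integrable_const 1).indicator hmeas)
          (energyCutoff_le_indicator ν k A)
    _ = ω.real {x | A ≤ localEnergy U K ν k x} := integral_indicator_one hmeas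

end EnergyCutoff

section Superstable

variable {d : ℕ} {U : Polynomial ℝ} {K : ℝ} {ω : Measure (Config d)}

lemma Superstable.exists_measure_le (h : Superstable U K ω) (β : ℝ) :
    ∃ a, 0 ≤ a ∧ ∀ (ν : Site d) (k : ℕ),
      ω {x | a * (2 * (k : ℝ) + 1) ^ d ≤ localEnergy U K ν k x} ≤
        ENNReal.ofReal (Real.exp (-(β * (2 * (k : ℝ) + 1) ^ d))) := by
  obtain ⟨D, hD, lam₀, hlam₀, hω⟩ := h
  set lam := lam₀ / 2
  have hlam_pos : 0 < lam := half_pos hlam₀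
  refine ⟨(D + |β|) / lam, by positivity, fun ν k => ?_⟩
  set n : ℝ := (2 * (k : ℝ) + 1) ^ d
  have hn : 0 ≤ n := by positivity
  have hmeas : Measurable fun x => ENNReal.ofReal (Real.exp (lam * localEnergy U K ν k x)) :=
    (Real.continuous_exp.comp (continuous_const.mul
      (continuous_localEnergy ν k))).measurable.ennreal_ofReal
  calc ω {x | (D + |β|) / lam * n ≤ localEnergy U K ν k x}
      ≤ ω {x | ENNReal.ofReal (Real.exp ((D + |β|) * n)) ≤
          ENNReal.ofReal (Real.exp (lam * localEnergy U K ν k x))} := by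
        refine measure_mono fun x (hx : (D + |β|) / lam * n ≤ localEnergy U K ν k x) =>
          ENNReal.ofReal_le_ofReal (Real.exp_le_exp.mpr ?_)
        calc (D + |β|) * n = lam * ((D + |β|) / lam * n) := by field_simp
          _ ≤ lam * localEnergy U K ν k x := by gcongr
    _ ≤ (∫⁻ x, ENNReal.ofReal (Real.exp (lam * localEnergy U K ν k x)) ∂ω) /
          ENNReal.ofReal (Real.exp ((D + |β|) * n)) :=
        meas_ge_le_lintegral_div hmeas.aemeasurable (by simpa using Real.exp_pos _)
          ENNReal.ofReal_ne_top
    _ ≤ ENNReal.ofReal (Real.exp (D * n)) / ENNReal.ofReal (Real.exp ((D + |β|) * n)) := by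
        gcongr
        exact hω lam hlam_pos (half_lt_self hlam₀) ν k
    _ = ENNReal.ofReal (Real.exp (D * n - (D + |β|) * n)) := by
        rw [← ENNReal.ofReal_div_of_pos (Real.exp_pos _), ← Real.exp_sub]
    _ ≤ ENNReal.ofReal (Real.exp (-(β * n))) := by
        refine ENNReal.ofReal_le_ofReal (Real.exp_le_exp.mpr ?_)
        linarith [mul_le_mul_of_nonneg_right (le_abs_self β) hn]

/-- The weight `(m + 1)⁻² ∏ l, (1 + |ν l|)⁻² e⁻ᵏ` of the cube `Λ_{ν,k}` at the `m`-th time: a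
summable family that dominates the probabilities of large energies in the cubes that are
logarithmically large with respect to `ν` and `m`. -/
def tailWeight (d : ℕ) (s : ℕ × Site d × ℕ) : ℝ :=
  1 / ((s.1 : ℝ) + 1) ^ 2 * ((∏ l, 1 / (1 + |(s.2.1 l : ℝ)|) ^ 2) * Real.exp (-(s.2.2 : ℝ)))

lemma summable_tailWeight : Summable (tailWeight d) := by
  have hnat : Summable fun n : ℕ => 1 / ((n : ℝ) + 1) ^ 2 := by
    exact_mod_cast (summable_nat_add_iff 1).mpr (Real.summable_one_div_nat_pow.mpr one_lt_two)
  have hint : Summable fun n : ℤ => 1 / (1 + |(n : ℝ)|) ^ 2 := by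
    have h : Summable fun n : ℕ => 1 / (1 + |((n : ℤ) : ℝ)|) ^ 2 := by
      simpa [add_comm] using hnat
    exact .of_nat_of_neg h (by simpa using h)
  have hsite := summable_prod_pi (ι := Fin d) hint fun n => by positivity
  have hsite_nonneg (ν : Site d) : 0 ≤ ∏ l, 1 / (1 + |(ν l : ℝ)|) ^ 2 :=
    Finset.prod_nonneg fun _ _ => by positivity
  have hcube := hsite.mul_of_nonneg Real.summable_exp_neg_nat hsite_nonneg
    fun k => (Real.exp_pos _).le
  have h := hnat.mul_of_nonneg hcube (fun m => by positivity)
    fun s => mul_nonneg (hsite_nonneg s.1) (Real.exp_pos _).le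
  exact h

lemma exp_neg_two_mul_le {b L : ℝ} (hb : 0 < b) (hL : Real.log b ≤ L) :
    Real.exp (-(2 * L)) ≤ 1 / b ^ 2 := by
  have hbL : b ≤ Real.exp L := (Real.log_le_iff_le_exp hb).mp hL
  rw [Real.exp_neg, ← one_div, two_mul, Real.exp_add, ← sq]
  gcongr

lemma abs_le_sdist_zero (ν : Site d) (l : Fin d) : |(ν l : ℝ)| ≤ sdist ν 0 := by
  have h := abs_sub_le_siteDist ν 0 l
  rw [Pi.zero_apply, sub_zero] at h
  unfold sdist
  exact_mod_cast h

lemma exp_neg_two_mul_pow_le_prod {ν : Site d} {L : ℝ}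
    (hν : Real.log (Real.exp 1 + sdist ν 0) ≤ L) :
    Real.exp (-(2 * L)) ^ d ≤ ∏ l, 1 / (1 + |(ν l : ℝ)|) ^ 2 := by
  calc Real.exp (-(2 * L)) ^ d = ∏ _l : Fin d, Real.exp (-(2 * L)) := by simp
    _ ≤ ∏ l, 1 / (1 + |(ν l : ℝ)|) ^ 2 := by
      refine Finset.prod_le_prod (fun _ _ => (Real.exp_pos _).le) fun l _ =>
        exp_neg_two_mul_le (by positivity) (le_trans (Real.log_le_log (by positivity) ?_) hν)
      linarith [abs_le_sdist_zero ν l, Real.add_one_le_exp 1]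

lemma exp_le_tailWeight (hd : 1 ≤ d) {m : ℕ} {ν : Site d} {k : ℕ}
    (hν : Real.log (Real.exp 1 + sdist ν 0) < (k : ℝ) ^ d)
    (hm : Real.log (1 + m) ≤ (k : ℝ) ^ d) :
    Real.exp (-((2 * (d : ℝ) + 3) * (2 * (k : ℝ) + 1) ^ d)) ≤ tailWeight d (m, ν, k) := by
  set L : ℝ := (k : ℝ) ^ d
  set n : ℝ := (2 * (k : ℝ) + 1) ^ d
  have hk0 := Nat.cast_nonneg (α := ℝ) k
  have hLn : L ≤ n := pow_le_pow_left₀ hk0 (by linarith) d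
  have hkn : (k : ℝ) ≤ n :=
    le_trans (by linarith) (le_self_pow₀ (by linarith) (Nat.one_le_iff_ne_zero.mp hd))
  calc Real.exp (-((2 * (d : ℝ) + 3) * n))
      ≤ Real.exp (-(2 * L) + (d * (-(2 * L)) + -n)) := by
        have : (2 * (d : ℝ) + 2) * L ≤ (2 * (d : ℝ) + 2) * n := by gcongr
        exact Real.exp_le_exp.mpr (by linarith)
    _ = Real.exp (-(2 * L)) * (Real.exp (-(2 * L)) ^ d * Real.exp (-n)) := by
        rw [Real.exp_add, Real.exp_add, Real.exp_nat_mul]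
    _ ≤ tailWeight d (m, ν, k) := by
        unfold tailWeight
        gcongr
        · exact exp_neg_two_mul_le (by positivity) (by rwa [add_comm])
        · exact exp_neg_two_mul_pow_le_prod hν.le

lemma exists_forall_le_mul_of_finite {ι : Type*} {f w : ι → ℝ} {P : ι → Prop} {a : ℝ} (ha : 0 ≤ a)
    (hw : ∀ p, 1 ≤ w p) (hfin : {p | P p ∧ a * w p < f p}.Finite) :
    ∃ M, 0 ≤ M ∧ ∀ p, P p → f p ≤ M * w p := by
  obtain ⟨b, hb⟩ := (hfin.image f).bddAbove
  refine ⟨max a b, ha.trans (le_max_left a b), fun p hp => ?_⟩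
  have hw0 : 0 ≤ w p := zero_le_one.trans (hw p)
  rcases le_or_gt (f p) (a * w p) with hle | hlt
  · exact hle.trans (by gcongr; exact le_max_left a b)
  · calc f p ≤ max a b := (hb (mem_image_of_mem f ⟨hp, hlt⟩)).trans (le_max_right a b)
      _ ≤ max a b * w p := le_mul_of_one_le_right (ha.trans (le_max_left a b)) (hw p)

lemma ae_exists_localEnergy_le (hd : 1 ≤ d) (hω : Superstable U K ω) (Ψ : ℕ → Config d → Config d)
    (hΨ : ∀ m ν k A, ω {x | A + 1 ≤ localEnergy U K ν k (Ψ m x)} ≤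
      ω {x | A ≤ localEnergy U K ν k x}) :
    ∀ᵐ x ∂ω, ∃ M, 0 ≤ M ∧ ∀ p : ℕ × Site d × ℕ,
      (Real.log (Real.exp 1 + sdist p.2.1 0) < (p.2.2 : ℝ) ^ d ∧
        Real.log (1 + p.1) ≤ (p.2.2 : ℝ) ^ d) →
      localEnergy U K p.2.1 p.2.2 (Ψ p.1 x) ≤ M * (2 * (p.2.2 : ℝ) + 1) ^ d := by
  obtain ⟨a, ha0, ha⟩ := hω.exists_measure_le (2 * (d : ℝ) + 3)
  set P : ℕ × Site d × ℕ → Prop := fun p =>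
    Real.log (Real.exp 1 + sdist p.2.1 0) < (p.2.2 : ℝ) ^ d ∧
      Real.log (1 + p.1) ≤ (p.2.2 : ℝ) ^ d
  have hn : ∀ p : ℕ × Site d × ℕ, 1 ≤ (2 * (p.2.2 : ℝ) + 1) ^ d := fun p =>
    one_le_pow₀ (by linarith [Nat.cast_nonneg (α := ℝ) p.2.2])
  have hle : ∀ p, ω {x | P p ∧ (a + 1) * (2 * (p.2.2 : ℝ) + 1) ^ d <
      localEnergy U K p.2.1 p.2.2 (Ψ p.1 x)} ≤ ENNReal.ofReal (tailWeight d p) := by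
    intro ⟨m, ν, k⟩
    by_cases hp : P (m, ν, k)
    · calc _ ≤ ω {x | a * (2 * (k : ℝ) + 1) ^ d + 1 ≤ localEnergy U K ν k (Ψ m x)} :=
            measure_mono fun x hx => by
              have := hn (m, ν, k)
              simp only [mem_ofPred_eq] at hx ⊢
              linarith [hx.2]
        _ ≤ ω {x | a * (2 * (k : ℝ) + 1) ^ d ≤ localEnergy U K ν k x} := hΨ m ν k _
        _ ≤ ENNReal.ofReal (Real.exp (-((2 * (d : ℝ) + 3) * (2 * (k : ℝ) + 1) ^ d))) := ha ν k
        _ ≤ ENNReal.ofReal (tailWeight d (m, ν, k)) :=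
            ENNReal.ofReal_le_ofReal (exp_le_tailWeight hd hp.1 hp.2)
    · simp [hp]
  have hsum : ∑' p, ω {x | P p ∧ (a + 1) * (2 * (p.2.2 : ℝ) + 1) ^ d <
      localEnergy U K p.2.1 p.2.2 (Ψ p.1 x)} ≠ ∞ :=
    ne_top_of_le_ne_top summable_tailWeight.tsum_ofReal_ne_top (ENNReal.tsum_le_tsum hle)
  filter_upwards [ae_finite_setOfPred_mem hsum] with x hx
  exact exists_forall_le_mul_of_finite (by linarith) hn hx

theorem ae_exists_cubeEnergy_le (hd : 1 ≤ d) (hK : 0 ≤ K) (hU : ∀ q, 0 ≤ U.eval q)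
    (hω : Superstable U K ω) (Ψ : ℕ → Config d → Config d)
    (hΨ : ∀ m ν k A, ω {x | A + 1 ≤ localEnergy U K ν k (Ψ m x)} ≤
      ω {x | A ≤ localEnergy U K ν k x}) :
    ∀ᵐ x ∂ω, ∃ M, 0 ≤ M ∧ ∀ (m : ℕ) (ν : Site d) (k : ℕ),
      Real.log (Real.exp 1 + sdist ν 0) < (k : ℝ) ^ d → Real.log (1 + m) ≤ (k : ℝ) ^ d →
        cubeEnergy U K ν k (Ψ m x) ≤ M * (2 * (k : ℝ) + 1) ^ d := by
  filter_upwards [ae_exists_localEnergy_le hd hω Ψ hΨ] with x ⟨M, hM0, hM⟩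
  refine ⟨3 ^ d * M, by positivity, fun m ν k hν hm => ?_⟩
  have hpow : (k : ℝ) ^ d ≤ ((k + 1 : ℕ) : ℝ) ^ d := by
    gcongr
    exact k.le_succ
  calc cubeEnergy U K ν k (Ψ m x) ≤ localEnergy U K ν (k + 1) (Ψ m x) :=
        cubeEnergy_le_localEnergy hK hU ν k _
    _ ≤ M * (2 * ((k + 1 : ℕ) : ℝ) + 1) ^ d :=
        hM (m, ν, k + 1) ⟨hν.trans_le hpow, hm.trans hpow⟩
    _ ≤ M * (3 ^ d * (2 * (k : ℝ) + 1) ^ d) := by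
        gcongr
        exact two_mul_succ_add_one_pow_le d k
    _ = 3 ^ d * M * (2 * (k : ℝ) + 1) ^ d := by ring

theorem ae_mem_X0 (hd : 1 ≤ d) (hK : 0 ≤ K) (hU : ∀ q, 0 ≤ U.eval q) (hω : Superstable U K ω) :
    ∀ᵐ x ∂ω, x ∈ X0 U K := by
  have h := ae_exists_cubeEnergy_le hd hK hU hω (fun _ x => x) fun _ ν k A =>
    measure_mono fun x (hx : A + 1 ≤ localEnergy U K ν k x) => show A ≤ _ by linarith
  filter_upwards [h] with x ⟨M, _, hM⟩
  exact (mem_X0_iff hd hK hU).mpr ⟨M, fun ν k hk => hM 0 ν k hk (by simp)⟩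

end Superstable

/-! ### Propagation of perturbations -/

section LogGrowth

variable {d : ℕ} {U : Polynomial ℝ} {K C : ℝ}

variable (U K) in
/-- The energies along the trajectory of `x` grow at most logarithmically in space and time, with
constant `B`. -/
def LogGrowth (B : ℝ) (x : Config d) : Prop :=
  ∀ (s : ℝ) (ν : Site d),
    siteEnergy U K ν (flow U K s x) ≤ B * Real.log (Real.exp 1 + sdist ν 0 + |s|)

lemma one_le_log_add_sdist_add (ν : Site d) {a : ℝ} (ha : 0 ≤ a) :
    1 ≤ Real.log (Real.exp 1 + sdist ν 0 + a) := by
  rw [add_assoc]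
  exact one_le_log_add (add_nonneg (sdist_nonneg ν 0) ha)

lemma LogGrowth.nonneg (hK : 0 ≤ K) (hU : ∀ q, 0 ≤ U.eval q) {B : ℝ} {x : Config d}
    (hB : LogGrowth U K B x) : 0 ≤ B :=
  (pos_of_mul_pos_left (one_pos.trans_le ((one_le_siteEnergy hK hU 0 _).trans (hB 0 0)))
    (zero_le_one.trans (one_le_log_add_sdist_add 0 (abs_nonneg 0)))).le

lemma LogGrowth.sq_position_le (hC : QuarticBounds U C) (hK : 0 ≤ K) {B : ℝ} {x : Config d}
    (hB : LogGrowth U K B x) {s T : ℝ} (hs : |s| ≤ T) (k : Site d) :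
    (flow U K s x k).1 ^ 2 ≤ √(C * (B * Real.log (Real.exp 1 + sdist k 0 + T))) := by
  have hC0 := hC.pos
  have hB0 := hB.nonneg hK hC.nonneg
  have hk0 := sdist_nonneg k 0
  refine Real.le_sqrt_of_sq_le ?_
  calc ((flow U K s x k).1 ^ 2) ^ 2 = (flow U K s x k).1 ^ 4 := by ring
    _ ≤ C * siteEnergy U K k (flow U K s x) := pow_four_position_le hC hK k _
    _ ≤ C * (B * Real.log (Real.exp 1 + sdist k 0 + |s|)) := by
        gcongr
        exact hB s k
    _ ≤ C * (B * Real.log (Real.exp 1 + sdist k 0 + T)) := by gcongr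

/-- The sign `ε` is the direction of time. -/
lemma siteEnergy_flow_le (hd : 1 ≤ d) (hC : QuarticBounds U C) (hK : 0 ≤ K) {x : Config d}
    (hx : x ∈ X0 U K) {M ε : ℝ} (hM0 : 0 ≤ M) (hε : |ε| = 1)
    (hM : ∀ (m : ℕ) (ν : Site d) (k : ℕ), Real.log (Real.exp 1 + sdist ν 0) < (k : ℝ) ^ d →
      Real.log (1 + m) ≤ (k : ℝ) ^ d →
        cubeEnergy U K ν k (flow U K (ε * m) x) ≤ M * (2 * (k : ℝ) + 1) ^ d)
    {s : ℝ} (hs : 0 ≤ s) (ν : Site d) :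
    siteEnergy U K ν (flow U K (ε * s) x) ≤
      5 ^ d * (Real.exp (energyRate d K) * spreadConst d * M) *
        Real.log (Real.exp 1 + sdist ν 0 + s) := by
  obtain ⟨M₀, hM₀⟩ := (mem_X0_iff hd hK hC.nonneg).mp hx
  obtain ⟨hsol, -⟩ := hM₀.isSolution_flow hd hC hK
  have hsp := one_le_spreadConst (d := d)
  have hν0 := sdist_nonneg ν 0
  have hrate := energyRate_nonneg (d := d) hK
  set m := ⌊s⌋₊
  have hms : (m : ℝ) ≤ s := Nat.floor_le hs
  have hstep : |ε * s - ε * m| ≤ 1 := by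
    rw [← mul_sub, abs_mul, hε, one_mul, abs_of_nonneg (sub_nonneg.mpr hms)]
    linarith [Nat.lt_floor_add_one s]
  refine siteEnergy_le_of_cubeEnergy_le hd hK hC.nonneg (by positivity)
    (one_le_log_add_sdist_add ν hs) fun k hk => ?_
  have hstart : ∀ l : ℕ, k ≤ l →
      cubeEnergy U K ν l (flow U K (0 + ε * m) x) ≤ M * (2 * (l : ℝ) + 1) ^ d := fun l hl => by
    have hkl : Real.log (Real.exp 1 + sdist ν 0 + s) < (l : ℝ) ^ d := hk.trans_le (by gcongr)
    rw [zero_add]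
    refine hM m ν l ((Real.log_le_log (by positivity) ?_).trans_lt hkl)
      ((Real.log_le_log (by positivity) ?_).trans hkl.le)
    · linarith
    · linarith [Real.add_one_le_exp 1]
  have h := (hsol.comp_add_const (ε * m)).cubeEnergy_le hd hK hC.nonneg hstart (ε * s - ε * m)
  rw [sub_add_cancel] at h
  calc cubeEnergy U K ν k (flow U K (ε * s) x)
      ≤ Real.exp (energyRate d K * 1) * (spreadConst d * (M * (2 * (k : ℝ) + 1) ^ d)) :=
        h.trans (by gcongr)
    _ = Real.exp (energyRate d K) * spreadConst d * M * (2 * (k : ℝ) + 1) ^ d := by ring_nf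

theorem ae_exists_logGrowth (hd : 1 ≤ d) (hC : QuarticBounds U C) (hK : 0 ≤ K)
    {ω : Measure (Config d)} [IsFiniteMeasure ω] (hω : Superstable U K ω)
    (hinv : TimeInvariant U K ω) : ∀ᵐ x ∂ω, x ∈ X0 U K ∧ ∃ B, LogGrowth U K B x := by
  have hX := ae_mem_X0 hd hK hC.nonneg hω
  have hbound (ε : ℝ) := ae_exists_cubeEnergy_le hd hK hC.nonneg hω (fun m => flow U K (ε * m))
    fun m ν k A => measure_energy_flow_le hd hC hK hinv hX (ε * m) ν k A
  filter_upwards [hX, hbound 1, hbound (-1)] with x hx ⟨M₁, hM₁0, hM₁⟩ ⟨M₂, hM₂0, hM₂⟩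
  have hsp := one_le_spreadConst (d := d)
  refine ⟨hx, 5 ^ d * (Real.exp (energyRate d K) * spreadConst d * max M₁ M₂), fun s ν => ?_⟩
  have hlog : 0 ≤ Real.log (Real.exp 1 + sdist ν 0 + |s|) :=
    zero_le_one.trans (one_le_log_add_sdist_add ν (abs_nonneg s))
  have hpos := siteEnergy_flow_le hd hC hK hx hM₁0 (by simp) hM₁ (abs_nonneg s) ν
  have hneg := siteEnergy_flow_le hd hC hK hx hM₂0 (by simp) hM₂ (abs_nonneg s) ν
  rcases abs_choice s with hs | hs
  · rw [one_mul, hs] at hpos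
    rw [hs] at hlog ⊢
    refine hpos.trans ?_
    gcongr
    exact le_max_left M₁ M₂
  · rw [neg_one_mul, hs, neg_neg] at hneg
    rw [hs] at hlog ⊢
    refine hneg.trans ?_
    gcongr
    exact le_max_right M₁ M₂

end LogGrowth

section Decay

variable {d : ℕ} {U : Polynomial ℝ} {K C B : ℝ}

lemma log_add_sdist_le (i k : Site d) {T : ℝ} (hT : 0 < T) :
    Real.log (Real.exp 1 + sdist k 0 + T) ≤
      Real.log (Real.exp 1 + sdist i 0 + T) + sdist k i / T := by
  have hi := sdist_nonneg i 0
  have hk := sdist_nonneg k 0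
  have hki := sdist_nonneg k i
  set y := sdist k i / T
  have : 0 ≤ y := by positivity
  have hTy : T * y = sdist k i := mul_div_cancel₀ _ hT.ne'
  calc Real.log (Real.exp 1 + sdist k 0 + T)
      ≤ Real.log ((Real.exp 1 + sdist i 0 + T) * (1 + y)) := by
        refine Real.log_le_log (by positivity) ?_
        have : 0 ≤ (Real.exp 1 + sdist i 0) * y := by positivity
        linarith [sdist_triangle k i 0]
    _ = Real.log (Real.exp 1 + sdist i 0 + T) + Real.log (1 + y) :=
        Real.log_mul (by positivity) (by positivity)
    _ ≤ Real.log (Real.exp 1 + sdist i 0 + T) + y := by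
        linarith [Real.log_le_sub_one_of_pos (show 0 < 1 + y by positivity)]

lemma sqrt_add_le_sqrt_add_div {a y D : ℝ} (ha : 0 ≤ a) (hy : 0 ≤ y) (hD : 0 < D) :
    √(a + y) ≤ √a + (D / 4 + y / D) := by
  refine Real.sqrt_le_iff.mpr ⟨by positivity, ?_⟩
  have hmean : y ≤ (D / 4 + y / D) ^ 2 := by
    have h : 4 * (D / 4) * (y / D) = y := by field_simp
    linarith [four_mul_le_sq_add (D / 4) (y / D)]
  have hcross : 0 ≤ √a * (D / 4 + y / D) := by positivity
  linarith [Real.sq_sqrt ha, add_sq (√a) (D / 4 + y / D)]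

/-- Since the square root is sublinear, replacing `k` by `i` in `√(log (|k| + T))` costs no more
than the term `|k - i| / T`, which the sliding weights absorb. -/
lemma exists_lipCoeff_le (d : ℕ) (hC : 0 ≤ C) (hK : 0 ≤ K) (hB : 0 ≤ B) :
    ∃ c₁ c₂ : ℝ, 0 ≤ c₁ ∧ 0 ≤ c₂ ∧ ∀ (i k : Site d) (T : ℝ), 0 < T →
      lipCoeff d K C (3 * √(C * (B * Real.log (Real.exp 1 + sdist k 0 + T))) + 2) *
        (3 ^ d * Real.exp 2) + 1 ≤
      c₁ + c₂ * √(Real.log (Real.exp 1 + sdist i 0 + T)) + sdist k i / T := by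
  set E := 3 ^ d * Real.exp 2
  set b := √(C * B)
  set D := 3 * C * E * b + 1 with hD
  have : 0 ≤ E := by positivity
  have : 0 ≤ b := Real.sqrt_nonneg _
  have hD0 : 0 < D := by positivity
  refine ⟨E * (1 + 3 * C + K * (3 ^ d + 1)) + 1 + 3 * C * E * b * (D / 4), 3 * C * E * b,
    by positivity, by positivity, fun i k T hT => ?_⟩
  set L := Real.log (Real.exp 1 + sdist i 0 + T)
  set y := sdist k i / T
  have hL0 : 0 ≤ L := zero_le_one.trans (one_le_log_add_sdist_add i hT.le)
  have hy0 : 0 ≤ y := div_nonneg (sdist_nonneg k i) hT.le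
  have hsqrt : √(C * (B * Real.log (Real.exp 1 + sdist k 0 + T))) ≤
      b * (√L + (D / 4 + y / D)) := by
    calc √(C * (B * Real.log (Real.exp 1 + sdist k 0 + T))) ≤ √(C * B * (L + y)) := by
          rw [mul_assoc]
          gcongr
          exact log_add_sdist_le i k hT
      _ = b * √(L + y) := Real.sqrt_mul (by positivity) _
      _ ≤ b * (√L + (D / 4 + y / D)) := by
          gcongr
          exact sqrt_add_le_sqrt_add_div hL0 hy0 hD0
  have hyD : 3 * C * E * b * (y / D) ≤ y := by
    rw [mul_div_assoc', div_le_iff₀ hD0, hD]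
    linarith
  have := mul_le_mul_of_nonneg_left hsqrt (show 0 ≤ 3 * C * E by positivity)
  unfold lipCoeff
  linarith

lemma sq_add_sq_le_of_abs_sub_le_one {p q r : ℝ} (hpq : |p - q| ≤ 1) (hq : q ^ 2 ≤ r) :
    p ^ 2 + q ^ 2 ≤ 3 * r + 2 := by
  have h : (p - q) ^ 2 ≤ 1 := (sq_le_one_iff_abs_le_one _).mpr hpq
  linarith [sq_nonneg (p - 2 * q)]

lemma QBound.eventually_norm_flow_update_sub_le_one {M : ℝ} {x : Config d} (hx : QBound U K M x)
    (hd : 1 ≤ d) (hC : QuarticBounds U C) (hK : 0 ≤ K) (i : Site d) {T : ℝ} (hT : 0 < T) :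
    ∀ᶠ z in 𝓝 (x i), IsSolution U K (fun t => flow U K t (Function.update x i z)) ∧
      flow U K 0 (Function.update x i z) = Function.update x i z ∧
      ∀ s, |s| ≤ T → ∀ k, ‖flow U K s (Function.update x i z) k - flow U K s x k‖ ≤ 1 := by
  obtain ⟨M', Λ, hΛ0, hΛ⟩ := hx.exists_lipschitz hd hC hK i hT
  filter_upwards [Metric.closedBall_mem_nhds (x i) (show 0 < 1 / (Λ + 1) by positivity)] with z hz
  rw [mem_closedBall_iff_norm, le_div_iff₀ (by positivity)] at hz
  have hz0 := norm_nonneg (z - x i)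
  have hzΛ := mul_nonneg hz0 hΛ0
  obtain ⟨hsol, hinit, -, hlip⟩ := hΛ z (by linarith)
  refine ⟨hsol, hinit, fun s hs k => (hlip s hs k).trans ?_⟩
  exact mul_le_one₀ (by linarith) (Real.exp_pos _).le
    (Real.exp_le_one_iff.mpr (by linarith [sdist_nonneg k i]))

theorem LogGrowth.exists_norm_flow_update_sub_le (hd : 1 ≤ d) (hC : QuarticBounds U C)
    (hK : 0 ≤ K) {x : Config d} (hx : x ∈ X0 U K) (hB : LogGrowth U K B x) (i : Site d) :
    ∃ c₁ c₂ : ℝ, 0 ≤ c₂ ∧ ∀ t : ℝ, 0 < t → ∀ᶠ z in 𝓝 (x i), ∀ j,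
      ‖flow U K t (Function.update x i z) j - flow U K t x j‖ ≤ ‖z - x i‖ *
        Real.exp (-(sdist j i / 2) +
          (c₁ + c₂ * √(Real.log (Real.exp 1 + sdist i 0 + 2 * t))) * t) := by
  obtain ⟨c₁, c₂, hc₁, hc₂, hcoef⟩ :=
    exists_lipCoeff_le d hC.pos.le hK (hB.nonneg hK hC.nonneg)
  refine ⟨c₁, c₂, hc₂, fun t ht => ?_⟩
  obtain ⟨M, hM⟩ := (mem_X0_iff hd hK hC.nonneg).mp hx
  obtain ⟨hsolx, hx0⟩ := hM.isSolution_flow hd hC hK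
  have hT : 0 < 2 * t := by positivity
  set ρ := c₁ + c₂ * √(Real.log (Real.exp 1 + sdist i 0 + 2 * t))
  filter_upwards [hM.eventually_norm_flow_update_sub_le_one hd hC hK i hT]
    with z ⟨hsolz, hz0, hz1⟩ j
  have hsub := (hsolz.isPartialSolution (2 * t)).isSubsolution_sub hC hK Subset.rfl
    (hsolx.isPartialSolution (2 * t))
    (r := fun k => 3 * √(C * (B * Real.log (Real.exp 1 + sdist k 0 + 2 * t))) + 2)
    (b := fun k => ‖z - x i‖ * Real.exp (-1 * sdist k i))
    (fun k s hs => sq_add_sq_le_of_abs_sub_le_one ((norm_fst_le _).trans (hz1 s hs k))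
      (hB.sq_position_le hC hK hs k))
    (fun k => by positivity) (fun k hk => absurd hk.1 hk.2)
  have hinit : ∀ k, ‖flow U K 0 (Function.update x i z) k - flow U K 0 x k‖ ≤
      ‖z - x i‖ * Real.exp (-1 * sdist k i) := fun k => by
    rw [hz0, hx0]
    rcases eq_or_ne k i with rfl | hki
    · simp [sdist_self]
    · rw [Function.update_of_ne hki, sub_self, norm_zero]
      positivity
  have h := hsub.norm_le_slidingWeight (G := 1) i (ρ := ρ) (by positivity) (norm_nonneg _)
    (by simp) (fun k => lipCoeff_nonneg hC.pos.le hK (by positivity)) (fun k => hcoef i k _ hT)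
    hinit (fun k s hs => (hz1 s hs k).trans (by
      rw [one_mul]
      exact Real.one_le_exp (by linarith [sdist_nonneg k i])))
    t (by rw [abs_of_pos ht]; linarith) j
  refine h.trans_eq ?_
  rw [slidingWeight, abs_of_pos ht]
  congr 2
  field_simp
  ring

end Decay

section PoissonBracket

variable {d : ℕ} {F G : Config d → ℝ} {x : Config d} {i : Site d} {L : ℝ}

lemma BoundedDifferentiable.exists_abs_sub_le {f : ℝ × ℝ → ℝ} (hf : BoundedDifferentiable f) :
    ∃ L, 0 ≤ L ∧ ∀ z w, |f z - f w| ≤ L * ‖z - w‖ := by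
  obtain ⟨hdiff, L, hL⟩ := hf
  exact ⟨L, (abs_nonneg _).trans (hL 0).1, fun z w =>
    convex_univ.norm_image_sub_le_of_norm_fderiv_le (𝕜 := ℝ) (fun y _ => hdiff y)
      (fun y _ => (hL y).2) (mem_univ w) (mem_univ z)⟩

lemma abs_partialQ_le (hL : 0 ≤ L)
    (h : ∀ᶠ z in 𝓝 (x i), |F (Function.update x i z) - F x| ≤ L * ‖z - x i‖) :
    |partialQ i F x| ≤ L := by
  rw [partialQ, ← Real.norm_eq_abs]
  refine norm_deriv_le_of_lip' (𝕜 := ℝ) hL ?_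
  have hc : Tendsto (fun s : ℝ => (s, (x i).2)) (𝓝 (x i).1) (𝓝 (x i)) :=
    (Continuous.prodMk_left (x i).2).tendsto (x i).1
  filter_upwards [hc.eventually h] with s hs
  simpa [Prod.norm_def] using hs

lemma abs_partialP_le (hL : 0 ≤ L)
    (h : ∀ᶠ z in 𝓝 (x i), |F (Function.update x i z) - F x| ≤ L * ‖z - x i‖) :
    |partialP i F x| ≤ L := by
  rw [partialP, ← Real.norm_eq_abs]
  refine norm_deriv_le_of_lip' (𝕜 := ℝ) hL ?_
  have hc : Tendsto (fun s : ℝ => ((x i).1, s)) (𝓝 (x i).2) (𝓝 (x i)) :=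
    (Continuous.prodMk_right (x i).1).tendsto (x i).2
  filter_upwards [hc.eventually h] with s hs
  simpa [Prod.norm_def] using hs

lemma poissonBracket_siteObs (f : ℝ × ℝ → ℝ) (i : Site d) (G : Config d → ℝ) (x : Config d) :
    poissonBracket (siteObs f i) G x = partialQ i (siteObs f i) x * partialP i G x -
      partialP i (siteObs f i) x * partialQ i G x := by
  refine tsum_eq_single i fun k hk => ?_
  simp [partialQ, partialP, siteObs, Function.update_of_ne hk.symm]

lemma abs_poissonBracket_siteObs_le {f : ℝ × ℝ → ℝ} {Lf : ℝ} (hLf : 0 ≤ Lf) (hL : 0 ≤ L)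
    (hf : ∀ z w, |f z - f w| ≤ Lf * ‖z - w‖)
    (hG : ∀ᶠ z in 𝓝 (x i), |G (Function.update x i z) - G x| ≤ L * ‖z - x i‖) :
    |poissonBracket (siteObs f i) G x| ≤ 2 * Lf * L := by
  have hfi : ∀ᶠ z in 𝓝 (x i), |siteObs f i (Function.update x i z) - siteObs f i x| ≤
      Lf * ‖z - x i‖ := .of_forall fun z => by simpa [siteObs] using hf z (x i)
  rw [poissonBracket_siteObs]
  calc _ ≤ |partialQ i (siteObs f i) x * partialP i G x| +
        |partialP i (siteObs f i) x * partialQ i G x| := abs_sub _ _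
    _ ≤ Lf * L + Lf * L := by
        rw [abs_mul, abs_mul]
        gcongr
        exacts [abs_partialQ_le hLf hfi, abs_partialP_le hL hG, abs_partialP_le hLf hfi,
          abs_partialQ_le hL hG]
    _ = 2 * Lf * L := by ring

end PoissonBracket

section LightCone

variable {d : ℕ} {U : Polynomial ℝ} {K C B : ℝ}

lemma eventually_sqrt_log_add_le (D : ℝ) :
    ∀ᶠ t : ℝ in atTop, √(Real.log (D + 2 * t)) ≤ 2 * √(Real.log t) := by
  filter_upwards [eventually_ge_atTop (2 + |D|)] with t ht
  have hD := abs_le.mp (le_refl |D|)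
  have ht2 : 2 ≤ t := by linarith [abs_nonneg D]
  have hpow : D + 2 * t ≤ t ^ 4 := by
    have h : (2 : ℝ) ^ 3 ≤ t ^ 3 := by gcongr
    nlinarith
  calc √(Real.log (D + 2 * t)) ≤ √(2 ^ 2 * Real.log t) := by
        refine Real.sqrt_le_sqrt ((Real.log_le_log (by linarith) hpow).trans_eq ?_)
        rw [Real.log_pow]
        norm_num
    _ = 2 * √(Real.log t) := by
        rw [Real.sqrt_mul (by norm_num), Real.sqrt_sq (by norm_num)]

lemma eventually_rate_le {α : ℝ} (hα : 1 / 2 < α) (a D : ℝ) {c : ℝ} (hc : 0 ≤ c) :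
    ∀ᶠ t : ℝ in atTop, a + c * √(Real.log (D + 2 * t)) - Real.log t ^ α / 2 ≤ -1 := by
  have hpow : Tendsto (fun t : ℝ => Real.log t ^ (α - 1 / 2)) atTop atTop :=
    (tendsto_rpow_atTop (by linarith)).comp Real.tendsto_log_atTop
  filter_upwards [hpow.eventually_ge_atTop (2 * (2 * c + |a| + 1)),
    Real.tendsto_log_atTop.eventually_ge_atTop 1, eventually_sqrt_log_add_le D]
    with t hexp hlog hsqrt
  have hu : 1 ≤ √(Real.log t) := Real.one_le_sqrt.mpr hlog
  have hmain : 2 * (2 * c + |a| + 1) * √(Real.log t) ≤ Real.log t ^ α := by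
    calc _ ≤ Real.log t ^ (α - 1 / 2) * √(Real.log t) := by gcongr
      _ = Real.log t ^ α := by
        rw [Real.sqrt_eq_rpow, ← Real.rpow_add (by linarith), sub_add_cancel]
  have hc' := mul_le_mul_of_nonneg_left hsqrt hc
  have ha := le_mul_of_one_le_right (show 0 ≤ |a| + 1 by positivity) hu
  linarith [le_abs_self a]

lemma LogGrowth.exists_abs_poissonBracket_le (hd : 1 ≤ d) (hC : QuarticBounds U C) (hK : 0 ≤ K)
    {x : Config d} (hx : x ∈ X0 U K) (hB : LogGrowth U K B x) {f g : ℝ × ℝ → ℝ}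
    (hf : BoundedDifferentiable f) (hg : BoundedDifferentiable g) (i : Site d) :
    ∃ A c₁ c₂ : ℝ, 0 ≤ A ∧ 0 ≤ c₂ ∧ ∀ t : ℝ, 0 < t → ∀ j,
      |poissonBracket (siteObs f i) (evolve U K t (siteObs g j)) x| ≤
        A * Real.exp (-(sdist j i / 2) +
          (c₁ + c₂ * √(Real.log (Real.exp 1 + sdist i 0 + 2 * t))) * t) := by
  obtain ⟨Lf, hLf, hfL⟩ := hf.exists_abs_sub_le
  obtain ⟨Lg, hLg, hgL⟩ := hg.exists_abs_sub_le
  obtain ⟨c₁, c₂, hc₂, hdecay⟩ := hB.exists_norm_flow_update_sub_le hd hC hK hx i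
  refine ⟨2 * Lf * Lg, c₁, c₂, by positivity, hc₂, fun t ht j => ?_⟩
  set w := Real.exp (-(sdist j i / 2) +
    (c₁ + c₂ * √(Real.log (Real.exp 1 + sdist i 0 + 2 * t))) * t)
  have hG : ∀ᶠ z in 𝓝 (x i),
      |evolve U K t (siteObs g j) (Function.update x i z) - evolve U K t (siteObs g j) x| ≤
        Lg * w * ‖z - x i‖ := by
    filter_upwards [hdecay t ht] with z hz
    calc _ ≤ Lg * ‖flow U K t (Function.update x i z) j - flow U K t x j‖ := hgL _ _
      _ ≤ Lg * (‖z - x i‖ * w) := mul_le_mul_of_nonneg_left (hz j) hLg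
      _ = Lg * w * ‖z - x i‖ := by ring
  exact (abs_poissonBracket_siteObs_le hLf (by positivity) hfL hG).trans_eq (by ring)

theorem LogGrowth.tendsto_poissonBracket (hd : 1 ≤ d) (hC : QuarticBounds U C) (hK : 0 ≤ K)
    {x : Config d} (hx : x ∈ X0 U K) (hB : LogGrowth U K B x) {f g : ℝ × ℝ → ℝ}
    (hf : BoundedDifferentiable f) (hg : BoundedDifferentiable g) {α : ℝ} (hα : 1 / 2 < α)
    (b : ℝ) (i : Site d) :
    Tendsto (fun t : ℝ => ⨆ (j : Site d) (_ : t * Real.log t ^ α < (siteDist i j : ℝ)),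
      ENNReal.ofReal (Real.exp (b * t) *
        |poissonBracket (siteObs f i) (evolve U K t (siteObs g j)) x|)) atTop (𝓝 0) := by
  obtain ⟨A, c₁, c₂, hA, hc₂, hbracket⟩ :=
    hB.exists_abs_poissonBracket_le hd hC hK hx hf hg i
  have hlim : Tendsto (fun t : ℝ => ENNReal.ofReal (A * Real.exp (-t))) atTop (𝓝 0) := by
    simpa using ENNReal.tendsto_ofReal
      ((Real.tendsto_exp_atBot.comp tendsto_neg_atTop_atBot).const_mul A)
  refine tendsto_of_tendsto_of_tendsto_of_le_of_le' tendsto_const_nhds hlim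
    (.of_forall fun _ => bot_le) ?_
  filter_upwards [eventually_rate_le hα (b + c₁) (Real.exp 1 + sdist i 0) hc₂,
    eventually_gt_atTop 0] with t hrate ht
  refine iSup₂_le fun j hj => ENNReal.ofReal_le_ofReal ?_
  set ρ := c₁ + c₂ * √(Real.log (Real.exp 1 + sdist i 0 + 2 * t))
  calc _ ≤ Real.exp (b * t) * (A * Real.exp (-(sdist j i / 2) + ρ * t)) :=
        mul_le_mul_of_nonneg_left (hbracket t ht j) (Real.exp_pos _).le
    _ = A * Real.exp (b * t + (-(sdist j i / 2) + ρ * t)) := by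
        rw [Real.exp_add (b * t)]
        ring
    _ ≤ A * Real.exp (-t) := by
        gcongr
        have hcone : t * Real.log t ^ α < sdist j i := by rwa [sdist_comm]
        have := mul_le_mul_of_nonneg_left hrate ht.le
        linarith

end LightCone

end AnharmonicLattice

end

/-- The first two conjuncts say that the time evolution and the Poisson brackets in the third one
are well defined: on `X₀` there is exactly one solution from each state, and `Φ_t(x)_j` is
differentiable in `x_i`. The supremum is taken in `[0,∞]`. -/
theorem theorem2 (d : ℕ) (hd : 1 ≤ d) (K : ℝ) (hK : 0 < K)
    (U : Polynomial ℝ) (hUdeg : U.natDegree = 4) (hUlead : 0 < U.leadingCoeff)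
    (hUnonneg : ∀ s : ℝ, 0 ≤ U.eval s)
    (ω : MeasureTheory.Measure (AnharmonicLattice.Config d))
    [MeasureTheory.IsProbabilityMeasure ω]
    (hstable : AnharmonicLattice.Superstable U K ω)
    (hinv : AnharmonicLattice.TimeInvariant U K ω) :
    (∀ x ∈ AnharmonicLattice.X0 (d := d) U K,
      ∃! γ : ℝ → AnharmonicLattice.Config d, AnharmonicLattice.IsSolution U K γ ∧ γ 0 = x) ∧
    (∀ x ∈ AnharmonicLattice.X0 (d := d) U K, ∀ (t : ℝ) (i j : AnharmonicLattice.Site d),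
      DifferentiableAt ℝ
        (fun z : ℝ × ℝ => AnharmonicLattice.flow U K t (Function.update x i z) j) (x i)) ∧
    (∀ f g : ℝ × ℝ → ℝ, AnharmonicLattice.BoundedDifferentiable f →
      AnharmonicLattice.BoundedDifferentiable g →
      ∀ α : ℝ, 1 / 2 < α → ∀ b : ℝ, 0 < b → ∀ i : AnharmonicLattice.Site d,
      ∀ᵐ x ∂ω, x ∈ AnharmonicLattice.X0 (d := d) U K ∧
        Filter.Tendsto
          (fun t : ℝ => ⨆ (j : AnharmonicLattice.Site d)
            (_ : t * Real.log t ^ α < (AnharmonicLattice.siteDist i j : ℝ)),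
            ENNReal.ofReal (Real.exp (b * t) *
              |AnharmonicLattice.poissonBracket (AnharmonicLattice.siteObs f i)
                (AnharmonicLattice.evolve U K t (AnharmonicLattice.siteObs g j)) x|))
          Filter.atTop (nhds 0)) := by
  obtain ⟨C, hC⟩ := AnharmonicLattice.exists_quarticBounds hUdeg hUnonneg
  refine ⟨fun x hx => AnharmonicLattice.existsUnique_isSolution hd hC hK.le hx,
    fun x hx t i j => AnharmonicLattice.differentiableAt_flow hd hC hK.le hx t i j,
    fun f g hf hg α hα b _ i => ?_⟩
  filter_upwards [AnharmonicLattice.ae_exists_logGrowth hd hC hK.le hstable hinv]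
    with x ⟨hx, B, hB⟩
  exact ⟨hx, hB.tendsto_poissonBracket hd hC hK.le hx hf hg hα b i⟩
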